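/- **Setting.** Let $N\ge 1$ and let $u\in(0,1)^{2N}$ with $u_1\ge u_2\ge\dots\ge u_{2N}$, and assume that the optimal pair is unique, i.e. $u_2>u_i$ for all $i\ge 3$. Write $\Delta_{2,i}=u_2-u_i$. At each time $t=0,1,2,\dots$ one pair $(i_t,j_t)$ of distinct items is played and $x_{i_t,j_t,t}=u_{i_t}u_{j_t}+\varepsilon_{i_t,j_t,t}$ is observed. The noise is independent over time, and each $\varepsilon_{i,j,t}$ is centred and sub-Gaussian with variance proxy $1/4$, $\mathbb E\,e^{\lambda\varepsilon_{i,j,t}}\le e^{\lambda^2/8}$ for all $\lambda\in\mathbb R$ (as for rewards in $[0,1]$). The regret after $T$ plays is $$R(T)=T\max_{i\ne j}u_iu_j-\sum_{t=0}^{T-1}u_{i_t}u_{j_t}.$$ **The algorithm Pair-Elim-Mono with horizon $T$** (precision $\delta=1/T$, regret minimisation). It works in rounds, grouped into windows $w=0,1,2,\dots$, and keeps confidence intervals $[Q^U_-(i,k),Q^U_+(i,k)]$ for the entries $(i,k)$ of the rows, computed from all row samples since the start, and $[Q^V_-(i,k),Q^V_+(i,k)]$ for the columns, where $(i,k)$ means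 column $i$ against row $k$, computed from the column samples of the current window. All intervals are initially $(-\infty,\infty)$. Say that row (column) $i$ is deemed smaller than row (column) $j$ if $Q_+(i,k)<Q_-(j,k)$ for some item $k$, with $Q=Q^U$ ($Q=Q^V$). The active set $S$ consists initially of all $(i,j)$, $i\ne j$. A round of window $w$ is as follows. 1. With $h=T$ for rows and $h=2^{2^w}$ for columns: every entry whose number of samples $C$ equals $k_l=\lceil 4^{l+1}\log h\rceil$ for some integer $l\ge 1$ gets the interval with centre the mean of these samples and radius $\sqrt{\log(h)/k_l}$. The other intervals are unchanged. 2. Entries are removed from $S$. If row $i$ is deemed smaller than two distinct rows, all $(i,l)$ and $(l,i)$ are removed; if row $i$ is deemed smaller than row $j$, all $(i,l)$ and $(l,i)$ except $(i,j)$ and $(j,i)$ are removed. If column $i$ is deemed smaller than two distinct columns, all $(l,i)$ are removed; if column $i$ is deemed smaller than column $j$, all $(l,i)$ except $(j,i)$ are removed. Removals by the row rules are permanent, removals by the column rules last until the end of the window. 3. Each $(i,j)\in S$, in some fixed order, is played twice in a row; the first outcome is a sample of row entry $(i,j)$, the second one a sample of column entry $(j,i)$ (column $j$ against row $i$). If $S$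 is empty, all $(i,j)$ with $i\ne j$ are sampled in this round. 4. If more than $2^{2^w}$ plays were made in the window, window $w+1$ starts: column samples and column intervals are erased and the entries removed by the column rules are reinstated. **Theorem.** There is a universal constant $c_{\mathfrak u}>0$ such that for all $N$ and $u$ as above there is a constant $c_{\mathfrak p}>0$, depending only on $N$ and $u$, such that for every integer $T\ge 3$, every such noise and every order of the entries in step 3, the expected regret of Pair-Elim-Mono with horizon $T$ satisfies $$\mathbb E[R(T)]\le c_{\mathfrak u}\,A(u)\log T+c_{\mathfrak p}\log\log T,\qquad A(u)=\sum_{i\in\{3,\dots,2N\}:\ \Delta_{2,i}>0}\frac1{u_1\Delta_{2,i}}.$$ -/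

import Mathlib

open MeasureTheory ProbabilityTheory

noncomputable section

/-- Checkpoints at which a confidence interval of precision parameter `h` is refreshed: the
sample count `c` is one of the numbers `k_l = ⌈4 ^ (l + 1) * log h⌉`, `l ≥ 1`. -/
def PairElimMono.IsCheckpoint (h : ℝ) (c : ℕ) : Prop :=
  ∃ l : ℕ, 0 < l ∧ c = ⌈(4 : ℝ) ^ (l + 1) * Real.log h⌉₊

/-- A table of confidence intervals, one for each entry `(i, k)`; `⊥` and `⊤` stand for the
trivial bounds that hold before the first checkpoint. -/
structure PairElimMono.Bounds (n : ℕ) where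
  lo : Fin n → Fin n → EReal
  hi : Fin n → Fin n → EReal

/-- The trivial confidence table. -/
def PairElimMono.Bounds.trivial (n : ℕ) : PairElimMono.Bounds n where
  lo := fun _ _ => ⊥
  hi := fun _ _ => ⊤

open scoped Classical in
/-- Update of a confidence table from sums of samples `X` and counts of samples `C`: entries whose
count is a checkpoint `k_l` get the interval of centre `X / C` and radius `√(log h / k_l)`, the
others are unchanged. -/
def PairElimMono.confidenceBound {n : ℕ} (X : Fin n → Fin n → ℝ) (C : Fin n → Fin n → ℕ) (h : ℝ)
    (Q : PairElimMono.Bounds n) : PairElimMono.Bounds n where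
  lo := fun i k =>
    if PairElimMono.IsCheckpoint h (C i k) then
      ((X i k / C i k - Real.sqrt (Real.log h / C i k) : ℝ) : EReal)
    else Q.lo i k
  hi := fun i k =>
    if PairElimMono.IsCheckpoint h (C i k) then
      ((X i k / C i k + Real.sqrt (Real.log h / C i k) : ℝ) : EReal)
    else Q.hi i k

/-- Item `i` is deemed smaller than item `j`: the two are separated when compared against some
third item `k`. (For `k = i` or `k = j` the intervals are trivial, so that nothing is separated.) -/
def PairElimMono.Bounds.Dominated {n : ℕ} (Q : PairElimMono.Bounds n) (i j : Fin n) : Prop :=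
  ∃ k : Fin n, Q.hi i k < Q.lo j k

/-- The row rules remove the entry `p`: one of the items `i` of `p` is deemed smaller than two
distinct items, or it is deemed smaller than an item `j` and `p` is neither `(i, j)` nor
`(j, i)`. -/
def PairElimMono.RowRemoved {n : ℕ} (Q : PairElimMono.Bounds n) (p : Fin n × Fin n) : Prop :=
  ∃ i : Fin n, (p.1 = i ∨ p.2 = i) ∧
    ((∃ j j' : Fin n, j ≠ j' ∧ Q.Dominated i j ∧ Q.Dominated i j') ∨
      ∃ j : Fin n, Q.Dominated i j ∧ p ≠ (i, j) ∧ p ≠ (j, i))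

/-- The column rules remove the entry `p = (l, i)`: its column `i` is deemed smaller than two
distinct columns, or it is deemed smaller than a column `j` and `p` is not `(j, i)`. -/
def PairElimMono.ColRemoved {n : ℕ} (Q : PairElimMono.Bounds n) (p : Fin n × Fin n) : Prop :=
  (∃ j j' : Fin n, j ≠ j' ∧ Q.Dominated p.2 j ∧ Q.Dominated p.2 j') ∨
    ∃ j : Fin n, Q.Dominated p.2 j ∧ p ≠ (j, p.2)

/-- Memory of the algorithm. `X`, `C` are the sums and numbers of the row samples since the start,
`Xw`, `Cw` those of the column samples in the current window (first index: the column item);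
`QU`, `QV` are the confidence tables of rows and of columns; `SU` is the set of entries not removed
by the row rules since the start and `SV` the set of entries not removed by the column rules in the
current window; `w` is the index of the window and `s` the number of plays made in it; `queue` is
the list of the entries that are still to be sampled in the current round. -/
structure PairElimMono.State (n : ℕ) where
  X : Fin n → Fin n → ℝ
  C : Fin n → Fin n → ℕ
  Xw : Fin n → Fin n → ℝ
  Cw : Fin n → Fin n → ℕ
  QU : PairElimMono.Bounds n
  QV : PairElimMono.Bounds n
  SU : Finset (Fin n × Fin n)
  SV : Finset (Fin n × Fin n)
  w : ℕ
  s : ℕ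
  queue : List (Fin n × Fin n)

/-- All entries off the diagonal. -/
def PairElimMono.allPairs (n : ℕ) : Finset (Fin n × Fin n) :=
  Finset.univ.filter fun p => p.1 ≠ p.2

open scoped Classical in
/-- Beginning of a round, with horizon `T`: update the confidence tables (precision parameter
`2 ^ 2 ^ w` for columns, `T` for rows), remove entries by the row and column rules, and plan to
sample every active entry once, in the order of the list `ord`. If no entry is left, all of them
are sampled in this round, so that a pair can be played. -/
def PairElimMono.beginRound {n : ℕ} (T : ℕ) (ord : List (Fin n × Fin n))
    (st : PairElimMono.State n) : PairElimMono.State n :=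
  let QV := PairElimMono.confidenceBound st.Xw st.Cw ((2 : ℝ) ^ 2 ^ st.w) st.QV
  let QU := PairElimMono.confidenceBound st.X st.C (T : ℝ) st.QU
  let SU := st.SU.filter fun p => ¬ PairElimMono.RowRemoved QU p
  let SV := st.SV.filter fun p => ¬ PairElimMono.ColRemoved QV p
  let S := SU ∩ SV
  { st with
    QU := QU
    QV := QV
    SU := SU
    SV := SV
    queue := if S = ∅ then ord else ord.filter fun p => p ∈ S }

/-- End of a round: if more than `2 ^ 2 ^ w` plays were made in the window, a new window starts, in
which everything that concerns columns starts afresh. -/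
def PairElimMono.endRound {n : ℕ} (st : PairElimMono.State n) : PairElimMono.State n :=
  if 2 ^ 2 ^ st.w < st.s then
    { st with
      Xw := fun _ _ => 0
      Cw := fun _ _ => 0
      QV := PairElimMono.Bounds.trivial n
      SV := PairElimMono.allPairs n
      w := st.w + 1
      s := 0 }
  else st

/-- The pair `p = (i, j)` is played twice, with outcomes `a` and `b`: `a` is a sample of row `i`
against `j`, and `b` is a sample of column `j` against `i`. -/
def PairElimMono.sample {n : ℕ} (p : Fin n × Fin n) (a b : ℝ)
    (st : PairElimMono.State n) : PairElimMono.State n :=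
  { st with
    X := fun i k => st.X i k + if (i, k) = p then a else 0
    C := fun i k => st.C i k + if (i, k) = p then 1 else 0
    Xw := fun i k => st.Xw i k + if (k, i) = p then b else 0
    Cw := fun i k => st.Cw i k + if (k, i) = p then 1 else 0
    s := st.s + 2 }

/-- The memory at the very start, before the first round. -/
def PairElimMono.init (n : ℕ) : PairElimMono.State n where
  X := fun _ _ => 0
  C := fun _ _ => 0
  Xw := fun _ _ => 0
  Cw := fun _ _ => 0
  QU := PairElimMono.Bounds.trivial n
  QV := PairElimMono.Bounds.trivial n
  SU := PairElimMono.allPairs n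
  SV := PairElimMono.allPairs n
  w := 0
  s := 0
  queue := []

/-- One iteration of the sampling loop, in which the next pair of the queue is played twice, with
outcomes read from `a` and then from `b`; after the last pair of a round the next round begins. -/
def PairElimMono.step {n : ℕ} (T : ℕ) (ord : List (Fin n × Fin n)) (a b : Fin n → Fin n → ℝ)
    (st : PairElimMono.State n) : PairElimMono.State n :=
  match st.queue with
  | [] => st
  | [p] => PairElimMono.beginRound T ord
      (PairElimMono.endRound (PairElimMono.sample p (a p.1 p.2) (b p.1 p.2) st))
  | p :: q :: rest =>
      { PairElimMono.sample p (a p.1 p.2) (b p.1 p.2) st with queue := q :: rest }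

/-- The memory before iteration `m`, when `x t i j` is the outcome of playing `(i, j)` at time `t`;
iteration `m` takes place at the times `2 * m` and `2 * m + 1`. -/
def PairElimMono.run {n : ℕ} (T : ℕ) (ord : List (Fin n × Fin n)) (x : ℕ → Fin n → Fin n → ℝ) :
    ℕ → PairElimMono.State n
  | 0 => PairElimMono.beginRound T ord (PairElimMono.init n)
  | m + 1 => PairElimMono.step T ord (x (2 * m)) (x (2 * m + 1)) (PairElimMono.run T ord x m)

/-- The pair played at time `t = 0, 1, 2, …` (`none` never occurs if there are two items). -/
def PairElimMono.play {n : ℕ} (T : ℕ) (ord : List (Fin n × Fin n)) (x : ℕ → Fin n → Fin n → ℝ)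
    (t : ℕ) : Option (Fin n × Fin n) :=
  (PairElimMono.run T ord x (t / 2)).queue.head?

/-- Expected reward of the best pair of distinct items when `W i j = u i * u j`. -/
def bestPairValue {n : ℕ} (u : Fin n → ℝ) : ℝ :=
  ⨆ p : {p : Fin n × Fin n // p.1 ≠ p.2}, u p.1.1 * u p.1.2

/-- Regret after `T` steps of a sequence of played pairs. -/
def pairRegret {n : ℕ} (u : Fin n → ℝ) (play : ℕ → Option (Fin n × Fin n)) (T : ℕ) : ℝ :=
  T * bestPairValue u - ∑ t ∈ Finset.range T, (play t).elim 0 fun p => u p.1 * u p.2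

/-- The sum of `1 / (u₁ (u₂ - u_i))` over `i ≥ 3` with `u₂ - u_i > 0` (the items `1`, `2`, `3`, …
are `0`, `1`, `2`, … in `Fin (2 * N)`). -/
def monoComplexity {N : ℕ} (hN : 1 ≤ N) (u : Fin (2 * N) → ℝ) : ℝ :=
  ∑ i ∈ Finset.univ.filter
      (fun i : Fin (2 * N) => 2 ≤ i.val ∧ 0 < u ⟨1, by omega⟩ - u i),
    1 / (u ⟨0, by omega⟩ * (u ⟨1, by omega⟩ - u i))

end

/-! Let a and b be the two best items and h_w = 2^(2^w). Entry means are products u_i u_k with u_k >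
0, so two valid intervals that separate against any k order u_i and u_j correctly. While the samples
are accurate no removal is therefore wrong: (a, b) and (b, a) stay active and column a is never
eliminated (`Invariant`, `GoodRun.invariant`). A comparison with gap g is settled once both entries
have 66 log h / g² samples (`exists_checkpoint`).

The leading term comes from the pairs that meet {a, b}. In windows with accurate columns the entries
(a, b) and (b, a) are sampled in every round. So (i, a) and (i, b) lose a row comparison for good
after O(log T / gap²) plays, and (a, j) and (b, j) lose a column comparison after O(log h_w / gap²)
plays in each window. As log h_w doubles with w, these logarithms add up to O(log T). Multiplying by
the loss per play leaves log T / gap, where gap ≥ u_a (u_b - u_i) (`GoodRun.rowPlays_le`,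
`GoodRun.colPlays_le`).

Pairs (i, j) disjoint from {a, b} must not contribute at order log T, as their column comparisons
have gaps that involve the possibly tiny u_i. If (i, j) is active, then (i, a) or (j, a) has
survived the row rules. Such an entry is sampled in every round of a window with accurate columns,
so a window of K, of order log T, plays is enough to remove it by rows (`GoodRun.window_lt`). Hence
(i, j) is played only in windows whose predecessor has inaccurate columns or h < K. The logarithms
log h_w of the windows of the second kind add up to O(log K) = O(log log T)
(`GoodRun.otherPlays_le`, `sum_earlyWindow_le`).

Failures are cheap. Rows are inaccurate with probability O(1/T), at a cost of at most T. Columns of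
window w are inaccurate with probability O(1/h_w), at a cost of O(h_w), which includes the delay of
the row removals. There are O(log log T) windows, so all this is O(log log T)
(`integral_pairRegret_le`). The probabilities come from an exponential supermartingale with
predictable selection, stopped at a prescribed number of samples (`measure_abs_sum_gt_le`,
`stopped_sum_eq`). -/

namespace PairElimMono

/-! ### Transitions within and between rounds -/

variable {n : ℕ}

/-- Number of row samples of `(i, k)` once the current round is over. -/
def State.rowCount (st : State n) (i k : Fin n) : ℕ :=
  st.C i k + if (i, k) ∈ st.queue then 1 else 0

/-- Number of column samples of `(i, k)` in the window once the current round is over. -/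
def State.colCount (st : State n) (i k : Fin n) : ℕ :=
  st.Cw i k + if (k, i) ∈ st.queue then 1 else 0

/-- Number of plays in the window once the current round is over. -/
def State.playCount (st : State n) : ℕ := st.s + 2 * st.queue.length

/-- A transition inside a round. -/
structure MidRound (st st' : State n) : Prop where
  rowCount : st'.rowCount = st.rowCount
  colCount : st'.colCount = st.colCount
  playCount : st'.playCount = st.playCount
  QU : st'.QU = st.QU
  QV : st'.QV = st.QV
  SU : st'.SU = st.SU
  SV : st'.SV = st.SV
  w : st'.w = st.w
  queue : ∃ p, st.queue = p :: st'.queue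

/-- A transition to a new round. -/
structure NextRound (T : ℕ) (ord : List (Fin n × Fin n)) (st st' : State n) : Prop where
  C : st'.C = st.rowCount
  QU : st'.QU = confidenceBound st'.X st'.C (T : ℝ) st.QU
  SU : ∀ p, p ∈ st'.SU ↔ p ∈ st.SU ∧ ¬ RowRemoved st'.QU p
  queue_sublist : st'.queue.Sublist ord
  mem_queue : (∃ p, p ∈ st'.SU ∧ p ∈ st'.SV) →
    ∀ p, p ∈ st'.queue ↔ p ∈ st'.SU ∧ p ∈ st'.SV
  window : (st'.Cw = st.colCount ∧
      st'.QV = confidenceBound st'.Xw st'.Cw ((2 : ℝ) ^ 2 ^ st'.w) st.QV ∧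
      (∀ p, p ∈ st'.SV ↔ p ∈ st.SV ∧ ¬ ColRemoved st'.QV p) ∧
      st'.s = st.playCount ∧ st'.w = st.w ∧ st.playCount ≤ 2 ^ 2 ^ st.w) ∨
    ((∀ i k, st'.Cw i k = 0) ∧
      st'.QV = confidenceBound st'.Xw st'.Cw ((2 : ℝ) ^ 2 ^ st'.w) (Bounds.trivial n) ∧
      (∀ p, p ∈ st'.SV ↔ p ∈ allPairs n ∧ ¬ ColRemoved st'.QV p) ∧
      st'.s = 0 ∧ st'.w = st.w + 1 ∧ 2 ^ 2 ^ st.w < st.playCount)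

/-- The elementary invariants of the memory. -/
structure State.WellFormed (ord : List (Fin n × Fin n)) (st : State n) : Prop where
  queue_sublist : st.queue.Sublist ord
  SU_subset : st.SU ⊆ allPairs n
  SV_subset : st.SV ⊆ allPairs n

theorem not_dominated_trivial (i j : Fin n) : ¬ (Bounds.trivial n).Dominated i j := by
  rintro ⟨k, hk⟩
  simp [Bounds.trivial] at hk

theorem beginRound_queue_sublist (T : ℕ) (ord : List (Fin n × Fin n)) (st : State n) :
    (beginRound T ord st).queue.Sublist ord := by
  simp only [beginRound]
  split_ifs
  · exact List.Sublist.refl _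
  · exact List.filter_sublist

theorem beginRound_queue_ne_nil (T : ℕ) {ord : List (Fin n × Fin n)}
    (hord : ∀ p, p ∈ ord ↔ p.1 ≠ p.2) (hne : ord ≠ []) {st : State n}
    (hSU : st.SU ⊆ allPairs n) : (beginRound T ord st).queue ≠ [] := by
  classical
  simp only [beginRound]
  split_ifs with h
  · exact hne
  · obtain ⟨p, hp⟩ := Finset.nonempty_iff_ne_empty.2 h
    have hp' : p ∈ ord := by
      have := hSU (Finset.mem_filter.1 (Finset.mem_inter.1 hp).1).1
      simpa [hord, allPairs] using this
    intro h0
    exact List.filter_eq_nil_iff.1 h0 p hp' (decide_eq_true hp)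

theorem beginRound_mem_queue (T : ℕ) {ord : List (Fin n × Fin n)}
    (hord : ∀ p, p ∈ ord ↔ p.1 ≠ p.2) {st : State n} (hSU : st.SU ⊆ allPairs n)
    (hex : ∃ p, p ∈ (beginRound T ord st).SU ∧ p ∈ (beginRound T ord st).SV)
    (p : Fin n × Fin n) : p ∈ (beginRound T ord st).queue ↔
      p ∈ (beginRound T ord st).SU ∧ p ∈ (beginRound T ord st).SV := by
  classical
  obtain ⟨q, hq⟩ := hex
  simp only [beginRound] at hq ⊢
  rw [if_neg (Finset.nonempty_iff_ne_empty.1 ⟨q, Finset.mem_inter.2 hq⟩)]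
  rw [List.mem_filter, decide_eq_true_iff, Finset.mem_inter]
  refine ⟨fun h => h.2, fun h => ⟨?_, h⟩⟩
  have := hSU (Finset.mem_filter.1 h.1).1
  simpa [hord, allPairs] using this

theorem beginRound_init_nextRound (T : ℕ) {ord : List (Fin n × Fin n)}
    (hord : ∀ p, p ∈ ord ↔ p.1 ≠ p.2) :
    NextRound T ord (init n) (beginRound T ord (init n)) where
  C := by funext i k; simp [beginRound, init, State.rowCount]
  QU := rfl
  SU := fun p => by simp [beginRound]
  queue_sublist := beginRound_queue_sublist _ _ _
  mem_queue := beginRound_mem_queue T hord subset_rfl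
  window := Or.inl ⟨by funext i k; simp [beginRound, init, State.colCount], rfl,
    fun p => by simp [beginRound], by simp [beginRound, init, State.playCount], rfl,
    by simp [init, State.playCount]⟩

/-- The sampled pair leaves the queue and, since the queue has no duplicates, does not occur later
in it; so the counts projected to the end of the round do not move. This reduces every later
induction to round boundaries. -/
theorem step_midRound (T : ℕ) (ord : List (Fin n × Fin n)) (y z : Fin n → Fin n → ℝ)
    {st : State n} (hnd : st.queue.Nodup) {p q : Fin n × Fin n} {rest : List (Fin n × Fin n)}
    (hq : st.queue = p :: q :: rest) : MidRound st (step T ord y z st) := by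
  have hstep : step T ord y z st =
      { sample p (y p.1 p.2) (z p.1 p.2) st with queue := q :: rest } := by
    rw [step, hq]
  rw [hq] at hnd
  have hp : p ∉ q :: rest := (List.nodup_cons.1 hnd).1
  rw [hstep]
  refine ⟨?_, ?_, ?_, rfl, rfl, rfl, rfl, rfl, ⟨p, hq⟩⟩
  · funext i k
    simp only [State.rowCount, sample, hq]
    by_cases h : (i, k) = p
    · rw [if_pos h, if_neg (h ▸ hp), if_pos (by rw [h]; simp)]
    · rw [if_neg h]
      simp [List.mem_cons, h]
  · funext i k
    simp only [State.colCount, sample, hq]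
    by_cases h : (k, i) = p
    · rw [if_pos h, if_neg (h ▸ hp), if_pos (by rw [h]; simp)]
    · rw [if_neg h]
      simp [List.mem_cons, h]
  · simp [State.playCount, sample, hq]
    ring

theorem step_nextRound (T : ℕ) {ord : List (Fin n × Fin n)}
    (hord : ∀ p, p ∈ ord ↔ p.1 ≠ p.2) (y z : Fin n → Fin n → ℝ)
    {st : State n} (hSU : st.SU ⊆ allPairs n) {p : Fin n × Fin n} (hq : st.queue = [p]) :
    NextRound T ord st (step T ord y z st) := by
  have hstep : step T ord y z st =
      beginRound T ord (endRound (sample p (y p.1 p.2) (z p.1 p.2) st)) := by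
    rw [step, hq]
  have hSU' : (endRound (sample p (y p.1 p.2) (z p.1 p.2) st)).SU = st.SU := by
    simp only [endRound]; split_ifs <;> rfl
  rw [hstep]
  refine ⟨?_, ?_, ?_, beginRound_queue_sublist _ _ _,
    beginRound_mem_queue T hord (hSU'.symm ▸ hSU), ?_⟩
  · funext i k
    simp only [beginRound, endRound, State.rowCount, hq, List.mem_singleton]
    split_ifs <;> simp_all [sample]
  · simp only [beginRound, endRound]
    split_ifs <;> rfl
  · intro r
    simp only [beginRound, Finset.mem_filter, hSU']
  · by_cases hw : 2 ^ 2 ^ st.w < st.s + 2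
    · right
      have he : endRound (sample p (y p.1 p.2) (z p.1 p.2) st) =
        { sample p (y p.1 p.2) (z p.1 p.2) st with
          Xw := fun _ _ => 0
          Cw := fun _ _ => 0
          QV := Bounds.trivial n
          SV := allPairs n
          w := st.w + 1
          s := 0 } := by
        rw [endRound, if_pos (by exact hw)]; rfl
      rw [he]
      exact ⟨fun _ _ => rfl, rfl, fun r => by simp [beginRound], rfl, rfl, by
        simpa [State.playCount, hq] using hw⟩
    · left
      have he : endRound (sample p (y p.1 p.2) (z p.1 p.2) st) =
        sample p (y p.1 p.2) (z p.1 p.2) st := by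
        rw [endRound, if_neg (by exact hw)]
      rw [he]
      refine ⟨?_, rfl, fun r => by
        simp only [beginRound, Finset.mem_filter]; rfl, by
        simp [State.playCount, hq, beginRound, sample], rfl, by
        simpa [State.playCount, hq] using hw⟩
      funext i k
      simp only [beginRound, sample, State.colCount, hq, List.mem_singleton]

theorem endRound_SU (st : State n) : (endRound st).SU = st.SU := by
  simp only [endRound]; split_ifs <;> rfl

theorem NextRound.wellFormed {T : ℕ} {ord : List (Fin n × Fin n)} {st st' : State n}
    (h : NextRound T ord st st') (hst : st.WellFormed ord) : st'.WellFormed ord := by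
  refine ⟨h.queue_sublist, fun p hp => hst.SU_subset ((h.SU p).1 hp).1, fun p hp => ?_⟩
  rcases h.window with h | h
  · exact hst.SV_subset ((h.2.2.1 p).1 hp).1
  · exact ((h.2.2.1 p).1 hp).1

theorem MidRound.wellFormed {ord : List (Fin n × Fin n)} {st st' : State n}
    (h : MidRound st st') (hst : st.WellFormed ord) : st'.WellFormed ord := by
  obtain ⟨p, hp⟩ := h.queue
  refine ⟨?_, h.SU ▸ hst.SU_subset, h.SV ▸ hst.SV_subset⟩
  exact (hp ▸ List.sublist_cons_self p _ : st'.queue.Sublist st.queue).trans hst.queue_sublist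

theorem run_wellFormed (T : ℕ) {ord : List (Fin n × Fin n)} (hnd : ord.Nodup)
    (hord : ∀ p, p ∈ ord ↔ p.1 ≠ p.2) (hne : ord ≠ []) (x : ℕ → Fin n → Fin n → ℝ) (m : ℕ) :
    (run T ord x m).WellFormed ord ∧ (run T ord x m).queue ≠ [] := by
  induction m with
  | zero =>
    exact ⟨(beginRound_init_nextRound T hord).wellFormed
      ⟨List.nil_sublist _, subset_rfl, subset_rfl⟩,
      beginRound_queue_ne_nil T hord hne subset_rfl⟩
  | succ m ih =>
    obtain ⟨ih, hq⟩ := ih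
    match hq' : (run T ord x m).queue with
    | [] => exact absurd hq' hq
    | [p] =>
      refine ⟨(step_nextRound T hord _ _ ih.SU_subset hq').wellFormed ih, ?_⟩
      rw [run, step, hq']
      exact beginRound_queue_ne_nil T hord hne (by rw [endRound_SU]; exact ih.SU_subset)
    | p :: q :: rest =>
      refine ⟨(step_midRound T ord _ _ (ih.queue_sublist.nodup hnd) hq').wellFormed ih, ?_⟩
      rw [run, step, hq']
      simp

theorem run_succ_cases (T : ℕ) {ord : List (Fin n × Fin n)} (hnd : ord.Nodup)
    (hord : ∀ p, p ∈ ord ↔ p.1 ≠ p.2) (hne : ord ≠ []) (x : ℕ → Fin n → Fin n → ℝ) (m : ℕ) :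
    MidRound (run T ord x m) (run T ord x (m + 1)) ∨
      (NextRound T ord (run T ord x m) (run T ord x (m + 1)) ∧
        (run T ord x m).queue.length = 1) := by
  obtain ⟨ih, hq⟩ := run_wellFormed T hnd hord hne x m
  match hq' : (run T ord x m).queue with
  | [] => exact absurd hq' hq
  | [p] => exact Or.inr ⟨step_nextRound T hord _ _ ih.SU_subset hq', rfl⟩
  | p :: q :: rest => exact Or.inl (step_midRound T ord _ _ (ih.queue_sublist.nodup hnd) hq')

/-- Induction along a run, in which the initial memory precedes the first round. -/
theorem run_induction (T : ℕ) {ord : List (Fin n × Fin n)} (hnd : ord.Nodup)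
    (hord : ∀ p, p ∈ ord ↔ p.1 ≠ p.2) (hne : ord ≠ []) (x : ℕ → Fin n → Fin n → ℝ)
    {M : ℕ} {motive : State n → Prop} (h0 : motive (init n))
    (hmid : ∀ st st', MidRound st st' → motive st → motive st')
    (hnext : ∀ st m, m < M → NextRound T ord st (run T ord x m) → motive st →
      motive (run T ord x m)) (m : ℕ) (hm : m < M) : motive (run T ord x m) := by
  induction m with
  | zero => exact hnext _ 0 hm (beginRound_init_nextRound T hord) h0
  | succ m ih =>
    rcases run_succ_cases T hnd hord hne x m with h | h
    · exact hmid _ _ h (ih (by omega))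
    · exact hnext _ _ hm h.1 (ih (by omega))

end PairElimMono

/-! ### Accuracy of the confidence tables -/

namespace PairElimMono

variable {n : ℕ}

/-- The sample count at which the confidence radius is at most `2⁻¹ ^ (l + 1)`. -/
noncomputable def checkpoint (l : ℕ) (h : ℝ) : ℕ := ⌈(4 : ℝ) ^ (l + 1) * Real.log h⌉₊

/-- The table `Q` holds valid confidence intervals for the entries `μ i k`, and each of them is as
narrow as warranted by `cnt i k - 1` samples. -/
structure Bounds.Accurate (Q : Bounds n) (cnt : Fin n → Fin n → ℕ) (h : ℝ)
    (μ : Fin n → Fin n → ℝ) : Prop where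
  lo_le : ∀ i k, Q.lo i k ≤ (μ i k : EReal)
  le_hi : ∀ i k, (μ i k : EReal) ≤ Q.hi i k
  narrow_lo : ∀ i k l, 0 < l → checkpoint l h + 1 ≤ cnt i k →
    ((μ i k - 2 * (1 / 2) ^ (l + 1) : ℝ) : EReal) ≤ Q.lo i k
  narrow_hi : ∀ i k l, 0 < l → checkpoint l h + 1 ≤ cnt i k →
    Q.hi i k ≤ ((μ i k + 2 * (1 / 2) ^ (l + 1) : ℝ) : EReal)

theorem Bounds.accurate_trivial {cnt : Fin n → Fin n → ℕ} (hcnt : ∀ i k, cnt i k = 0) (h : ℝ)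
    (μ : Fin n → Fin n → ℝ) : (Bounds.trivial n).Accurate cnt h μ where
  lo_le := fun _ _ => bot_le
  le_hi := fun _ _ => le_top
  narrow_lo := fun i k l _ hl => by rw [hcnt] at hl; omega
  narrow_hi := fun i k l _ hl => by rw [hcnt] at hl; omega

theorem sqrt_log_div_le {h : ℝ} {l c : ℕ} (hh : 0 < Real.log h) (hc : checkpoint l h ≤ c) :
    Real.sqrt (Real.log h / c) ≤ (1 / 2) ^ (l + 1) := by
  have h1 : (4 : ℝ) ^ (l + 1) * Real.log h ≤ c := (Nat.le_ceil _).trans (Nat.cast_le.2 hc)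
  have h2 : (0 : ℝ) < c := lt_of_lt_of_le (by positivity) h1
  apply Real.sqrt_le_iff.2 ⟨by positivity, ?_⟩
  rw [div_le_iff₀ h2, ← pow_mul, mul_comm (l + 1) 2, pow_mul]
  have h3 : ((1 / 2 : ℝ) ^ 2) ^ (l + 1) * 4 ^ (l + 1) = 1 := by
    rw [← mul_pow]; norm_num
  calc Real.log h = ((1 / 2 : ℝ) ^ 2) ^ (l + 1) * (4 ^ (l + 1) * Real.log h) := by
        rw [← mul_assoc, h3, one_mul]
    _ ≤ _ := by gcongr

/-- A count grows by at most one per round, so no checkpoint is skipped. A projected count of at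
least k_l + 1 means that k_l samples were there at the start of the round: either the table is
refreshed now, with at least k_l samples, or the old projected count already exceeded k_l. -/
theorem Bounds.Accurate.update {Q : Bounds n} {cnt cnt' C : Fin n → Fin n → ℕ} {h : ℝ}
    {μ X : Fin n → Fin n → ℝ} (hQ : Q.Accurate cnt h μ) (hh : 0 < Real.log h)
    (hC : ∀ i k, C i k ≤ cnt i k) (hcnt : ∀ i k, cnt' i k ≤ C i k + 1)
    (hX : ∀ i k, |X i k - C i k * μ i k| ≤ Real.sqrt (C i k * Real.log h)) :
    (confidenceBound X C h Q).Accurate cnt' h μ := by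
  have key : ∀ i k, IsCheckpoint h (C i k) →
      X i k / C i k - Real.sqrt (Real.log h / C i k) ≤ μ i k ∧
      μ i k ≤ X i k / C i k + Real.sqrt (Real.log h / C i k) := by
    rintro i k ⟨l, hl, hc⟩
    have hpos : (0 : ℝ) < C i k := by
      rw [hc]; exact_mod_cast Nat.ceil_pos.2 (by positivity)
    have hs : Real.sqrt (C i k * Real.log h) = C i k * Real.sqrt (Real.log h / C i k) := by
      have : (C i k : ℝ) * Real.log h = (C i k : ℝ) ^ 2 * (Real.log h / C i k) := by
        field_simp
      rw [this, Real.sqrt_mul (by positivity), Real.sqrt_sq hpos.le]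
    have h1 := abs_le.1 (hX i k)
    rw [hs] at h1
    have hx : X i k - C i k * μ i k = C i k * (X i k / C i k - μ i k) := by field_simp
    rw [hx, ← mul_neg] at h1
    have h2 := le_of_mul_le_mul_left h1.1 hpos
    have h3 := le_of_mul_le_mul_left h1.2 hpos
    constructor <;> linarith
  have low : ∀ i k l, 0 < l → checkpoint l h + 1 ≤ cnt' i k → ¬ IsCheckpoint h (C i k) →
      checkpoint l h + 1 ≤ cnt i k := by
    intro i k l hl h1 h2
    have h3 : C i k ≠ checkpoint l h := fun h4 => h2 ⟨l, hl, h4⟩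
    have := hcnt i k
    have := hC i k
    omega
  refine ⟨fun i k => ?_, fun i k => ?_, fun i k l hl hk => ?_, fun i k l hl hk => ?_⟩
  · simp only [confidenceBound]
    split_ifs with hc
    · exact_mod_cast (key i k hc).1
    · exact hQ.lo_le i k
  · simp only [confidenceBound]
    split_ifs with hc
    · exact_mod_cast (key i k hc).2
    · exact hQ.le_hi i k
  · simp only [confidenceBound]
    split_ifs with hc
    · have h1 := (key i k hc).2
      have h2 := sqrt_log_div_le (l := l) (c := C i k) hh (by have := hcnt i k; omega)
      apply EReal.coe_le_coe_iff.2
      linarith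
    · exact hQ.narrow_lo i k l hl (low i k l hl hk hc)
  · simp only [confidenceBound]
    split_ifs with hc
    · have h1 := (key i k hc).1
      have h2 := sqrt_log_div_le (l := l) (c := C i k) hh (by have := hcnt i k; omega)
      apply EReal.coe_le_coe_iff.2
      linarith
    · exact hQ.narrow_hi i k l hl (low i k l hl hk hc)

/-- Each endpoint is within two radii of the mean, so a gap of more than four radii separates the
intervals. -/
theorem Bounds.Accurate.dominated {Q : Bounds n} {cnt : Fin n → Fin n → ℕ} {h : ℝ}
    {μ : Fin n → Fin n → ℝ} (hQ : Q.Accurate cnt h μ) {i j k : Fin n} {l : ℕ} (hl : 0 < l)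
    (hi : checkpoint l h + 1 ≤ cnt i k) (hj : checkpoint l h + 1 ≤ cnt j k)
    (hgap : 4 * (1 / 2 : ℝ) ^ (l + 1) < μ j k - μ i k) : Q.Dominated i j :=
  ⟨k, (hQ.narrow_hi i k l hl hi).trans_lt (lt_of_lt_of_le
    (EReal.coe_lt_coe_iff.2 (by linarith)) (hQ.narrow_lo j k l hl hj))⟩

/-- The means of the entries. -/
def entryMean (u : Fin n → ℝ) (i k : Fin n) : ℝ := u i * u k

/-- The rank-one structure enters here: the common positive factor `u k` cancels, so a comparison
against any item is truthful. -/
theorem Bounds.Accurate.lt_of_dominated {Q : Bounds n} {cnt : Fin n → Fin n → ℕ} {h : ℝ}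
    {u : Fin n → ℝ} (hu : ∀ i, 0 < u i) (hQ : Q.Accurate cnt h (entryMean u)) {i j : Fin n}
    (hd : Q.Dominated i j) : u i < u j := by
  obtain ⟨k, hk⟩ := hd
  have := EReal.coe_lt_coe_iff.1 (((hQ.le_hi i k).trans_lt hk).trans_le (hQ.lo_le j k))
  exact lt_of_mul_lt_mul_right this (hu k).le

/-- The level is the least one that resolves `g`. Minimality one level earlier gives 4^k g² ≤ 4,
hence 64 log h for the checkpoint times g²; the ceiling adds at most 1 ≤ 2 log h, which makes 66. -/
theorem exists_checkpoint {g : ℝ} (hg : 0 < g) (hg1 : g < 1) :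
    ∃ l : ℕ, 0 < l ∧ 4 * (1 / 2 : ℝ) ^ (l + 1) < g ∧
      ∀ h : ℝ, 2 ≤ h → (checkpoint l h : ℝ) ≤ 66 * Real.log h / g ^ 2 := by
  classical
  have hex : ∃ l : ℕ, 2 * (1 / 2 : ℝ) ^ l < g := by
    obtain ⟨l, hl⟩ := exists_pow_lt_of_lt_one (show 0 < g / 2 by positivity)
      (show (1 / 2 : ℝ) < 1 by norm_num)
    exact ⟨l, by linarith⟩
  obtain ⟨l, hl, hmin⟩ : ∃ l : ℕ, 2 * (1 / 2 : ℝ) ^ l < g ∧ ∀ k < l, g ≤ 2 * (1 / 2 : ℝ) ^ k :=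
    ⟨Nat.find hex, Nat.find_spec hex, fun k hk => not_lt.1 (Nat.find_min hex hk)⟩
  obtain ⟨k, rfl⟩ : ∃ k, l = k + 1 := by
    cases l with
    | zero => norm_num at hl; linarith
    | succ k => exact ⟨k, rfl⟩
  refine ⟨k + 1, k.succ_pos, by rw [pow_succ]; linarith, fun h hh => ?_⟩
  have hlog : 1 / 2 ≤ Real.log h := by
    have := Real.log_two_gt_d9
    have := Real.log_le_log (by norm_num) hh
    linarith
  have h1 := hmin k (Nat.lt_succ_self k)
  have h2 : (4 : ℝ) ^ k * ((1 / 2) ^ k * (1 / 2) ^ k) = 1 := by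
    rw [← mul_pow, ← mul_pow]; norm_num
  have h3 : (4 : ℝ) ^ k * g ^ 2 ≤ 4 := by
    have : g ^ 2 ≤ 4 * ((1 / 2) ^ k * (1 / 2) ^ k) := by nlinarith
    have h4 : (0 : ℝ) < 4 ^ k := by positivity
    nlinarith
  have h5 : (checkpoint (k + 1) h : ℝ) ≤ 4 ^ (k + 1 + 1) * Real.log h + 1 :=
    (Nat.ceil_lt_add_one (by positivity)).le
  rw [le_div_iff₀ (by positivity)]
  have h6 : g ^ 2 ≤ 1 := by nlinarith
  calc (checkpoint (k + 1) h : ℝ) * g ^ 2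
      ≤ (4 ^ (k + 1 + 1) * Real.log h + 1) * g ^ 2 := by gcongr
    _ = 16 * Real.log h * (4 ^ k * g ^ 2) + g ^ 2 := by ring
    _ ≤ 16 * Real.log h * 4 + 1 := by gcongr
    _ ≤ 66 * Real.log h := by linarith

end PairElimMono

/-! ### Correctness of the removals under accurate samples -/

namespace PairElimMono

variable {n : ℕ}

/-- `a` and `b` are the two best items, in this order, and all others are worse. -/
structure TopPair (u : Fin n → ℝ) (a b : Fin n) : Prop where
  pos : ∀ i, 0 < u i
  lt_one : ∀ i, u i < 1
  ne : a ≠ b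
  le : u b ≤ u a
  lt : ∀ i, i ≠ a → i ≠ b → u i < u b

theorem TopPair.le_fst {u : Fin n → ℝ} {a b : Fin n} (h : TopPair u a b) (i : Fin n) :
    u i ≤ u a := by
  by_cases hi : i = a
  · rw [hi]
  by_cases hi' : i = b
  · rw [hi']; exact h.le
  exact (h.lt i hi hi').le.trans h.le

theorem TopPair.le_snd {u : Fin n → ℝ} {a b : Fin n} (h : TopPair u a b) {i : Fin n}
    (hi : i ≠ a) : u i ≤ u b := by
  by_cases hi' : i = b
  · rw [hi']
  exact (h.lt i hi hi').le

/-- The row samples in the memory are close to the means. -/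
def RowAccurate (u : Fin n → ℝ) (T : ℕ) (st : State n) : Prop :=
  ∀ i k, |st.X i k - st.C i k * entryMean u i k| ≤ Real.sqrt (st.C i k * Real.log T)

/-- The column samples in the memory are close to the means. -/
def ColAccurate (u : Fin n → ℝ) (st : State n) : Prop :=
  ∀ i k, |st.Xw i k - st.Cw i k * entryMean u i k| ≤
    Real.sqrt (st.Cw i k * Real.log ((2 : ℝ) ^ 2 ^ st.w))

theorem log_window_pos (w : ℕ) : 0 < Real.log ((2 : ℝ) ^ 2 ^ w) := by
  rw [Real.log_pow]
  have := Real.log_pos one_lt_two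
  positivity

/-- Invariants of a run with accurate row samples and with accurate column samples in the windows
`w` with `ok w`. -/
structure Invariant (u : Fin n → ℝ) (a b : Fin n) (T : ℕ) (ord : List (Fin n × Fin n))
    (ok : ℕ → Prop) (st : State n) : Prop where
  wf : st.WellFormed ord
  accU : st.QU.Accurate st.rowCount T (entryMean u)
  accV : ok st.w → st.QV.Accurate st.colCount ((2 : ℝ) ^ 2 ^ st.w) (entryMean u)
  notRow : ∀ p ∈ st.SU, ¬ RowRemoved st.QU p
  notCol : ∀ p ∈ st.SV, ¬ ColRemoved st.QV p
  topU : (a, b) ∈ st.SU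
  symm : ∀ i j, (i, j) ∈ st.SU → (j, i) ∈ st.SU
  keepU : ∀ i j, i ≠ a → (i, j) ∈ st.SU → u j ≤ u i → (i, a) ∈ st.SU
  topV : ok st.w → (a, b) ∈ st.SV
  fstV : ok st.w → ∀ l, l ≠ a → (l, a) ∈ st.SV
  keepV : ok st.w → ∀ i j, j ≠ a → (i, j) ∈ st.SV → u i ≤ u j → (a, j) ∈ st.SV
  queue : ok st.w → ∀ p ∈ st.queue, p ∈ st.SU ∧ p ∈ st.SV

theorem mem_allPairs {i j : Fin n} : (i, j) ∈ allPairs n ↔ i ≠ j := by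
  simp [allPairs]

theorem RowRemoved.swap {Q : Bounds n} {i j : Fin n} (h : RowRemoved Q (i, j)) :
    RowRemoved Q (j, i) := by
  obtain ⟨c, hc, h⟩ := h
  refine ⟨c, hc.symm, ?_⟩
  rcases h with h | ⟨d, hd, h1, h2⟩
  · exact Or.inl h
  · refine Or.inr ⟨d, hd, fun h => h2 ?_, fun h => h1 ?_⟩
    · simp only [Prod.mk.injEq] at h ⊢; exact h.symm
    · simp only [Prod.mk.injEq] at h ⊢; exact h.symm

variable {u : Fin n → ℝ} {a b : Fin n} {T : ℕ} {ord : List (Fin n × Fin n)} {ok : ℕ → Prop}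

theorem invariant_init (hu : TopPair u a b) : Invariant u a b T ord ok (init n) where
  wf := ⟨List.nil_sublist _, subset_rfl, subset_rfl⟩
  accU := Bounds.accurate_trivial (by simp [State.rowCount, init]) _ _
  accV := fun _ => Bounds.accurate_trivial (by simp [State.colCount, init]) _ _
  notRow := by
    rintro p _ ⟨c, _, ⟨j, j', _, h, _⟩ | ⟨j, h, _⟩⟩ <;> exact not_dominated_trivial _ _ h
  notCol := by
    rintro p _ (⟨j, j', _, h, _⟩ | ⟨j, h, _⟩) <;> exact not_dominated_trivial _ _ h
  topU := mem_allPairs.2 hu.ne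
  symm := fun _ _ h => mem_allPairs.2 (mem_allPairs.1 h).symm
  keepU := fun _ _ h _ _ => mem_allPairs.2 h
  topV := fun _ => mem_allPairs.2 hu.ne
  fstV := fun _ _ h => mem_allPairs.2 h
  keepV := fun _ _ _ h _ _ => mem_allPairs.2 h.symm
  queue := by simp [init]

theorem Invariant.midRound {st st' : State n} (h : MidRound st st')
    (hi : Invariant u a b T ord ok st) : Invariant u a b T ord ok st' := by
  have hwf := h.wellFormed hi.wf
  obtain ⟨h1, h2, h3, h4, h5, h6, h7, h8, p, hp⟩ := h
  obtain ⟨g1, g2, g3, g4, g5, g6, g7, g8, g9, g10, g11, g12⟩ := hi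
  refine ⟨hwf, ?_, ?_, ?_, ?_, ?_, ?_, ?_, ?_, ?_, ?_, ?_⟩
  · rwa [h1, h4]
  · rwa [h2, h5, h8]
  · rwa [h4, h6]
  · rwa [h5, h7]
  · rwa [h6]
  · rwa [h6]
  · rwa [h6]
  · rwa [h7, h8]
  · rwa [h7, h8]
  · rwa [h7, h8]
  · rw [h6, h7, h8]
    exact fun hw q hq => g12 hw q (by rw [hp]; exact List.mem_cons_of_mem _ hq)

/-- As `a` is never dominated, the removal of `(i, a)` is due to `i`. An item that dominates `i` is
better than `i`, hence is not `j`, and so the exception in the row rule does not save `(i, j)`. The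
contrapositive propagates `keepU`: an active entry keeps its better item active against `a`. -/
theorem RowRemoved.of_fst (hu : TopPair u a b) {Q : Bounds n} {i j : Fin n}
    (hQ : ∀ c d, Q.Dominated c d → u c < u d) (h : RowRemoved Q (i, a)) (hij : u j ≤ u i) :
    RowRemoved Q (i, j) := by
  obtain ⟨c, hc, h⟩ := h
  have ha : ∀ d, ¬ Q.Dominated a d := fun d hd => (hu.le_fst d).not_gt (hQ _ _ hd)
  have hci : c = i := by
    rcases hc with hc | hc
    · exact hc.symm
    · change a = c at hc
      subst hc
      rcases h with ⟨d, _, _, hd, _⟩ | ⟨d, hd, _⟩ <;> exact absurd hd (ha d)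
  subst hci
  refine ⟨c, Or.inl rfl, ?_⟩
  rcases h with h | ⟨d, hd, h1, h2⟩
  · exact Or.inl h
  · have h3 := hQ _ _ hd
    refine Or.inr ⟨d, hd, ?_, ?_⟩ <;> rintro h4 <;> simp only [Prod.mk.injEq] at h4
    · rw [h4.2] at hij; exact hij.not_gt h3
    · rw [h4.1] at h3; exact lt_irrefl _ h3

/-- Nothing dominates `a`, and only `a` can dominate `b`; that single domination spares `(a, b)` by
the exception in the rule. -/
theorem not_rowRemoved_top (hu : TopPair u a b) {Q : Bounds n}
    (hQ : ∀ c d, Q.Dominated c d → u c < u d) : ¬ RowRemoved Q (a, b) := by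
  have ha : ∀ d, ¬ Q.Dominated a d := fun d hd => (hu.le_fst d).not_gt (hQ _ _ hd)
  have hb : ∀ d, Q.Dominated b d → d = a := by
    intro d hd
    by_contra hda
    exact (hu.le_snd hda).not_gt (hQ _ _ hd)
  rintro ⟨c, hc | hc, h⟩ <;> simp only at hc <;> subst hc
  · rcases h with ⟨d, _, _, hd, _⟩ | ⟨d, hd, _⟩ <;> exact ha d hd
  · rcases h with ⟨d, e, hde, hd, he⟩ | ⟨d, hd, _, h2⟩
    · exact hde ((hb d hd).trans (hb e he).symm)
    · exact h2 (by rw [hb d hd])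

theorem not_colRemoved_top (hu : TopPair u a b) {Q : Bounds n}
    (hQ : ∀ c d, Q.Dominated c d → u c < u d) : ¬ ColRemoved Q (a, b) := by
  have hb : ∀ d, Q.Dominated b d → d = a := by
    intro d hd
    by_contra hda
    exact (hu.le_snd hda).not_gt (hQ _ _ hd)
  rintro (⟨d, e, hde, hd, he⟩ | ⟨d, hd, h2⟩)
  · exact hde ((hb d hd).trans (hb e he).symm)
  · exact h2 (by rw [hb d hd])

theorem not_colRemoved_fst (hu : TopPair u a b) {Q : Bounds n}
    (hQ : ∀ c d, Q.Dominated c d → u c < u d) (l : Fin n) : ¬ ColRemoved Q (l, a) := by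
  have ha : ∀ d, ¬ Q.Dominated a d := fun d hd => (hu.le_fst d).not_gt (hQ _ _ hd)
  rintro (⟨d, e, hde, hd, he⟩ | ⟨d, hd, h2⟩)
  · exact ha d hd
  · exact ha d hd

/-- A column that dominates `j` is better than `j`, hence is not `i`. This propagates `keepV`. -/
theorem ColRemoved.of_fst {Q : Bounds n} {i j : Fin n}
    (hQ : ∀ c d, Q.Dominated c d → u c < u d) (h : ColRemoved Q (a, j)) (hij : u i ≤ u j) :
    ColRemoved Q (i, j) := by
  rcases h with h | ⟨d, hd, h1⟩
  · exact Or.inl h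
  · refine Or.inr ⟨d, hd, fun h2 => ?_⟩
    simp only [Prod.mk.injEq, and_true] at h2
    subst h2
    exact hij.not_gt (hQ _ _ hd)

theorem Invariant.nextRound (hu : TopPair u a b) (hT : 0 < Real.log T) {st st' : State n}
    (h : NextRound T ord st st') (hrow : RowAccurate u T st')
    (hcol : ok st'.w → ColAccurate u st')
    (hi : Invariant u a b T ord ok st) : Invariant u a b T ord ok st' := by
  have hwf := h.wellFormed hi.wf
  have hr : ∀ i k, st'.rowCount i k ≤ st'.C i k + 1 := fun i k => by
    simp only [State.rowCount]; split_ifs <;> omega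
  have hc : ∀ i k, st'.colCount i k ≤ st'.Cw i k + 1 := fun i k => by
    simp only [State.colCount]; split_ifs <;> omega
  have accU : st'.QU.Accurate st'.rowCount T (entryMean u) := by
    rw [h.QU]
    exact hi.accU.update hT (fun i k => by rw [h.C]) hr hrow
  have accV : ok st'.w → st'.QV.Accurate st'.colCount ((2 : ℝ) ^ 2 ^ st'.w) (entryMean u) := by
    intro hok
    rcases h.window with ⟨h1, h2, h3, h4, h5, h6⟩ | ⟨h1, h2, h3, h4, h5, h6⟩
    · rw [h2]
      have := hi.accV (h5 ▸ hok)
      rw [← h5] at this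
      exact this.update (log_window_pos _) (fun i k => by rw [h1]) hc (hcol hok)
    · rw [h2]
      exact (Bounds.accurate_trivial (cnt := st'.Cw) h1 _ _).update (log_window_pos _)
        (fun i k => le_rfl) hc (hcol hok)
  have domU : ∀ c d, st'.QU.Dominated c d → u c < u d := fun c d => accU.lt_of_dominated hu.pos
  have domV : ok st'.w → ∀ c d, st'.QV.Dominated c d → u c < u d :=
    fun hok c d => (accV hok).lt_of_dominated hu.pos
  have topU : (a, b) ∈ st'.SU := (h.SU _).2 ⟨hi.topU, not_rowRemoved_top hu domU⟩
  -- Membership in the old set is needed only if the window continues; a new window starts from all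
  -- pairs.
  have memV : ∀ p, (st'.SV ⊆ st.SV → ok st.w → p ∈ st.SV) → p ∈ allPairs n → ok st'.w →
      ¬ ColRemoved st'.QV p → p ∈ st'.SV := by
    intro p hp hp' hok hnr
    rcases h.window with ⟨h1, h2, h3, h4, h5, h6⟩ | ⟨h1, h2, h3, h4, h5, h6⟩
    · exact (h3 p).2 ⟨hp (fun q hq => ((h3 q).1 hq).1) (h5 ▸ hok), hnr⟩
    · exact (h3 p).2 ⟨hp', hnr⟩
  have topV : ok st'.w → (a, b) ∈ st'.SV := fun hok =>
    memV _ (fun _ h => hi.topV h) (mem_allPairs.2 hu.ne) hok (not_colRemoved_top hu (domV hok))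
  have notCol : ∀ p ∈ st'.SV, ¬ ColRemoved st'.QV p := by
    intro p hp
    rcases h.window with ⟨h1, h2, h3, h4, h5, h6⟩ | ⟨h1, h2, h3, h4, h5, h6⟩
    · exact ((h3 p).1 hp).2
    · exact ((h3 p).1 hp).2
  refine ⟨hwf, accU, accV, fun p hp => ((h.SU p).1 hp).2, notCol, topU, ?_, ?_, topV, ?_, ?_, ?_⟩
  · intro i j hij
    obtain ⟨h1, h2⟩ := (h.SU _).1 hij
    exact (h.SU _).2 ⟨hi.symm _ _ h1, fun h3 => h2 h3.swap⟩
  · intro i j hia hij hle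
    obtain ⟨h1, h2⟩ := (h.SU _).1 hij
    exact (h.SU _).2 ⟨hi.keepU _ _ hia h1 hle, fun h3 => h2 (h3.of_fst hu domU hle)⟩
  · exact fun hok l hl => memV _ (fun _ h => hi.fstV h l hl) (mem_allPairs.2 hl) hok
      (not_colRemoved_fst hu (domV hok) l)
  · intro hok i j hja hij hle
    refine memV _ (fun hs hok' => hi.keepV hok' i j hja (hs hij) hle) (mem_allPairs.2 hja.symm) hok
      (fun h3 => notCol _ hij (h3.of_fst (domV hok) hle))
  -- The active set contains `(a, b)`, so the fallback of sampling all pairs does not occur.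
  · exact fun hok p hp => (h.mem_queue ⟨_, topU, topV hok⟩ p).1 hp

end PairElimMono

/-! ### Sample counts along a good run -/

namespace PairElimMono

variable {n : ℕ}

theorem run_succ_samples (T : ℕ) {ord : List (Fin n × Fin n)} (hnd : ord.Nodup)
    (hord : ∀ p, p ∈ ord ↔ p.1 ≠ p.2) (hne : ord ≠ []) (x : ℕ → Fin n → Fin n → ℝ) (m : ℕ) :
    ∃ p, (run T ord x m).queue.head? = some p ∧
      (∀ i k, (run T ord x (m + 1)).X i k =
        (run T ord x m).X i k + if (i, k) = p then x (2 * m) i k else 0) ∧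
      (∀ i k, (run T ord x (m + 1)).C i k =
        (run T ord x m).C i k + if (i, k) = p then 1 else 0) ∧
      (((run T ord x (m + 1)).w = (run T ord x m).w ∧
        (∀ i k, (run T ord x (m + 1)).Xw i k =
          (run T ord x m).Xw i k + if (k, i) = p then x (2 * m + 1) k i else 0) ∧
        (∀ i k, (run T ord x (m + 1)).Cw i k =
          (run T ord x m).Cw i k + if (k, i) = p then 1 else 0) ∧
        (run T ord x (m + 1)).s = (run T ord x m).s + 2) ∨
      ((run T ord x (m + 1)).w = (run T ord x m).w + 1 ∧
        (∀ i k, (run T ord x (m + 1)).Xw i k = 0) ∧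
        (∀ i k, (run T ord x (m + 1)).Cw i k = 0) ∧
        (run T ord x (m + 1)).s = 0)) := by
  have hq := (run_wellFormed T hnd hord hne x m).2
  have hif : ∀ (y : Fin n → Fin n → ℝ) (i k : Fin n) (p : Fin n × Fin n),
      (if (i, k) = p then y p.1 p.2 else 0) = if (i, k) = p then y i k else 0 := by
    rintro y i k p
    split_ifs with h
    · rw [← h]
    · rfl
  match hq' : (run T ord x m).queue with
  | [] => exact absurd hq' hq
  | [p] =>
    refine ⟨p, rfl, ?_⟩
    have hstep : run T ord x (m + 1) = beginRound T ord (endRound (sample p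
        (x (2 * m) p.1 p.2) (x (2 * m + 1) p.1 p.2) (run T ord x m))) := by
      rw [run, step, hq']
    rw [hstep]
    simp only [beginRound, endRound]
    split_ifs with hw
    · exact ⟨fun i k => by simp only [sample]; rw [hif], fun i k => rfl,
        Or.inr ⟨rfl, fun _ _ => rfl, fun _ _ => rfl, rfl⟩⟩
    · exact ⟨fun i k => by simp only [sample]; rw [hif], fun i k => rfl,
        Or.inl ⟨rfl, fun i k => by simp only [sample]; rw [hif], fun _ _ => rfl, rfl⟩⟩
  | p :: q :: rest =>
    refine ⟨p, rfl, ?_⟩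
    have hstep : run T ord x (m + 1) = { sample p
        (x (2 * m) p.1 p.2) (x (2 * m + 1) p.1 p.2) (run T ord x m) with queue := q :: rest } := by
      rw [run, step, hq']
    rw [hstep]
    exact ⟨fun i k => by simp only [sample]; rw [hif], fun i k => rfl,
        Or.inl ⟨rfl, fun i k => by simp only [sample]; rw [hif], fun _ _ => rfl, rfl⟩⟩

/-- A run whose row samples are accurate before iteration `M`, and whose column samples are
accurate in the windows `w` with `ok w`. -/
structure GoodRun (u : Fin n → ℝ) (a b : Fin n) (T : ℕ) (ord : List (Fin n × Fin n))
    (x : ℕ → Fin n → Fin n → ℝ) (M : ℕ) (ok : ℕ → Prop) : Prop where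
  top : TopPair u a b
  log_pos : 0 < Real.log T
  nodup : ord.Nodup
  mem_ord : ∀ p, p ∈ ord ↔ p.1 ≠ p.2
  row : ∀ m < M, RowAccurate u T (run T ord x m)
  col : ∀ m < M, ok (run T ord x m).w → ColAccurate u (run T ord x m)

variable {u : Fin n → ℝ} {a b : Fin n} {T : ℕ} {ord : List (Fin n × Fin n)}
  {x : ℕ → Fin n → Fin n → ℝ} {M : ℕ} {ok : ℕ → Prop}

theorem GoodRun.ord_ne_nil (h : GoodRun u a b T ord x M ok) : ord ≠ [] :=
  List.ne_nil_of_mem ((h.mem_ord (a, b)).2 h.top.ne)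

theorem GoodRun.invariant (h : GoodRun u a b T ord x M ok) {m : ℕ} (hm : m < M) :
    Invariant u a b T ord ok (run T ord x m) :=
  run_induction T h.nodup h.mem_ord h.ord_ne_nil x (invariant_init h.top)
    (fun _ _ h1 h2 => h2.midRound h1)
    (fun _ _ hm h1 h2 => h2.nextRound h.top h.log_pos h1 (h.row _ hm) (h.col _ hm)) m hm

theorem GoodRun.induction (h : GoodRun u a b T ord x M ok) {motive : State n → Prop}
    (h0 : motive (init n))
    (hmid : ∀ st st', MidRound st st' → motive st → motive st')
    (hnext : ∀ st st', NextRound T ord st st' → Invariant u a b T ord ok st →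
      Invariant u a b T ord ok st' → motive st → motive st') {m : ℕ} (hm : m < M) :
    motive (run T ord x m) :=
  (run_induction T h.nodup h.mem_ord h.ord_ne_nil x
    (motive := fun st => Invariant u a b T ord ok st ∧ motive st)
    ⟨invariant_init h.top, h0⟩
    (fun st st' h1 h2 => ⟨h2.1.midRound h1, hmid st st' h1 h2.2⟩)
    (fun st _ hm h1 h2 => ⟨h.invariant hm, hnext st _ h1 h2.1 (h.invariant hm) h2.2⟩) m hm).2

theorem NextRound.mem_queue_iff {st st' : State n} (h : NextRound T ord st st')
    (hi : Invariant u a b T ord ok st') (hok : ok st'.w) (p : Fin n × Fin n) :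
    p ∈ st'.queue ↔ p ∈ st'.SU ∧ p ∈ st'.SV :=
  h.mem_queue ⟨_, hi.topU, hi.topV hok⟩ p

theorem Invariant.fst_active {st : State n} (hi : Invariant u a b T ord ok st) (hok : ok st.w)
    {i : Fin n} (hia : i ≠ a) (h : (i, a) ∈ st.SU) : (i, a) ∈ st.SU ∧ (i, a) ∈ st.SV :=
  ⟨h, hi.fstV hok i hia⟩

theorem Invariant.top_active {st : State n} (hi : Invariant u a b T ord ok st) (hok : ok st.w) :
    (a, b) ∈ st.SU ∧ (a, b) ∈ st.SV := ⟨hi.topU, hi.topV hok⟩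

theorem Invariant.top_swap_active {st : State n} (hu : TopPair u a b)
    (hi : Invariant u a b T ord ok st) (hok : ok st.w) :
    (b, a) ∈ st.SU ∧ (b, a) ∈ st.SV := hi.fst_active hok hu.ne.symm (hi.symm _ _ hi.topU)

theorem GoodRun.colCount_mono (h : GoodRun u a b T ord x M ok) {p q : Fin n × Fin n}
    (hpq : ∀ st, Invariant u a b T ord ok st → ok st.w → p ∈ st.SU → p ∈ st.SV →
      q ∈ st.SU ∧ q ∈ st.SV) {m : ℕ} (hm : m < M) :
    ok (run T ord x m).w →
      (run T ord x m).colCount p.2 p.1 ≤ (run T ord x m).colCount q.2 q.1 := by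
  refine h.induction (motive := fun st => ok st.w → st.colCount p.2 p.1 ≤ st.colCount q.2 q.1)
    ?_ ?_ ?_ hm
  · simp [State.colCount, init]
  · intro st st' h1 h2
    rwa [h1.w, h1.colCount]
  · intro st st' h1 _ hi h2 hok
    have h3 : p ∈ st'.queue → q ∈ st'.queue := by
      rw [h1.mem_queue_iff hi hok, h1.mem_queue_iff hi hok]
      exact fun h => hpq _ hi hok h.1 h.2
    have h4 : st'.Cw p.2 p.1 ≤ st'.Cw q.2 q.1 := by
      rcases h1.window with ⟨g1, g2, g3, g4, g5, g6⟩ | ⟨g1, g2, g3, g4, g5, g6⟩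
      · rw [g1]; exact h2 (g5 ▸ hok)
      · rw [g1, g1]
    simp only [State.colCount, Prod.mk.eta]
    by_cases h5 : p ∈ st'.queue
    · rw [if_pos h5, if_pos (h3 h5)]; omega
    · rw [if_neg h5]; omega

/-- By `hpq` the entry `(l, k)` is sampled at least as often as `(l, j)` in the window. Beyond the
checkpoint column `j` would be separated from column `k` against row `l`, and `l ≠ k` rules out the
exception that could keep `(l, j)`. -/
theorem GoodRun.colCount_le (h : GoodRun u a b T ord x M ok) {l j k : Fin n} (hlk : l ≠ k)
    (hpq : ∀ st, Invariant u a b T ord ok st → ok st.w → (l, j) ∈ st.SU → (l, j) ∈ st.SV →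
      (l, k) ∈ st.SU ∧ (l, k) ∈ st.SV) {lev : ℕ} (hlev : 0 < lev)
    (hgap : 4 * (1 / 2 : ℝ) ^ (lev + 1) < u k * u l - u j * u l) {m : ℕ} (hm : m < M) :
    ok (run T ord x m).w → (run T ord x m).colCount j l ≤
      checkpoint lev ((2 : ℝ) ^ 2 ^ (run T ord x m).w) := by
  refine (h.induction (motive := fun st => ok st.w → st.colCount j l ≤ st.colCount k l ∧
    st.colCount j l ≤ checkpoint lev ((2 : ℝ) ^ 2 ^ st.w)) ?_ ?_ ?_ hm · |>.2)
  · simp [State.colCount, init]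
  · intro st st' h1 h2
    rwa [h1.w, h1.colCount]
  · intro st st' h1 _ hi h2 hok
    have h3 : (l, j) ∈ st'.queue → (l, k) ∈ st'.queue := by
      rw [h1.mem_queue_iff hi hok, h1.mem_queue_iff hi hok]
      exact fun h => hpq _ hi hok h.1 h.2
    have h4 : st'.Cw j l ≤ st'.Cw k l ∧
        st'.Cw j l ≤ checkpoint lev ((2 : ℝ) ^ 2 ^ st'.w) := by
      rcases h1.window with ⟨g1, g2, g3, g4, g5, g6⟩ | ⟨g1, g2, g3, g4, g5, g6⟩
      · rw [g1, g5]; exact h2 (g5 ▸ hok)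
      · rw [g1, g1]; simp
    by_cases h5 : (l, j) ∈ st'.queue
    · have e1 : st'.colCount j l = st'.Cw j l + 1 := by simp only [State.colCount, if_pos h5]
      have e2 : st'.colCount k l = st'.Cw k l + 1 := by simp only [State.colCount, if_pos (h3 h5)]
      rw [e1, e2]
      refine ⟨by omega, ?_⟩
      by_contra hlt
      have hd := (hi.accV hok).dominated (i := j) (j := k) (k := l) hlev (by omega) (by omega) hgap
      refine hi.notCol (l, j) ((h1.mem_queue_iff hi hok _).1 h5).2 (Or.inr ⟨k, hd, fun h => ?_⟩)
      simp only [Prod.mk.injEq, and_true] at h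
      exact hlk h
    · have e1 : st'.colCount j l = st'.Cw j l := by simp only [State.colCount, if_neg h5, add_zero]
      have e2 : st'.Cw k l ≤ st'.colCount k l := by simp only [State.colCount]; omega
      omega

/-- A window is closed only at the end of a round, so it overshoots its threshold by at most one
round. -/
theorem playCount_le (T : ℕ) {ord : List (Fin n × Fin n)} (hnd : ord.Nodup)
    (hord : ∀ p, p ∈ ord ↔ p.1 ≠ p.2) (hne : ord ≠ []) (x : ℕ → Fin n → Fin n → ℝ) (m : ℕ) :
    (run T ord x m).playCount ≤ 2 ^ 2 ^ (run T ord x m).w + 2 * ord.length := by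
  refine run_induction T hnd hord hne x (M := m + 1)
    (motive := fun st => st.playCount ≤ 2 ^ 2 ^ st.w + 2 * ord.length) ?_ ?_ ?_ m m.lt_succ_self
  · simp [State.playCount, init]
  · intro st st' h1 h2
    rwa [h1.playCount, h1.w]
  · intro st m' _ h1 h2
    have h3 := h1.queue_sublist.length_le
    rw [State.playCount]
    rcases h1.window with ⟨g1, g2, g3, g4, g5, g6⟩ | ⟨g1, g2, g3, g4, g5, g6⟩
    · rw [g4, g5]; omega
    · rw [g4, zero_add]
      exact (Nat.mul_le_mul_left 2 h3).trans (Nat.le_add_left _ _)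

theorem Invariant.not_mem_SU_of_counts {st : State n}
    (hi : Invariant u a b T ord ok st) {i j k : Fin n} (hjk : j ≠ k) (hij : u i < u j) {lev : ℕ}
    (hlev : 0 < lev) (hgap : 4 * (1 / 2 : ℝ) ^ (lev + 1) < u j * u k - u i * u k)
    (h1 : checkpoint lev T + 1 ≤ st.rowCount i k) (h2 : checkpoint lev T + 1 ≤ st.rowCount j k) :
    (i, k) ∉ st.SU := by
  intro hmem
  have hd := hi.accU.dominated (i := i) (j := j) (k := k) hlev h1 h2 hgap
  refine hi.notRow _ hmem ⟨i, Or.inl rfl, Or.inr ⟨j, hd, fun h => ?_, fun h => ?_⟩⟩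
  · simp only [Prod.mk.injEq, true_and] at h
    exact hjk h.symm
  · simp only [Prod.mk.injEq] at h
    rw [h.1] at hij
    exact lt_irrefl _ hij

/-- In a window with accurate columns, an entry `(i, a)` that survives the row rules is sampled in
every round, since column `a` is never removed. A round has at most `2 * ord.length` plays, so the
samples of `(i, a)` are at least the plays divided by that number. The window's column counts bound
the row counts from below, and `(b, a)` is sampled as often; a long window would thus have removed
`(i, a)` by rows. -/
theorem GoodRun.window_lt (h : GoodRun u a b T ord x M ok) {i : Fin n} (hia : i ≠ a) (hib : i ≠ b)
    {lev : ℕ} (hlev : 0 < lev)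
    (hgap : 4 * (1 / 2 : ℝ) ^ (lev + 1) < u b * u a - u i * u a) {m : ℕ} (hm : m < M)
    (hmem : (i, a) ∈ (run T ord x m).SU) {w : ℕ} (hw : w + 1 = (run T ord x m).w) (hok : ok w) :
    2 ^ 2 ^ w < 2 * ord.length * checkpoint lev T := by
  have hib' := h.top.lt i hia hib
  refine (h.induction (motive := fun st =>
    (ok st.w → st.colCount a i ≤ st.colCount a b ∧
      ((i, a) ∈ st.SU → st.playCount ≤ 2 * ord.length * st.colCount a i)) ∧
    (∀ i k, st.colCount i k ≤ st.rowCount k i) ∧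
    ((i, a) ∈ st.SU → ∀ w, w + 1 = st.w → ok w →
      2 ^ 2 ^ w < 2 * ord.length * checkpoint lev T)) ?_ ?_ ?_ hm).2.2 hmem w hw hok
  · refine ⟨?_, ?_, ?_⟩ <;> simp [State.colCount, State.rowCount, State.playCount, init]
  · intro st st' h1 h2
    rwa [h1.w, h1.colCount, h1.rowCount, h1.playCount, h1.SU]
  · intro st st' h1 hi0 hi h2
    obtain ⟨h2, h3, h4⟩ := h2
    have hC : ∀ i k, st'.Cw i k ≤ st'.C k i := by
      intro i k
      rw [h1.C]
      rcases h1.window with ⟨g1, g2, g3, g4, g5, g6⟩ | ⟨g1, g2, g3, g4, g5, g6⟩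
      · rw [g1]; exact h3 i k
      · rw [g1]; simp
    have hS : (i, a) ∈ st'.SU → (i, a) ∈ st.SU := fun hs => ((h1.SU _).1 hs).1
    refine ⟨fun hok => ⟨?_, fun hs => ?_⟩, fun i k => ?_, fun hs w hw hok => ?_⟩
    · have h5 : (b, a) ∈ st'.queue :=
        (h1.mem_queue_iff hi hok _).2 (hi.top_swap_active h.top hok)
      have h6 : st'.Cw a i ≤ st'.Cw a b := by
        rcases h1.window with ⟨g1, g2, g3, g4, g5, g6⟩ | ⟨g1, g2, g3, g4, g5, g6⟩
        · rw [g1]; exact (h2 (g5 ▸ hok)).1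
        · rw [g1, g1]
      simp only [State.colCount, if_pos h5]
      split_ifs <;> omega
    · have h5 : (i, a) ∈ st'.queue := (h1.mem_queue_iff hi hok _).2 (hi.fst_active hok hia hs)
      have h6 : st'.s ≤ 2 * ord.length * st'.Cw a i := by
        rcases h1.window with ⟨g1, g2, g3, g4, g5, g6⟩ | ⟨g1, g2, g3, g4, g5, g6⟩
        · rw [g1, g4]; exact (h2 (g5 ▸ hok)).2 (hS hs)
        · rw [g4]; exact Nat.zero_le _
      have h7 := h1.queue_sublist.length_le
      simp only [State.colCount, State.playCount, if_pos h5, mul_add]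
      omega
    · have := hC i k
      simp only [State.colCount, State.rowCount]; omega
    · rcases h1.window with ⟨g1, g2, g3, g4, g5, g6⟩ | ⟨g1, g2, g3, g4, g5, g6⟩
      · exact h4 (hS hs) w (g5 ▸ hw) hok
      · obtain rfl : w = st.w := by omega
        obtain ⟨h5, h6⟩ := h2 hok
        refine g6.trans_le ((h6 (hS hs)).trans (Nat.mul_le_mul_left _ ?_))
        -- Were the checkpoint exceeded, row `i` would already be separated from row `b` against `a`
        -- in the last round of the old window.
        by_contra hlt
        have h7 := h3 a i
        have h8 := h3 a b
        exact hi0.not_mem_SU_of_counts h.top.ne.symm hib' hlev hgap (by omega) (by omega)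
          (hS hs)

/-- In windows with accurate columns, the entry `(i, j)` with `i` and `j` not among the best two
items is active only if one of `(i, a)` and `(j, a)` is. -/
theorem Invariant.fst_mem_SU {st : State n} (hi : Invariant u a b T ord ok st) {i j : Fin n}
    (hia : i ≠ a) (hja : j ≠ a) (h : (i, j) ∈ st.SU) : (i, a) ∈ st.SU ∨ (j, a) ∈ st.SU := by
  rcases le_total (u j) (u i) with hle | hle
  · exact Or.inl (hi.keepU _ _ hia h hle)
  · exact Or.inr (hi.keepU _ _ hja (hi.symm _ _ h) hle)

end PairElimMono

/-! ### Numbers of plays per window and over accurate windows -/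

namespace PairElimMono

variable {n : ℕ}

/-- Inside window `w` the counter `c` equals the partial sum. The bound is required of `c m + wt m`,
because the last increment of a window is erased by the reset before it shows in `c`. -/
theorem windowed_sum_le {v c wt : ℕ → ℕ} {M : ℕ} (h0 : c 0 = 0)
    (hstep : ∀ m, m + 1 < M → (v (m + 1) = v m ∧ c (m + 1) = c m + wt m) ∨
      (v (m + 1) = v m + 1 ∧ c (m + 1) = 0)) {K w : ℕ}
    (hK : ∀ m < M, v m = w → c m + wt m ≤ K) :
    ∑ m ∈ Finset.range M, (if v m = w then wt m else 0) ≤ K := by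
  suffices h : ∀ m ≤ M, ∑ m ∈ Finset.range m, (if v m = w then wt m else 0) ≤ K ∧
      (m < M → (v m < w → ∑ m ∈ Finset.range m, (if v m = w then wt m else 0) = 0) ∧
        (v m = w → ∑ m ∈ Finset.range m, (if v m = w then wt m else 0) = c m)) from
    (h M le_rfl).1
  intro m
  induction m with
  | zero => simp [h0]
  | succ m ih =>
    intro hm
    obtain ⟨h1, h2⟩ := ih (by omega)
    obtain ⟨h2, h3⟩ := h2 (by omega)
    rw [Finset.sum_range_succ]
    have h4 := hK m (by omega)
    refine ⟨?_, fun hm' => ?_⟩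
    · split_ifs with hv
      · rw [h3 hv]; exact h4 hv
      · omega
    · rcases hstep m hm' with ⟨h5, h6⟩ | ⟨h5, h6⟩
      · rw [h5, h6]
        refine ⟨fun hv => ?_, fun hv => ?_⟩
        · rw [if_neg hv.ne, h2 hv]
        · rw [if_pos hv, h3 hv]
      · rw [h5, h6]
        refine ⟨fun hv => ?_, fun hv => ?_⟩ <;> rw [if_neg (by omega), h2 (by omega)]

theorem run_window_bound (T : ℕ) {ord : List (Fin n × Fin n)} (hnd : ord.Nodup)
    (hord : ∀ p, p ∈ ord ↔ p.1 ≠ p.2) (hne : ord ≠ []) (x : ℕ → Fin n → Fin n → ℝ) (m : ℕ) :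
    (run T ord x m).s ≤ 2 * m ∧
      ∀ w, (run T ord x m).w = w + 1 → 2 ^ 2 ^ w < 2 * m := by
  induction m with
  | zero => exact ⟨le_rfl, fun w hw => by simp [run, beginRound, init] at hw⟩
  | succ m ih =>
    obtain ⟨p, -, -, -, hs⟩ := run_succ_samples T hnd hord hne x m
    refine ⟨?_, fun w hw => ?_⟩
    · rcases hs with ⟨-, -, -, hs⟩ | ⟨-, -, -, hs⟩ <;> rw [hs] <;> omega
    · rcases run_succ_cases T hnd hord hne x m with h | ⟨h, hl⟩
      · have := ih.2 w (h.w ▸ hw)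
        omega
      · rcases h.window with ⟨-, -, -, -, g5, -⟩ | ⟨-, -, -, -, g5, g6⟩
        · have := ih.2 w (g5 ▸ hw)
          omega
        · obtain rfl : (run T ord x m).w = w := by omega
          refine g6.trans_le ?_
          rw [State.playCount, hl]
          omega

theorem sum_window_plays_le (T : ℕ) {ord : List (Fin n × Fin n)} (hnd : ord.Nodup)
    (hord : ∀ p, p ∈ ord ↔ p.1 ≠ p.2) (hne : ord ≠ []) (x : ℕ → Fin n → Fin n → ℝ) (M w : ℕ) :
    ∑ m ∈ Finset.range M, (if (run T ord x m).w = w then 2 else 0) ≤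
      2 ^ 2 ^ w + 2 * ord.length := by
  refine windowed_sum_le (v := fun m => (run T ord x m).w) (c := fun m => (run T ord x m).s)
    (wt := fun _ => 2) rfl (fun m _ => ?_) (fun m _ hw => ?_)
  · obtain ⟨p, -, -, -, ⟨h1, -, -, h2⟩ | ⟨h1, -, -, h2⟩⟩ := run_succ_samples T hnd hord hne x m
    · exact Or.inl ⟨h1, h2⟩
    · exact Or.inr ⟨h1, h2⟩
  · have h1 := playCount_le T hnd hord hne x m
    have h2 := List.length_pos_iff.2 (run_wellFormed T hnd hord hne x m).2
    rw [hw, State.playCount] at h1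
    omega

theorem sum_window_pair_le (T : ℕ) {ord : List (Fin n × Fin n)} (hnd : ord.Nodup)
    (hord : ∀ p, p ∈ ord ↔ p.1 ≠ p.2) (hne : ord ≠ []) (x : ℕ → Fin n → Fin n → ℝ) (M w : ℕ)
    (p : Fin n × Fin n) {K : ℕ}
    (hK : ∀ m < M, (run T ord x m).w = w → (run T ord x m).colCount p.2 p.1 ≤ K) :
    ∑ m ∈ Finset.range M, (if (run T ord x m).w = w then
      (if (run T ord x m).queue.head? = some p then 1 else 0) else 0) ≤ K := by
  refine windowed_sum_le (v := fun m => (run T ord x m).w)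
    (c := fun m => (run T ord x m).Cw p.2 p.1)
    (wt := fun m => if (run T ord x m).queue.head? = some p then 1 else 0) rfl
    (fun m _ => ?_) (fun m hm hw => ?_)
  · obtain ⟨q, hq, -, -, ⟨h1, -, h2, -⟩ | ⟨h1, -, h2, -⟩⟩ := run_succ_samples T hnd hord hne x m
    · refine Or.inl ⟨h1, ?_⟩
      simp only [h2, hq, Option.some.injEq, Prod.mk.eta, eq_comm]
    · exact Or.inr ⟨h1, h2 _ _⟩
  · refine le_trans ?_ (hK m hm hw)
    simp only [State.colCount, Prod.mk.eta]
    gcongr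
    split_ifs with h1 h2
    · rfl
    · exact absurd (List.mem_of_mem_head? h1) h2
    · omega
    · rfl

variable {u : Fin n → ℝ} {a b : Fin n} {T : ℕ} {ord : List (Fin n × Fin n)}
  {x : ℕ → Fin n → Fin n → ℝ} {M : ℕ} {ok : ℕ → Prop}

open scoped Classical in
/-- Number of the first `m` iterations that play `p` in a window with `ok w`. -/
noncomputable def okPlays (T : ℕ) (ord : List (Fin n × Fin n)) (x : ℕ → Fin n → Fin n → ℝ)
    (ok : ℕ → Prop) (p : Fin n × Fin n) (m : ℕ) : ℕ :=
  ∑ m ∈ Finset.range m,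
    if (run T ord x m).queue.head? = some p ∧ ok (run T ord x m).w then 1 else 0

open scoped Classical in
/-- The value of `okPlays` after the current round. -/
noncomputable def okCount (T : ℕ) (ord : List (Fin n × Fin n)) (x : ℕ → Fin n → Fin n → ℝ)
    (ok : ℕ → Prop) (p : Fin n × Fin n) (m : ℕ) : ℕ :=
  okPlays T ord x ok p m + if p ∈ (run T ord x m).queue ∧ ok (run T ord x m).w then 1 else 0

theorem okPlays_succ_le (p : Fin n × Fin n) (m : ℕ) :
    okPlays T ord x ok p (m + 1) ≤ okCount T ord x ok p m := by
  rw [okPlays, Finset.sum_range_succ, okCount, okPlays]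
  gcongr
  split_ifs with h1 h2
  · rfl
  · exact absurd ⟨List.mem_of_mem_head? h1.1, h1.2⟩ h2
  · omega
  · rfl

theorem okCount_midRound (hnd : ord.Nodup) {m : ℕ} (hwf : (run T ord x m).WellFormed ord)
    (h : MidRound (run T ord x m) (run T ord x (m + 1))) (p : Fin n × Fin n) :
    okCount T ord x ok p (m + 1) = okCount T ord x ok p m := by
  obtain ⟨q, hq⟩ := h.queue
  have hnd' : (q :: (run T ord x (m + 1)).queue).Nodup := hq ▸ hwf.queue_sublist.nodup hnd
  have hq' := (List.nodup_cons.1 hnd').1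
  rw [okCount, okPlays, Finset.sum_range_succ, okCount, okPlays, h.w, add_assoc, hq]
  congr 1
  by_cases hok : ok (run T ord x m).w
  · by_cases hpq : q = p
    · subst hpq
      simp [hok, hq']
    · simp [hok, hpq, Ne.symm hpq]
  · simp [hok]

theorem okPlays_succ_nextRound {m : ℕ} (hl : (run T ord x m).queue.length = 1)
    (p : Fin n × Fin n) : okPlays T ord x ok p (m + 1) = okCount T ord x ok p m := by
  obtain ⟨q, hq⟩ := List.length_eq_one_iff.1 hl
  rw [okPlays, Finset.sum_range_succ, okCount, okPlays, hq]
  split_ifs <;> simp_all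

/-- Row samples persist across windows, but activity of `(i, k)` forces activity of `(j, k)` only
where columns are accurate. Counting only those plays keeps `(i, k)` behind `(j, k)`, and both
counts lie below the true row counts; past the checkpoint, row `i` is separated from row `j` and
`(i, k)` is gone. -/
theorem GoodRun.okCount_le (h : GoodRun u a b T ord x M ok) {i j k : Fin n} (hjk : j ≠ k)
    (hij : u i < u j)
    (hpq : ∀ st, Invariant u a b T ord ok st → ok st.w → (i, k) ∈ st.SU → (i, k) ∈ st.SV →
      (j, k) ∈ st.SU ∧ (j, k) ∈ st.SV) {lev : ℕ} (hlev : 0 < lev)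
    (hgap : 4 * (1 / 2 : ℝ) ^ (lev + 1) < u j * u k - u i * u k) {m : ℕ} (hm : m < M) :
    okCount T ord x ok (i, k) m ≤ checkpoint lev T := by
  have key : ∀ m st, m < M → NextRound T ord st (run T ord x m) →
      okPlays T ord x ok (i, k) m ≤ okPlays T ord x ok (j, k) m →
      okPlays T ord x ok (i, k) m ≤ st.rowCount i k →
      okPlays T ord x ok (j, k) m ≤ st.rowCount j k →
      okPlays T ord x ok (i, k) m ≤ checkpoint lev T →
      okCount T ord x ok (i, k) m ≤ okCount T ord x ok (j, k) m ∧
      okCount T ord x ok (i, k) m ≤ (run T ord x m).rowCount i k ∧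
      okCount T ord x ok (j, k) m ≤ (run T ord x m).rowCount j k ∧
      okCount T ord x ok (i, k) m ≤ checkpoint lev T := by
    intro m st hm h1 g1 g2 g3 g4
    have hi := h.invariant hm
    rw [← h1.C] at g2 g3
    have e1 : okCount T ord x ok (i, k) m ≤ (run T ord x m).rowCount i k := by
      simp only [okCount, State.rowCount]
      refine add_le_add g2 ?_
      split_ifs <;> simp_all
    have e2 : okCount T ord x ok (j, k) m ≤ (run T ord x m).rowCount j k := by
      simp only [okCount, State.rowCount]
      refine add_le_add g3 ?_
      split_ifs <;> simp_all
    by_cases hq : (i, k) ∈ (run T ord x m).queue ∧ ok (run T ord x m).w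
    · have hact := (h1.mem_queue_iff hi hq.2 _).1 hq.1
      have hq' : (j, k) ∈ (run T ord x m).queue ∧ ok (run T ord x m).w :=
        ⟨(h1.mem_queue_iff hi hq.2 _).2 (hpq _ hi hq.2 hact.1 hact.2), hq.2⟩
      have f1 : okCount T ord x ok (i, k) m = okPlays T ord x ok (i, k) m + 1 := by
        rw [okCount, if_pos hq]
      have f2 : okCount T ord x ok (j, k) m = okPlays T ord x ok (j, k) m + 1 := by
        rw [okCount, if_pos hq']
      refine ⟨by omega, e1, e2, ?_⟩
      by_contra hlt
      exact hi.not_mem_SU_of_counts hjk hij hlev hgap (by omega) (by omega) hact.1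
    · have f1 : okCount T ord x ok (i, k) m = okPlays T ord x ok (i, k) m := by
        rw [okCount, if_neg hq, add_zero]
      have f2 : okPlays T ord x ok (j, k) m ≤ okCount T ord x ok (j, k) m := by
        rw [okCount]; omega
      exact ⟨by omega, e1, e2, by omega⟩
  suffices hs : ∀ m < M, okCount T ord x ok (i, k) m ≤ okCount T ord x ok (j, k) m ∧
      okCount T ord x ok (i, k) m ≤ (run T ord x m).rowCount i k ∧
      okCount T ord x ok (j, k) m ≤ (run T ord x m).rowCount j k ∧
      okCount T ord x ok (i, k) m ≤ checkpoint lev T from (hs m hm).2.2.2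
  intro m
  induction m with
  | zero =>
    intro hm
    refine key 0 _ hm (beginRound_init_nextRound T h.mem_ord) ?_ ?_ ?_ ?_ <;> simp [okPlays]
  | succ m ih =>
    intro hm
    have ih := ih (by omega)
    rcases run_succ_cases T h.nodup h.mem_ord h.ord_ne_nil x m with h1 | ⟨h1, hl⟩
    · have hwf := (run_wellFormed T h.nodup h.mem_ord h.ord_ne_nil x m).1
      rwa [okCount_midRound h.nodup hwf h1, okCount_midRound h.nodup hwf h1, h1.rowCount]
    · refine key (m + 1) _ hm h1 ?_ ?_ ?_ ?_ <;>
        simp only [okPlays_succ_nextRound hl]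
      exacts [ih.1, ih.2.1, ih.2.2.1, ih.2.2.2]

theorem GoodRun.okPlays_le (h : GoodRun u a b T ord x M ok) {i j k : Fin n} (hjk : j ≠ k)
    (hij : u i < u j)
    (hpq : ∀ st, Invariant u a b T ord ok st → ok st.w → (i, k) ∈ st.SU → (i, k) ∈ st.SV →
      (j, k) ∈ st.SU ∧ (j, k) ∈ st.SV) {lev : ℕ} (hlev : 0 < lev)
    (hgap : 4 * (1 / 2 : ℝ) ^ (lev + 1) < u j * u k - u i * u k) :
    okPlays T ord x ok (i, k) M ≤ checkpoint lev T := by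
  cases M with
  | zero => simp [okPlays]
  | succ m =>
    exact (okPlays_succ_le _ _).trans (h.okCount_le hjk hij hpq hlev hgap m.lt_succ_self)

end PairElimMono

/-! ### Loss of a good run -/

namespace PairElimMono

variable {n : ℕ} {u : Fin n → ℝ} {a b : Fin n} {T : ℕ} {ord : List (Fin n × Fin n)}
  {x : ℕ → Fin n → Fin n → ℝ} {M : ℕ} {ok : ℕ → Prop}

/-- Loss of a single play of `p` against the pair `(a, b)`. -/
def gap (u : Fin n → ℝ) (a b : Fin n) (p : Fin n × Fin n) : ℝ := u a * u b - u p.1 * u p.2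

theorem TopPair.gap_nonneg (h : TopPair u a b) {p : Fin n × Fin n} (hp : p.1 ≠ p.2) :
    0 ≤ gap u a b p := by
  have hpos := h.pos
  rw [gap, sub_nonneg]
  by_cases h1 : p.1 = a
  · rw [h1]
    exact mul_le_mul_of_nonneg_left (h.le_snd (h1 ▸ hp.symm)) (hpos a).le
  · rw [mul_comm (u a)]
    exact mul_le_mul (h.le_snd h1) (h.le_fst _) (hpos _).le (hpos _).le

theorem TopPair.gap_lt_one (h : TopPair u a b) (p : Fin n × Fin n) : gap u a b p < 1 := by
  have h1 := mul_pos (h.pos p.1) (h.pos p.2)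
  have h2 : u a * u b < 1 :=
    mul_lt_one_of_nonneg_of_lt_one_left (h.pos a).le (h.lt_one a) (h.lt_one b).le
  rw [gap]; linarith

open scoped Classical in
theorem okPlays_le_sum {R : ℕ} (hR : ∀ m < M, (run T ord x m).w < R) (p : Fin n × Fin n)
    {K : ℕ → ℝ} (hK : ∀ w, ok w → ((∑ m ∈ Finset.range M, (if (run T ord x m).w = w then
      (if (run T ord x m).queue.head? = some p then 1 else 0) else 0) : ℕ) : ℝ) ≤ K w) :
    (okPlays T ord x ok p M : ℝ) ≤ ∑ w ∈ Finset.range R, if ok w then K w else 0 := by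
  have h1 : okPlays T ord x ok p M = ∑ w ∈ Finset.range R, if ok w then
      ∑ m ∈ Finset.range M, (if (run T ord x m).w = w then
        (if (run T ord x m).queue.head? = some p then 1 else 0) else 0) else 0 := by
    have h2 : ∀ w, (if ok w then
      ∑ m ∈ Finset.range M, (if (run T ord x m).w = w then
        (if (run T ord x m).queue.head? = some p then 1 else 0) else 0) else 0) =
      ∑ m ∈ Finset.range M, (if (run T ord x m).w = w then
        (if (run T ord x m).queue.head? = some p ∧ ok (run T ord x m).w then 1 else 0)
        else 0) := by
      intro w
      split_ifs with hw
      · refine Finset.sum_congr rfl fun m _ => ?_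
        split_ifs <;> simp_all
      · symm
        refine Finset.sum_eq_zero fun m _ => ?_
        split_ifs <;> simp_all
    simp_rw [h2]
    rw [Finset.sum_comm, okPlays]
    refine Finset.sum_congr rfl fun m hm => ?_
    rw [Finset.sum_ite_eq, if_pos (Finset.mem_range.2 (hR m (Finset.mem_range.1 hm)))]
  rw [h1]
  push_cast
  refine Finset.sum_le_sum fun w _ => ?_
  split_ifs with hw
  · exact_mod_cast hK w hw
  · rfl

theorem two_le_window (w : ℕ) : (2 : ℝ) ≤ 2 ^ 2 ^ w :=
  le_self_pow₀ one_le_two (by positivity)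

theorem GoodRun.colPlays_le (h : GoodRun u a b T ord x M ok) {R : ℕ}
    (hR : ∀ m < M, (run T ord x m).w < R) {l j k : Fin n} (hlk : l ≠ k)
    (hpq : ∀ st, Invariant u a b T ord ok st → ok st.w → (l, j) ∈ st.SU → (l, j) ∈ st.SV →
      (l, k) ∈ st.SU ∧ (l, k) ∈ st.SV) {g : ℝ} (hg0 : 0 < g) (hg1 : g < 1)
    (hg : g ≤ u k * u l - u j * u l) :
    (okPlays T ord x ok (l, j) M : ℝ) ≤
      66 * (∑ w ∈ Finset.range R, Real.log ((2 : ℝ) ^ 2 ^ w)) / g ^ 2 := by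
  classical
  obtain ⟨lev, hlev, hgap, hlog⟩ := exists_checkpoint hg0 hg1
  refine (okPlays_le_sum hR (l, j) (K := fun w => 66 * Real.log ((2 : ℝ) ^ 2 ^ w) / g ^ 2)
    fun w hw => ?_).trans ?_
  · refine le_trans ?_ (hlog _ (two_le_window w))
    refine Nat.cast_le.2 (sum_window_pair_le T h.nodup h.mem_ord h.ord_ne_nil x M w _ ?_)
    intro m hm hmw
    have := h.colCount_le hlk hpq hlev (hgap.trans_le hg) hm (hmw ▸ hw)
    rwa [hmw] at this
  · rw [Finset.mul_sum, Finset.sum_div]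
    refine Finset.sum_le_sum fun w _ => ?_
    have := log_window_pos w
    split_ifs
    · rfl
    · positivity

theorem GoodRun.rowPlays_le (h : GoodRun u a b T ord x M ok) (hT : 2 ≤ T)
    {i j k : Fin n} (hjk : j ≠ k) (hij : u i < u j)
    (hpq : ∀ st, Invariant u a b T ord ok st → ok st.w → (i, k) ∈ st.SU → (i, k) ∈ st.SV →
      (j, k) ∈ st.SU ∧ (j, k) ∈ st.SV) {g : ℝ} (hg0 : 0 < g) (hg1 : g < 1)
    (hg : g ≤ u j * u k - u i * u k) :
    (okPlays T ord x ok (i, k) M : ℝ) ≤ 66 * Real.log T / g ^ 2 := by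
  obtain ⟨lev, hlev, hgap, hlog⟩ := exists_checkpoint hg0 hg1
  exact (Nat.cast_le.2 (h.okPlays_le hjk hij hpq hlev (hgap.trans_le hg))).trans
    (hlog _ (by exact_mod_cast hT))

/-- The window `w` is not preceded by a window with accurate columns and at least `K` plays. -/
def EarlyWindow (ok : ℕ → Prop) (K : ℝ) (w : ℕ) : Prop :=
  ∀ w', w' + 1 = w → ok w' → (2 : ℝ) ^ 2 ^ w' < K

-- The better of `i` and `j` is still active against `a`. If it is `i`, column `j` competes with
-- column `a` in row `i`; if it is `j`, then `(a, j)` is active too and column `j` competes with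
-- column `b` in row `a`. So each window allows O(log h / g²) plays. By `GoodRun.window_lt` there
-- are none unless the window is early.
open scoped Classical in
theorem GoodRun.otherPlays_le (h : GoodRun u a b T ord x M ok) (hT : 2 ≤ T) {R : ℕ}
    (hR : ∀ m < M, (run T ord x m).w < R) {i j : Fin n} (hia : i ≠ a) (hib : i ≠ b)
    (hja : j ≠ a) (hjb : j ≠ b) {g : ℝ} (hg0 : 0 < g) (hg1 : g < 1)
    (hg : ∀ i j, j ≠ a → j ≠ b → g ≤ u i * (u b - u j)) :
    (okPlays T ord x ok (i, j) M : ℝ) ≤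
      66 * (∑ w ∈ Finset.range R,
        if EarlyWindow ok (2 * ord.length * (66 * Real.log T / g ^ 2)) w then
          Real.log ((2 : ℝ) ^ 2 ^ w) else 0) / g ^ 2 := by
  obtain ⟨lev, hlev, hgap, hlog⟩ := exists_checkpoint hg0 hg1
  have hlogT := hlog T (by exact_mod_cast hT)
  have hu := h.top
  have hcol : ∀ m < M, ok (run T ord x m).w → (run T ord x m).colCount j i ≤
      checkpoint lev ((2 : ℝ) ^ 2 ^ (run T ord x m).w) := by
    intro m hm hok
    rcases le_total (u i) (u j) with hle | hle
    · have h1 : (run T ord x m).colCount j i ≤ (run T ord x m).colCount j a :=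
        h.colCount_mono (p := (i, j)) (q := (a, j)) (fun st hi hok h1 h2 =>
          ⟨hi.symm _ _ (hi.keepU j i hja (hi.symm _ _ h1) hle), hi.keepV hok i j hja h2 hle⟩) hm hok
      refine h1.trans (h.colCount_le (k := b) hu.ne
        (fun st hi hok _ _ => hi.top_active hok) hlev (hgap.trans_le ?_) hm hok)
      have := hg a j hja hjb
      linarith
    · refine h.colCount_le (k := a) hia
        (fun st hi hok h1 _ => hi.fst_active hok hia (hi.keepU i j hia h1 hle)) hlev
        (hgap.trans_le ?_) hm hok
      have := hg i j hja hjb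
      have := mul_le_mul_of_nonneg_right hu.le (hu.pos i).le
      linarith
  refine (okPlays_le_sum hR (i, j) (K := fun w =>
    if EarlyWindow ok (2 * ord.length * (66 * Real.log T / g ^ 2)) w then
      66 * Real.log ((2 : ℝ) ^ 2 ^ w) / g ^ 2 else 0) fun w hw => ?_).trans ?_
  · split_ifs with hearly
    · refine le_trans ?_ (hlog _ (two_le_window w))
      refine Nat.cast_le.2 (sum_window_pair_le T h.nodup h.mem_ord h.ord_ne_nil x M w _ ?_)
      rintro m hm rfl
      exact hcol m hm hw
    · refine (Nat.cast_eq_zero.2 (Finset.sum_eq_zero fun m hm => ?_)).le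
      split_ifs with h1 h2
      · exfalso
        refine hearly fun w' hw' hok => ?_
        have hm := Finset.mem_range.1 hm
        have hi := h.invariant hm
        have hmem := (hi.queue (h1.symm ▸ hw) _ (List.mem_of_mem_head? h2)).1
        have hlt : 2 ^ 2 ^ w' < 2 * ord.length * checkpoint lev T := by
          rcases hi.fst_mem_SU hia hja hmem with hmem | hmem
          · refine h.window_lt hia hib hlev (hgap.trans_le ?_) hm hmem (hw'.trans h1.symm) hok
            have := hg a i hia hib
            linarith
          · refine h.window_lt hja hjb hlev (hgap.trans_le ?_) hm hmem (hw'.trans h1.symm) hok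
            have := hg a j hja hjb
            linarith
        have hlt' : (2 : ℝ) ^ 2 ^ w' < 2 * ord.length * checkpoint lev T := by exact_mod_cast hlt
        exact hlt'.trans_le (by gcongr)
      · rfl
      · rfl
  · rw [Finset.mul_sum, Finset.sum_div]
    refine Finset.sum_le_sum fun w _ => ?_
    have := log_window_pos w
    split_ifs
    · rfl
    · simp
    · positivity
    · simp

open scoped Classical in
/-- Bound on the loss of a run. -/
theorem GoodRun.sum_gap_le (h : GoodRun u a b T ord x M ok) (hT : 2 ≤ T) {R : ℕ}
    (hR : ∀ m < M, (run T ord x m).w < R)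
    (hRT : ∑ w ∈ Finset.range R, Real.log ((2 : ℝ) ^ 2 ^ w) ≤ 4 * Real.log T)
    {g : ℝ} (hg0 : 0 < g) (hg1 : g < 1)
    (hg : ∀ i j, j ≠ a → j ≠ b → g ≤ u i * (u b - u j)) {P : ℕ → Fin n × Fin n}
    (hP : ∀ m, (run T ord x m).queue.head? = some (P m)) :
    ∑ m ∈ Finset.range M, gap u a b (P m) ≤
      (∑ w ∈ Finset.range R, if ok w then 0 else ((2 : ℝ) ^ 2 ^ w + 2 * ord.length)) +
      1056 * Real.log T *
        (∑ i ∈ Finset.univ.filter (fun i => i ≠ a ∧ i ≠ b), 1 / (u a * (u b - u i))) +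
      n ^ 2 * (66 * (∑ w ∈ Finset.range R,
        if EarlyWindow ok (2 * ord.length * (66 * Real.log T / g ^ 2)) w then
          Real.log ((2 : ℝ) ^ 2 ^ w) else 0) / g ^ 2) := by
  have hu := h.top
  have hPord : ∀ m, (P m).1 ≠ (P m).2 := fun m => by
    have h1 := List.mem_of_mem_head? (hP m)
    exact (h.mem_ord _).1 ((run_wellFormed T h.nodup h.mem_ord h.ord_ne_nil x
      m).1.queue_sublist.subset h1)
  set D : ℝ := 66 * (∑ w ∈ Finset.range R,
        if EarlyWindow ok (2 * ord.length * (66 * Real.log T / g ^ 2)) w then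
          Real.log ((2 : ℝ) ^ 2 ^ w) else 0) / g ^ 2 with hD
  have hD0 : 0 ≤ D := by
    rw [hD]
    have : 0 ≤ ∑ w ∈ Finset.range R,
        if EarlyWindow ok (2 * ord.length * (66 * Real.log T / g ^ 2)) w then
          Real.log ((2 : ℝ) ^ 2 ^ w) else 0 :=
      Finset.sum_nonneg fun w _ => by
        have := log_window_pos w
        split_ifs <;> positivity
    positivity
  -- 264 = 66 · 4: a column comparison costs 66 log h_w per window, and the log h_w sum to at most 4
  -- log T. Row comparisons need only 66.
  set f : Fin n → ℝ := fun i => if i ≠ a ∧ i ≠ b then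
    264 * Real.log T * (1 / (u a * (u b - u i))) else 0 with hf
  have hlT := h.log_pos
  have hf0 : ∀ i, 0 ≤ f i := by
    intro i
    simp only [hf]
    split_ifs with hi
    · have := sub_pos.2 (hu.lt i hi.1 hi.2)
      have := hu.pos a
      positivity
    · rfl
  have hsplit : ∀ m, gap u a b (P m) =
      (if ok (run T ord x m).w then gap u a b (P m) else 0) +
      (if ok (run T ord x m).w then 0 else gap u a b (P m)) := by
    intro m
    split_ifs <;> simp
  -- Each iteration in a failed window is charged 2, its number of plays, so that
  -- `sum_window_plays_le` applies.
  have hbad : ∑ m ∈ Finset.range M, (if ok (run T ord x m).w then 0 else gap u a b (P m)) ≤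
      ∑ w ∈ Finset.range R, if ok w then 0 else ((2 : ℝ) ^ 2 ^ w + 2 * ord.length) := by
    calc ∑ m ∈ Finset.range M, (if ok (run T ord x m).w then 0 else gap u a b (P m))
        ≤ ∑ m ∈ Finset.range M, ∑ w ∈ Finset.range R,
          (if (run T ord x m).w = w then (if ok w then 0 else 2) else 0 : ℝ) := by
          refine Finset.sum_le_sum fun m hm => ?_
          rw [Finset.sum_ite_eq, if_pos (Finset.mem_range.2 (hR m (Finset.mem_range.1 hm)))]
          have := hu.gap_lt_one (P m)
          split_ifs <;> linarith
      _ = ∑ w ∈ Finset.range R, ∑ m ∈ Finset.range M,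
          (if (run T ord x m).w = w then (if ok w then 0 else 2) else 0 : ℝ) := Finset.sum_comm
      _ ≤ _ := by
          refine Finset.sum_le_sum fun w _ => ?_
          split_ifs with hw
          · simp
          · exact_mod_cast sum_window_plays_le T h.nodup h.mem_ord h.ord_ne_nil x M w
  have hgood : ∑ m ∈ Finset.range M, (if ok (run T ord x m).w then gap u a b (P m) else 0) =
      ∑ p, gap u a b p * okPlays T ord x ok p M := by
    simp_rw [okPlays, hP]
    push_cast
    simp_rw [Finset.mul_sum]
    rw [Finset.sum_comm]
    refine Finset.sum_congr rfl fun m _ => ?_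
    by_cases hok : ok (run T ord x m).w
    · simp [hok]
    · simp [hok]
  -- The loss per play cancels one factor of the squared gap in the number of plays.
  have hdiv : ∀ {g' N C c : ℝ}, 0 < c → c ≤ g' → N ≤ C / g' ^ 2 → 0 ≤ C →
      g' * N ≤ C * (1 / c) := by
    intro g' N C c hc hcg hN hC
    have hg' : 0 < g' := hc.trans_le hcg
    calc g' * N ≤ g' * (C / g' ^ 2) := by gcongr
      _ = C * (1 / g') := by field_simp
      _ ≤ C * (1 / c) := by gcongr
  have hpair : ∀ p, gap u a b p * okPlays T ord x ok p M ≤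
      (if p.2 = a ∨ p.2 = b then f p.1 else 0) + (if p.1 = a ∨ p.1 = b then f p.2 else 0) + D := by
    rintro ⟨i, j⟩
    simp only
    have hnn1 : 0 ≤ (if j = a ∨ j = b then f i else 0) := by split_ifs <;> simp [hf0]
    have hnn2 : 0 ≤ (if i = a ∨ i = b then f j else 0) := by split_ifs <;> simp [hf0]
    by_cases hij : i = j
    · have : okPlays T ord x ok (i, j) M = 0 := by
        rw [okPlays]
        refine Finset.sum_eq_zero fun m _ => if_neg fun h1 => ?_
        rw [hP] at h1
        have := hPord m
        rw [Option.some.inj h1.1] at this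
        exact this hij
      rw [this, Nat.cast_zero, mul_zero]
      positivity
    have hi0 := hu.pos i
    have hj0 := hu.pos j
    have ha0 := hu.pos a
    have hb0 := hu.pos b
    by_cases hia : i = a
    · subst hia
      by_cases hjb : j = b
      · subst hjb
        rw [gap, sub_self, zero_mul]
        positivity
      have hj := hu.lt j (Ne.symm hij) hjb
      have hc : 0 < u i * (u b - u j) := mul_pos ha0 (sub_pos.2 hj)
      have hgap : gap u i b (i, j) = u b * u i - u j * u i := by rw [gap]; ring
      have h1 := h.colPlays_le hR (l := i) (j := j) (k := b) hu.ne
        (fun st hi hok _ _ => hi.top_active hok) (g := gap u i b (i, j))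
        (by rw [hgap]; linarith) (hu.gap_lt_one _) hgap.le
      have h2 := hdiv (g' := gap u i b (i, j)) (C := 264 * Real.log T) hc (by rw [hgap]; linarith)
        (h1.trans (div_le_div_of_nonneg_right (by linarith) (sq_nonneg _))) (by positivity)
      have h3 : f j = 264 * Real.log T * (1 / (u i * (u b - u j))) := by
        simp only [hf]; rw [if_pos ⟨Ne.symm hij, hjb⟩]
      rw [if_pos (Or.inl rfl), h3]
      linarith
    by_cases hib : i = b
    · subst hib
      by_cases hja : j = a
      · subst hja
        rw [gap, mul_comm, sub_eq_zero.2 (mul_comm (u j) (u i)), mul_zero]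
        positivity
      have hj := hu.lt j hja (Ne.symm hij)
      have hc : 0 < u a * (u i - u j) := mul_pos ha0 (sub_pos.2 hj)
      have hgap : gap u a i (i, j) = u a * u i - u j * u i := by rw [gap]; ring
      have hle : u a * (u i - u j) ≤ gap u a i (i, j) := by
        have := mul_le_mul_of_nonneg_right hu.le hj0.le
        rw [hgap]; linarith
      have h1 := h.colPlays_le hR (l := i) (j := j) (k := a) hia
        (fun st hi hok _ _ => hi.top_swap_active hu hok) (g := gap u a i (i, j))
        (hc.trans_le hle) (hu.gap_lt_one _) hgap.le
      have h2 := hdiv (C := 264 * Real.log T) hc hle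
        (h1.trans (div_le_div_of_nonneg_right (by linarith) (sq_nonneg _))) (by positivity)
      have h3 : f j = 264 * Real.log T * (1 / (u a * (u i - u j))) := by
        simp only [hf]; rw [if_pos ⟨hja, Ne.symm hij⟩]
      rw [if_pos (Or.inr rfl : i = a ∨ i = i), h3]
      linarith
    have hi := hu.lt i hia hib
    have hc : 0 < u a * (u b - u i) := mul_pos ha0 (sub_pos.2 hi)
    have h3 : f i = 264 * Real.log T * (1 / (u a * (u b - u i))) := by
      simp only [hf]; rw [if_pos ⟨hia, hib⟩]
    have h4 : 66 * Real.log T * (1 / (u a * (u b - u i))) ≤ f i := by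
      rw [h3]; gcongr; norm_num
    by_cases hja : j = a
    · subst hja
      have hgap : gap u j b (i, j) = u b * u j - u i * u j := by rw [gap]; ring
      have hle : u j * (u b - u i) ≤ gap u j b (i, j) := by rw [hgap]; linarith
      have h1 := h.rowPlays_le hT (i := i) (j := b) (k := j) hu.ne.symm hi
        (fun st hi hok _ _ => hi.top_swap_active hu hok) (g := gap u j b (i, j))
        (hc.trans_le hle) (hu.gap_lt_one _) hgap.le
      have h2 := hdiv hc hle h1 (by positivity)
      rw [if_pos (Or.inl rfl)]
      linarith
    by_cases hjb : j = b
    · subst hjb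
      have hgap : gap u a j (i, j) = u a * u j - u i * u j := by rw [gap]
      have hle : u a * (u j - u i) ≤ gap u a j (i, j) := by
        have := mul_le_mul_of_nonneg_right hu.le hi0.le
        rw [hgap]; linarith
      have h1 := h.rowPlays_le hT (i := i) (j := a) (k := j) hu.ne (hi.trans_le hu.le)
        (fun st hi hok _ _ => hi.top_active hok) (g := gap u a j (i, j))
        (hc.trans_le hle) (hu.gap_lt_one _) hgap.le
      have h2 := hdiv hc hle h1 (by positivity)
      rw [if_pos (Or.inr rfl : j = a ∨ j = j)]
      linarith
    have h5 := h.otherPlays_le hT hR hia hib hja hjb hg0 hg1 hg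
    have h6 : gap u a b (i, j) * okPlays T ord x ok (i, j) M ≤ okPlays T ord x ok (i, j) M :=
      mul_le_of_le_one_left (Nat.cast_nonneg _) (hu.gap_lt_one _).le
    linarith
  have hcount : ∀ c : ℝ, (∑ i : Fin n, if i = a ∨ i = b then c else 0) = 2 * c := by
    intro c
    rw [← Finset.sum_filter, Finset.sum_const,
      show Finset.univ.filter (fun i => i = a ∨ i = b) = {a, b} by ext; simp,
      Finset.card_pair hu.ne]
    simp
  -- Each `f i` occurs four times: for the pairs of `i` with `a` or `b`, in both orders. This gives
  -- 1056 = 4 · 264.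
  have hsum : ∑ p : Fin n × Fin n, ((if p.2 = a ∨ p.2 = b then f p.1 else 0) +
      (if p.1 = a ∨ p.1 = b then f p.2 else 0) + D) = 4 * ∑ i, f i + n ^ 2 * D := by
    rw [Finset.sum_add_distrib, Finset.sum_add_distrib, Fintype.sum_prod_type,
      Fintype.sum_prod_type_right]
    simp_rw [hcount, ← Finset.mul_sum]
    simp [Fintype.card_prod]
    ring
  have hfsum : 4 * ∑ i, f i = 1056 * Real.log T *
      (∑ i ∈ Finset.univ.filter (fun i => i ≠ a ∧ i ≠ b), 1 / (u a * (u b - u i))) := by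
    simp only [hf]
    rw [← Finset.sum_filter, ← Finset.mul_sum]
    ring
  rw [Finset.sum_congr rfl fun m _ => hsplit m, Finset.sum_add_distrib, hgood]
  have := (Finset.sum_le_sum fun p _ => hpair p).trans_eq hsum
  rw [hfsum] at this
  linarith

end PairElimMono

/-! ### Number of windows and sums of their logarithms -/

namespace PairElimMono

variable {n : ℕ}

/-- Number of windows that can be reached within `T` plays. -/
def numWindows (T : ℕ) : ℕ := Nat.log 2 (Nat.log 2 T) + 2

theorem window_lt_numWindows (T : ℕ) {ord : List (Fin n × Fin n)} (hnd : ord.Nodup)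
    (hord : ∀ p, p ∈ ord ↔ p.1 ≠ p.2) (hne : ord ≠ []) (x : ℕ → Fin n → Fin n → ℝ) {m : ℕ}
    (hm : 2 * m < T) : (run T ord x m).w < numWindows T := by
  rw [numWindows]
  by_contra! hw
  have h1 := (run_window_bound T hnd hord hne x m).2 ((run T ord x m).w - 1) (by omega)
  have hT : T ≠ 0 := by omega
  have h2 := (Nat.le_log_iff_pow_le one_lt_two hT).2 (h1.le.trans hm.le)
  have h3 : Nat.log 2 T ≠ 0 := (lt_of_lt_of_le (Nat.two_pow_pos _) h2).ne'
  have h4 := (Nat.le_log_iff_pow_le one_lt_two h3).2 h2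
  omega

theorem log_window (w : ℕ) : Real.log ((2 : ℝ) ^ 2 ^ w) = 2 ^ w * Real.log 2 := by
  rw [Real.log_pow]; push_cast; rfl

theorem two_pow_numWindows_le {T : ℕ} (hT : 2 ≤ T) :
    2 ^ (Nat.log 2 (Nat.log 2 T)) * Real.log 2 ≤ Real.log T := by
  rw [← log_window]
  have h1 : Nat.log 2 T ≠ 0 := (Nat.log_pos one_lt_two hT).ne'
  have h2 := (Nat.le_log_iff_pow_le one_lt_two h1).1 le_rfl
  have h3 := (Nat.le_log_iff_pow_le one_lt_two (by omega : T ≠ 0)).1 h2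
  exact Real.log_le_log (by positivity) (by exact_mod_cast h3)

/-- The geometric sum is below 2^R log 2 with R = `numWindows T`; the `+ 2` in R is the factor 4. -/
theorem sum_log_window_le {T : ℕ} (hT : 2 ≤ T) :
    ∑ w ∈ Finset.range (numWindows T), Real.log ((2 : ℝ) ^ 2 ^ w) ≤ 4 * Real.log T := by
  simp_rw [log_window]
  rw [← Finset.sum_mul, geom_sum_eq (by norm_num), numWindows, pow_add]
  have := two_pow_numWindows_le hT
  have := Real.log_pos one_lt_two
  linarith

theorem one_lt_log_three : 1 < Real.log 3 := by
  rw [Real.lt_log_iff_exp_lt (by norm_num)]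
  have := Real.exp_one_lt_d9
  linarith

theorem log_log_le_of_three_le {T : ℕ} (hT : 3 ≤ T) :
    0 < Real.log (Real.log 3) ∧ Real.log (Real.log 3) ≤ Real.log (Real.log T) := by
  have h1 := one_lt_log_three
  have h2 : Real.log 3 ≤ Real.log T := Real.log_le_log (by norm_num) (by exact_mod_cast hT)
  exact ⟨Real.log_pos h1, Real.log_le_log (by linarith) h2⟩

/-- Additive constants are absorbed because log log T ≥ log log 3 > 0; this is where `3 ≤ T`
matters. -/
theorem exists_numWindows_le : ∃ c : ℝ, 0 < c ∧ ∀ T : ℕ, 3 ≤ T →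
    (numWindows T : ℝ) ≤ c * Real.log (Real.log T) := by
  have hl2 := Real.log_pos one_lt_two
  have hll3 := (log_log_le_of_three_le (le_refl 3)).1
  refine ⟨1 / Real.log 2 + (|Real.log (Real.log 2)| / Real.log 2 + 2) / Real.log (Real.log 3),
    by positivity, fun T hT => ?_⟩
  have h1 := two_pow_numWindows_le (by omega : 2 ≤ T)
  have h2 := Real.log_le_log (by positivity) h1
  rw [Real.log_mul (by positivity) hl2.ne', Real.log_pow] at h2
  have h3 := (log_log_le_of_three_le hT).2
  have h4 : (Nat.log 2 (Nat.log 2 T) : ℝ) ≤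
      Real.log (Real.log T) / Real.log 2 + |Real.log (Real.log 2)| / Real.log 2 := by
    rw [← add_div, le_div_iff₀ hl2]
    have := neg_abs_le (Real.log (Real.log 2))
    linarith
  have h5 : |Real.log (Real.log 2)| / Real.log 2 + 2 ≤
      (|Real.log (Real.log 2)| / Real.log 2 + 2) / Real.log (Real.log 3) *
        Real.log (Real.log T) := by
    rw [div_mul_eq_mul_div, le_div_iff₀ hll3]
    gcongr
  rw [numWindows]
  push_cast
  rw [add_mul, one_div_mul_eq_div]
  linarith

-- A sum of distinct powers of two is less than twice the largest, and the largest logarithm is at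
-- most log K.
open scoped Classical in
theorem sum_log_window_lt_le (r : ℕ) (K : ℝ) :
    ∑ w ∈ Finset.range r, (if (2 : ℝ) ^ 2 ^ w < K then Real.log ((2 : ℝ) ^ 2 ^ w) else 0) ≤
      2 * max (Real.log K) 0 := by
  rw [← Finset.sum_filter]
  set S := (Finset.range r).filter fun w => (2 : ℝ) ^ 2 ^ w < K
  rcases S.eq_empty_or_nonempty with h | h
  · rw [h]; simp
  have hk := S.max'_mem h
  set k := S.max' h
  have hl2 := Real.log_pos one_lt_two
  have h1 : ∑ w ∈ S, 2 ^ w < 2 ^ (k + 1) :=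
    Nat.geomSum_lt le_rfl fun w hw => Nat.lt_succ_of_le (S.le_max' w hw)
  have h2 : (∑ w ∈ S, (2 : ℝ) ^ w) ≤ 2 ^ (k + 1) := by exact_mod_cast h1.le
  have h3 : 2 ^ k * Real.log 2 ≤ Real.log K := by
    rw [← log_window]
    exact Real.log_le_log (by positivity) (Finset.mem_filter.1 hk).2.le
  simp_rw [log_window]
  rw [← Finset.sum_mul]
  calc (∑ w ∈ S, (2 : ℝ) ^ w) * Real.log 2 ≤ 2 ^ (k + 1) * Real.log 2 := by gcongr
    _ = 2 * (2 ^ k * Real.log 2) := by ring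
    _ ≤ 2 * max (Real.log K) 0 := by
        have := le_max_left (Real.log K) 0
        linarith

-- Window `w + 1` is early only if window `w` failed or is short. Its logarithm is twice that of
-- `w`, so it is charged to `w`; window 0 has no predecessor and contributes log 2.
open scoped Classical in
theorem sum_earlyWindow_le (ok : ℕ → Prop) (K : ℝ) (R : ℕ) :
    ∑ w ∈ Finset.range R, (if EarlyWindow ok K w then Real.log ((2 : ℝ) ^ 2 ^ w) else 0) ≤
      Real.log 2 + (∑ w ∈ Finset.range R, if ok w then 0 else 2 * Real.log ((2 : ℝ) ^ 2 ^ w)) +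
        4 * max (Real.log K) 0 := by
  have hl2 := Real.log_pos one_lt_two
  have hnn : ∀ w, 0 ≤ (if ok w then 0 else 2 * Real.log ((2 : ℝ) ^ 2 ^ w)) := fun w => by
    have := log_window_pos w
    split_ifs <;> positivity
  cases R with
  | zero => simp; positivity
  | succ r =>
    rw [Finset.sum_range_succ']
    have h0 : (if EarlyWindow ok K 0 then Real.log ((2 : ℝ) ^ 2 ^ 0) else 0) ≤ Real.log 2 := by
      split_ifs
      · simp
      · exact hl2.le
    have hterm : ∀ w, (if EarlyWindow ok K (w + 1) then Real.log ((2 : ℝ) ^ 2 ^ (w + 1)) else 0) ≤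
        (if ok w then 0 else 2 * Real.log ((2 : ℝ) ^ 2 ^ w)) +
        2 * (if (2 : ℝ) ^ 2 ^ w < K then Real.log ((2 : ℝ) ^ 2 ^ w) else 0) := by
      intro w
      have h1 := log_window_pos w
      have h2 : Real.log ((2 : ℝ) ^ 2 ^ (w + 1)) = 2 * Real.log ((2 : ℝ) ^ 2 ^ w) := by
        rw [log_window, log_window]; ring
      rw [h2]
      by_cases hE : EarlyWindow ok K (w + 1)
      · rw [if_pos hE]
        by_cases hok : ok w
        · rw [if_pos (hE w rfl hok), if_pos hok]; linarith
        · rw [if_neg hok]; split_ifs <;> linarith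
      · rw [if_neg hE]
        have := hnn w
        split_ifs at * <;> linarith
    have h1 := Finset.sum_le_sum fun w (_ : w ∈ Finset.range r) => hterm w
    rw [Finset.sum_add_distrib, ← Finset.mul_sum] at h1
    have h2 := sum_log_window_lt_le r K
    rw [Finset.sum_range_succ _ r]
    have := hnn r
    linarith

end PairElimMono

/-! ### Measurability of the memory -/

namespace PairElimMono

variable {n : ℕ} {Ω : Type*}

/-- A random memory all of whose components are measurable. -/
structure MeasurableState [MeasurableSpace Ω] (f : Ω → State n) : Prop where
  X : ∀ i k, Measurable fun ω => (f ω).X i k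
  C : ∀ i k, Measurable fun ω => (f ω).C i k
  Xw : ∀ i k, Measurable fun ω => (f ω).Xw i k
  Cw : ∀ i k, Measurable fun ω => (f ω).Cw i k
  loU : ∀ i k, Measurable fun ω => (f ω).QU.lo i k
  hiU : ∀ i k, Measurable fun ω => (f ω).QU.hi i k
  loV : ∀ i k, Measurable fun ω => (f ω).QV.lo i k
  hiV : ∀ i k, Measurable fun ω => (f ω).QV.hi i k
  SU : ∀ p, Measurable fun ω => p ∈ (f ω).SU
  SV : ∀ p, Measurable fun ω => p ∈ (f ω).SV
  w : Measurable fun ω => (f ω).w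
  s : Measurable fun ω => (f ω).s
  queue : ∀ l, Measurable fun ω => (f ω).queue = l

theorem MeasurableState.mono {m₁ m₂ : MeasurableSpace Ω} (h : m₁ ≤ m₂) {f : Ω → State n}
    (hf : @MeasurableState n Ω m₁ f) : @MeasurableState n Ω m₂ f := by
  obtain ⟨h1, h2, h3, h4, h5, h6, h7, h8, h9, h10, h11, h12, h13⟩ := hf
  exact @MeasurableState.mk n Ω m₂ f (fun i k => (h1 i k).mono h le_rfl)
    (fun i k => (h2 i k).mono h le_rfl) (fun i k => (h3 i k).mono h le_rfl)
    (fun i k => (h4 i k).mono h le_rfl) (fun i k => (h5 i k).mono h le_rfl)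
    (fun i k => (h6 i k).mono h le_rfl) (fun i k => (h7 i k).mono h le_rfl)
    (fun i k => (h8 i k).mono h le_rfl) (fun i => (h9 i).mono h le_rfl)
    (fun i => (h10 i).mono h le_rfl) (h11.mono h le_rfl) (h12.mono h le_rfl)
    (fun i => (h13 i).mono h le_rfl)

section

variable [MeasurableSpace Ω]

/-- Used to freeze the discrete parts of the memory (queue, window, active sets), after which every
branch of the algorithm is an explicit measurable expression. -/
theorem measurable_of_countable_cases {ι β : Type*} [Countable ι] [MeasurableSpace β] {q : Ω → ι}
    (hq : ∀ l, Measurable fun ω => q ω = l) {F : Ω → β}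
    (hF : ∀ l, ∃ g : Ω → β, Measurable g ∧ ∀ ω, q ω = l → F ω = g ω) : Measurable F := by
  choose g hg hFg using hF
  intro A hA
  have : F ⁻¹' A = ⋃ l, {ω | q ω = l} ∩ g l ⁻¹' A := by
    ext ω
    simp only [Set.mem_preimage, Set.mem_iUnion, Set.mem_inter_iff, Set.mem_ofPred_eq]
    refine ⟨fun h => ⟨q ω, rfl, hFg _ ω rfl ▸ h⟩, ?_⟩
    rintro ⟨l, hl, h⟩
    rwa [hFg l ω hl]
  rw [this]
  exact MeasurableSet.iUnion fun l => (measurableSet_setOfPred.2 (hq l)).inter (hg l hA)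

theorem measurableState_of_countable_cases {ι : Type*} [Countable ι] {q : Ω → ι}
    (hq : ∀ l, Measurable fun ω => q ω = l) {F : Ω → State n}
    (hF : ∀ l, ∃ g : Ω → State n, MeasurableState g ∧ ∀ ω, q ω = l → F ω = g ω) :
    MeasurableState F := by
  have key : ∀ {β : Type} [MeasurableSpace β] (π : State n → β),
      (∀ g : Ω → State n, MeasurableState g → Measurable fun ω => π (g ω)) →
      Measurable fun ω => π (F ω) := fun π hπ =>
    measurable_of_countable_cases hq fun l => by
      obtain ⟨g, hg, hFg⟩ := hF l
      exact ⟨fun ω => π (g ω), hπ g hg, fun ω hω => by rw [hFg ω hω]⟩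
  exact ⟨fun i k => key (fun st => st.X i k) fun g hg => hg.X i k,
    fun i k => key (fun st => st.C i k) fun g hg => hg.C i k,
    fun i k => key (fun st => st.Xw i k) fun g hg => hg.Xw i k,
    fun i k => key (fun st => st.Cw i k) fun g hg => hg.Cw i k,
    fun i k => key (fun st => st.QU.lo i k) fun g hg => hg.loU i k,
    fun i k => key (fun st => st.QU.hi i k) fun g hg => hg.hiU i k,
    fun i k => key (fun st => st.QV.lo i k) fun g hg => hg.loV i k,
    fun i k => key (fun st => st.QV.hi i k) fun g hg => hg.hiV i k,
    fun p => key (fun st => p ∈ st.SU) fun g hg => hg.SU p,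
    fun p => key (fun st => p ∈ st.SV) fun g hg => hg.SV p,
    key (fun st => st.w) fun g hg => hg.w,
    key (fun st => st.s) fun g hg => hg.s,
    fun l => key (fun st => st.queue = l) fun g hg => hg.queue l⟩

theorem measurable_eq_const {β : Type*} [MeasurableSpace β] [MeasurableSingletonClass β]
    {q : Ω → β} (hq : Measurable q) (l : β) : Measurable fun ω => q ω = l :=
  measurableSet_setOfPred.1 (hq (measurableSet_singleton l))

theorem measurableState_const (st : State n) : MeasurableState fun _ : Ω => st :=
  ⟨fun _ _ => measurable_const, fun _ _ => measurable_const, fun _ _ => measurable_const,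
    fun _ _ => measurable_const, fun _ _ => measurable_const, fun _ _ => measurable_const,
    fun _ _ => measurable_const, fun _ _ => measurable_const, fun _ => measurable_const,
    fun _ => measurable_const, measurable_const, measurable_const, fun _ => measurable_const⟩

theorem MeasurableState.sample {f : Ω → State n} (hf : MeasurableState f) (p : Fin n × Fin n)
    {y z : Ω → ℝ} (hy : Measurable y) (hz : Measurable z) :
    MeasurableState fun ω => PairElimMono.sample p (y ω) (z ω) (f ω) := by
  refine ⟨fun i k => (hf.X i k).add ?_, fun i k => (hf.C i k).add measurable_const,
    fun i k => (hf.Xw i k).add ?_, fun i k => (hf.Cw i k).add measurable_const,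
    hf.loU, hf.hiU, hf.loV, hf.hiV, hf.SU, hf.SV, hf.w, hf.s.add measurable_const, hf.queue⟩
  · split_ifs <;> [exact hy; exact measurable_const]
  · split_ifs <;> [exact hz; exact measurable_const]

theorem MeasurableState.endRound {f : Ω → State n} (hf : MeasurableState f) :
    MeasurableState fun ω => PairElimMono.endRound (f ω) := by
  refine measurableState_of_countable_cases (q := fun ω => ((f ω).w, (f ω).s))
    (measurable_eq_const (hf.w.prodMk hf.s)) ?_
  rintro ⟨w, s⟩
  by_cases hw : 2 ^ 2 ^ w < s
  · refine ⟨fun ω => { f ω with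
      Xw := fun _ _ => 0
      Cw := fun _ _ => 0
      QV := Bounds.trivial n
      SV := allPairs n
      w := w + 1
      s := 0 }, ?_, ?_⟩
    · exact ⟨hf.X, hf.C, fun _ _ => measurable_const, fun _ _ => measurable_const,
        hf.loU, hf.hiU, fun _ _ => measurable_const, fun _ _ => measurable_const,
        hf.SU, fun p => measurable_const (a := p ∈ allPairs n), measurable_const,
        measurable_const, hf.queue⟩
    · intro ω hω
      simp only [Prod.mk.injEq] at hω
      rw [PairElimMono.endRound, hω.1, hω.2, if_pos hw]
  · refine ⟨f, hf, fun ω hω => ?_⟩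
    simp only [Prod.mk.injEq] at hω
    rw [PairElimMono.endRound, hω.1, hω.2, if_neg hw]

theorem measurable_dominated {Q : Ω → Bounds n} (hlo : ∀ i k, Measurable fun ω => (Q ω).lo i k)
    (hhi : ∀ i k, Measurable fun ω => (Q ω).hi i k) (i j : Fin n) :
    Measurable fun ω => (Q ω).Dominated i j :=
  Measurable.exists fun k => measurableSet_setOfPred.1 (measurableSet_lt (hhi i k) (hlo j k))

theorem measurable_rowRemoved {Q : Ω → Bounds n} (hlo : ∀ i k, Measurable fun ω => (Q ω).lo i k)
    (hhi : ∀ i k, Measurable fun ω => (Q ω).hi i k) (p : Fin n × Fin n) :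
    Measurable fun ω => RowRemoved (Q ω) p := by
  have := measurable_dominated hlo hhi
  unfold RowRemoved
  fun_prop

theorem measurable_colRemoved {Q : Ω → Bounds n} (hlo : ∀ i k, Measurable fun ω => (Q ω).lo i k)
    (hhi : ∀ i k, Measurable fun ω => (Q ω).hi i k) (p : Fin n × Fin n) :
    Measurable fun ω => ColRemoved (Q ω) p := by
  have := measurable_dominated hlo hhi
  unfold ColRemoved
  fun_prop


theorem measurable_confidenceBound_lo {X : Ω → Fin n → Fin n → ℝ} {C : Ω → Fin n → Fin n → ℕ}
    {Q : Ω → Bounds n} (hX : ∀ i k, Measurable fun ω => X ω i k)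
    (hC : ∀ i k, Measurable fun ω => C ω i k) (hlo : ∀ i k, Measurable fun ω => (Q ω).lo i k)
    (h : ℝ) (i k : Fin n) :
    Measurable fun ω => (confidenceBound (X ω) (C ω) h (Q ω)).lo i k := by
  have hc : Measurable fun ω => (C ω i k : ℝ) := measurable_from_top.comp (hC i k)
  refine Measurable.ite (hC i k (MeasurableSet.of_discrete (s := {c | IsCheckpoint h c})))
    (measurable_coe_real_ereal.comp ?_) (hlo i k)
  exact ((hX i k).div hc).sub (measurable_const.div hc).sqrt

theorem measurable_confidenceBound_hi {X : Ω → Fin n → Fin n → ℝ} {C : Ω → Fin n → Fin n → ℕ}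
    {Q : Ω → Bounds n} (hX : ∀ i k, Measurable fun ω => X ω i k)
    (hC : ∀ i k, Measurable fun ω => C ω i k) (hhi : ∀ i k, Measurable fun ω => (Q ω).hi i k)
    (h : ℝ) (i k : Fin n) :
    Measurable fun ω => (confidenceBound (X ω) (C ω) h (Q ω)).hi i k := by
  have hc : Measurable fun ω => (C ω i k : ℝ) := measurable_from_top.comp (hC i k)
  refine Measurable.ite (hC i k (MeasurableSet.of_discrete (s := {c | IsCheckpoint h c})))
    (measurable_coe_real_ereal.comp ?_) (hhi i k)
  exact ((hX i k).div hc).add (measurable_const.div hc).sqrt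

theorem measurable_finset_eq {ι : Type*} [Countable ι] {S : Ω → Finset ι}
    (hS : ∀ p, Measurable fun ω => p ∈ S ω) (A : Finset ι) : Measurable fun ω => S ω = A := by
  have : (fun ω => S ω = A) = fun ω => ∀ p, p ∈ S ω ↔ p ∈ A := by
    funext ω; rw [Finset.ext_iff]
  rw [this]
  exact Measurable.forall fun p => (hS p).iff measurable_const

theorem MeasurableState.beginRound {f : Ω → State n} (hf : MeasurableState f) (T : ℕ)
    (ord : List (Fin n × Fin n)) :
    MeasurableState fun ω => PairElimMono.beginRound T ord (f ω) := by
  classical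
  have loU := measurable_confidenceBound_lo hf.X hf.C hf.loU T
  have hiU := measurable_confidenceBound_hi hf.X hf.C hf.hiU T
  have hwin : ∀ i k, (Measurable fun ω => (PairElimMono.beginRound T ord (f ω)).QV.lo i k) ∧
      Measurable fun ω => (PairElimMono.beginRound T ord (f ω)).QV.hi i k := by
    intro i k
    constructor
    · refine measurable_of_countable_cases (measurable_eq_const hf.w) fun w =>
        ⟨_, measurable_confidenceBound_lo hf.Xw hf.Cw hf.loV ((2 : ℝ) ^ 2 ^ w) i k, ?_⟩
      rintro ω rfl
      rfl
    · refine measurable_of_countable_cases (measurable_eq_const hf.w) fun w =>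
        ⟨_, measurable_confidenceBound_hi hf.Xw hf.Cw hf.hiV ((2 : ℝ) ^ 2 ^ w) i k, ?_⟩
      rintro ω rfl
      rfl
  have loV := fun i k => (hwin i k).1
  have hiV := fun i k => (hwin i k).2
  have SU : ∀ p, Measurable fun ω => p ∈ (PairElimMono.beginRound T ord (f ω)).SU := by
    intro p
    simp only [PairElimMono.beginRound, Finset.mem_filter]
    exact (hf.SU p).and (measurable_rowRemoved loU hiU p).not
  have SV : ∀ p, Measurable fun ω => p ∈ (PairElimMono.beginRound T ord (f ω)).SV := by
    intro p
    have h1 : (fun ω => p ∈ (PairElimMono.beginRound T ord (f ω)).SV) = fun ω =>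
        p ∈ (f ω).SV ∧ ¬ ColRemoved (PairElimMono.beginRound T ord (f ω)).QV p := by
      funext ω
      simp only [PairElimMono.beginRound, Finset.mem_filter]
    rw [h1]
    exact (hf.SV p).and (measurable_colRemoved loV hiV p).not
  refine ⟨hf.X, hf.C, hf.Xw, hf.Cw, loU, hiU, loV, hiV, SU, SV, hf.w, hf.s, fun l => ?_⟩
  refine measurable_of_countable_cases (measurable_finset_eq SU) fun A =>
    ⟨_, measurable_of_countable_cases (measurable_finset_eq SV) (F := fun ω =>
      (if A ∩ (PairElimMono.beginRound T ord (f ω)).SV = ∅ then ord else ord.filter fun p =>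
        p ∈ A ∩ (PairElimMono.beginRound T ord (f ω)).SV) = l) fun B =>
      ⟨_, measurable_const (a := (if A ∩ B = ∅ then ord else ord.filter fun p => p ∈ A ∩ B) = l),
        ?_⟩, ?_⟩
  · rintro ω rfl
    rfl
  · rintro ω rfl
    simp only [PairElimMono.beginRound]
    congr!

theorem MeasurableState.step {f : Ω → State n} (hf : MeasurableState f) (T : ℕ)
    (ord : List (Fin n × Fin n)) {y z : Ω → Fin n → Fin n → ℝ}
    (hy : ∀ i k, Measurable fun ω => y ω i k) (hz : ∀ i k, Measurable fun ω => z ω i k) :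
    MeasurableState fun ω => PairElimMono.step T ord (y ω) (z ω) (f ω) := by
  refine measurableState_of_countable_cases (q := fun ω => (f ω).queue) hf.queue fun l => ?_
  match l with
  | [] => exact ⟨f, hf, fun ω hω => by rw [PairElimMono.step, hω]⟩
  | [p] => exact ⟨_, ((hf.sample p (hy p.1 p.2) (hz p.1 p.2)).endRound.beginRound T ord),
      fun ω hω => by rw [PairElimMono.step, hω]⟩
  | p :: q :: rest =>
    have h := hf.sample p (hy p.1 p.2) (hz p.1 p.2)
    refine ⟨fun ω => { PairElimMono.sample p (y ω p.1 p.2) (z ω p.1 p.2) (f ω) with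
      queue := q :: rest }, ⟨h.X, h.C, h.Xw, h.Cw, h.loU, h.hiU, h.loV, h.hiV, h.SU, h.SV, h.w,
      h.s, fun l => measurable_const (a := q :: rest = l)⟩, fun ω hω => by rw [PairElimMono.step, hω]⟩

end

/-- The memory before iteration `m` is measurable with respect to the outcomes observed so far. -/
theorem measurableState_run {𝒢 : ℕ → MeasurableSpace Ω} (hmono : Monotone 𝒢) (T : ℕ)
    (ord : List (Fin n × Fin n)) {x : Ω → ℕ → Fin n → Fin n → ℝ}
    (hx : ∀ m i k, Measurable[𝒢 (m + 1)] fun ω => x ω (2 * m) i k)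
    (hx' : ∀ m i k, Measurable[𝒢 (m + 1)] fun ω => x ω (2 * m + 1) i k) (m : ℕ) :
    @MeasurableState n Ω (𝒢 m) fun ω => run T ord (x ω) m := by
  induction m with
  | zero => exact @measurableState_const n Ω (𝒢 0) _
  | succ m ih =>
    exact @MeasurableState.step n Ω (𝒢 (m + 1)) _ (ih.mono (hmono m.le_succ)) T ord _ _
      (hx m) (hx' m)

end PairElimMono

/-! ### Concentration for adaptively selected samples -/

namespace PairElimMono

section Concentration

variable {Ω : Type*} {mΩ : MeasurableSpace Ω} {μ : Measure Ω}
  {𝒢 : ℕ → MeasurableSpace Ω} {Y : ℕ → Ω → ℝ} {A : ℕ → Ω → Prop}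

theorem lintegral_exp_sub_le {Z : Ω → ℝ} (hZ : HasSubgaussianMGF Z (1 / 4) μ) (t : ℝ) :
    ∫⁻ ω, ENNReal.ofReal (Real.exp (t * Z ω - t ^ 2 / 8)) ∂μ ≤ 1 := by
  have h1 : Integrable (fun ω => Real.exp (t * Z ω - t ^ 2 / 8)) μ := by
    simp_rw [sub_eq_add_neg, Real.exp_add]
    exact (hZ.integrable_exp_mul t).mul_const _
  rw [← ofReal_integral_eq_lintegral_ofReal h1 (Filter.Eventually.of_forall fun _ =>
    (Real.exp_pos _).le), ENNReal.ofReal_le_one]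
  simp_rw [sub_eq_add_neg, Real.exp_add]
  rw [integral_mul_const]
  have h2 := hZ.mgf_le t
  rw [mgf] at h2
  calc _ ≤ Real.exp (((1 / 4 : NNReal) : ℝ) * t ^ 2 / 2) * Real.exp (-(t ^ 2 / 8)) := by gcongr
    _ = 1 := by
      rw [← Real.exp_add, Real.exp_eq_one_iff]
      push_cast
      ring

variable [IsProbabilityMeasure μ]

-- The exponential is a supermartingale: whether sample `M` is selected is known from `𝒢 M`, while
-- `Y M` is independent of `𝒢 M` and its factor has expectation at most 1.
open scoped Classical in
theorem lintegral_exp_sum_le_one (h𝒢 : ∀ m, 𝒢 m ≤ mΩ) (hmono : Monotone 𝒢)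
    (hY : ∀ m, Measurable[𝒢 (m + 1)] (Y m))
    (hind : ∀ m, Indep (𝒢 m) (MeasurableSpace.comap (Y m) inferInstance) μ)
    (hsub : ∀ m, HasSubgaussianMGF (Y m) (1 / 4) μ) (hA : ∀ m, Measurable[𝒢 m] (A m))
    (t : ℝ) (M : ℕ) :
    ∫⁻ ω, ENNReal.ofReal (Real.exp (∑ m ∈ Finset.range M,
      if A m ω then t * Y m ω - t ^ 2 / 8 else 0)) ∂μ ≤ 1 := by
  induction M with
  | zero => simp
  | succ M ih =>
    set Z : Ω → ENNReal := fun ω => ENNReal.ofReal (Real.exp (∑ m ∈ Finset.range M,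
      if A m ω then t * Y m ω - t ^ 2 / 8 else 0)) with hZ
    set V : Ω → ENNReal := fun ω => ENNReal.ofReal (Real.exp (t * Y M ω - t ^ 2 / 8)) with hV
    have hZm : Measurable[𝒢 M] Z := by
      refine ENNReal.measurable_ofReal.comp (Real.measurable_exp.comp ?_)
      refine @Finset.measurable_fun_sum _ _ _ _ _ _ (𝒢 M) _ _ fun m hm => ?_
      have hm := Finset.mem_range.1 hm
      refine Measurable.ite ?_ ?_ measurable_const
      · exact hmono hm.le _ (@measurableSet_setOfPred _ (𝒢 m) _ |>.2 (hA m))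
      · exact (((hY m).mono (hmono hm) le_rfl).const_mul t).sub measurable_const
    have hAM : @MeasurableSet Ω (𝒢 M) {ω | A M ω} := @measurableSet_setOfPred _ (𝒢 M) _ |>.2 (hA M)
    have hVm : Measurable[MeasurableSpace.comap (Y M) inferInstance] V :=
      ENNReal.measurable_ofReal.comp (Real.measurable_exp.comp
        (((comap_measurable (Y M)).const_mul t).sub measurable_const))
    have hsplit : ∀ ω, ENNReal.ofReal (Real.exp (∑ m ∈ Finset.range (M + 1),
        if A m ω then t * Y m ω - t ^ 2 / 8 else 0)) =
        {ω | A M ω}ᶜ.indicator Z ω + {ω | A M ω}.indicator Z ω * V ω := by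
      intro ω
      rw [Finset.sum_range_succ, Real.exp_add, ENNReal.ofReal_mul (Real.exp_pos _).le]
      by_cases h : A M ω
      · simp [Set.indicator, h, hZ, hV]
      · simp [Set.indicator, h, hZ]
    simp_rw [hsplit]
    rw [lintegral_add_left ((hZm.indicator hAM.compl).mono (h𝒢 M) le_rfl),
      lintegral_mul_eq_lintegral_mul_lintegral_of_independent_measurableSpace (h𝒢 M)
        ((hY M).mono (h𝒢 _) le_rfl).comap_le (hind M) (hZm.indicator hAM) hVm]
    calc ∫⁻ ω, {ω | A M ω}ᶜ.indicator Z ω ∂μ +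
          (∫⁻ ω, {ω | A M ω}.indicator Z ω ∂μ) * ∫⁻ ω, V ω ∂μ
        ≤ ∫⁻ ω, {ω | A M ω}ᶜ.indicator Z ω ∂μ + (∫⁻ ω, {ω | A M ω}.indicator Z ω ∂μ) * 1 := by
          gcongr
          exact lintegral_exp_sub_le (hsub M) t
      _ = ∫⁻ ω, Z ω ∂μ := by
          rw [mul_one, ← lintegral_add_left ((hZm.indicator hAM.compl).mono (h𝒢 M) le_rfl)]
          refine lintegral_congr fun ω => ?_
          rw [add_comm]
          exact congrFun (Set.indicator_self_add_compl {ω | A M ω} Z) ω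
      _ ≤ 1 := ih

-- Chernoff bound on the event that exactly `c` samples are selected. Fixing `c` makes the
-- compensator deterministic. The sign `σ` serves both tails.
open scoped Classical in
theorem measure_sum_gt_le (h𝒢 : ∀ m, 𝒢 m ≤ mΩ) (hmono : Monotone 𝒢)
    (hY : ∀ m, Measurable[𝒢 (m + 1)] (Y m))
    (hind : ∀ m, Indep (𝒢 m) (MeasurableSpace.comap (Y m) inferInstance) μ)
    (hsub : ∀ m, HasSubgaussianMGF (Y m) (1 / 4) μ) (hA : ∀ m, Measurable[𝒢 m] (A m))
    {M c : ℕ} (hc : 0 < c) {L : ℝ} (hL : 0 ≤ L) {σ : ℝ} (hσ : σ ^ 2 = 1) :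
    μ {ω | ∑ m ∈ Finset.range M, (if A m ω then (1 : ℝ) else 0) = c ∧
      Real.sqrt (c * L) < σ * ∑ m ∈ Finset.range M, if A m ω then Y m ω else 0} ≤
      ENNReal.ofReal (Real.exp (-(2 * L))) := by
  -- The optimal parameter: the linear term is at least 4L and the compensator t²c/8 equals 2L,
  -- leaving 2L in the exponent.
  set t : ℝ := σ * (4 * Real.sqrt (c * L) / c) with ht
  have hc' : (0 : ℝ) < c := by exact_mod_cast hc
  have hsq : Real.sqrt (c * L) ^ 2 = c * L := Real.sq_sqrt (by positivity)
  have hE := lintegral_exp_sum_le_one h𝒢 hmono hY hind hsub hA t M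
  have hmeas : AEMeasurable (fun ω => ENNReal.ofReal (Real.exp (∑ m ∈ Finset.range M,
      if A m ω then t * Y m ω - t ^ 2 / 8 else 0))) μ := by
    refine (ENNReal.measurable_ofReal.comp (Real.measurable_exp.comp ?_)).aemeasurable
    refine Finset.measurable_fun_sum _ fun m hm => ?_
    refine Measurable.ite ?_ ?_ measurable_const
    · exact h𝒢 m _ (@measurableSet_setOfPred _ (𝒢 m) _ |>.2 (hA m))
    · exact (((hY m).mono (h𝒢 _) le_rfl).const_mul t).sub measurable_const
  have h1 := mul_meas_ge_le_lintegral₀ hmeas (ENNReal.ofReal (Real.exp (2 * L)))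
  have h2 : {ω | ∑ m ∈ Finset.range M, (if A m ω then (1 : ℝ) else 0) = c ∧
      Real.sqrt (c * L) < σ * ∑ m ∈ Finset.range M, if A m ω then Y m ω else 0} ⊆
      {ω | ENNReal.ofReal (Real.exp (2 * L)) ≤ ENNReal.ofReal (Real.exp (∑ m ∈ Finset.range M,
      if A m ω then t * Y m ω - t ^ 2 / 8 else 0))} := by
    rintro ω ⟨hN, hS⟩
    refine ENNReal.ofReal_le_ofReal (Real.exp_le_exp.2 ?_)
    have h3 : ∑ m ∈ Finset.range M, (if A m ω then t * Y m ω - t ^ 2 / 8 else 0) =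
        t * (∑ m ∈ Finset.range M, if A m ω then Y m ω else 0) -
        t ^ 2 / 8 * ∑ m ∈ Finset.range M, (if A m ω then (1 : ℝ) else 0) := by
      rw [Finset.mul_sum, Finset.mul_sum, ← Finset.sum_sub_distrib]
      refine Finset.sum_congr rfl fun m _ => ?_
      split_ifs <;> ring
    rw [h3, hN]
    have h4 : t ^ 2 / 8 * c = 2 * L := by
      rw [ht, mul_pow, hσ, div_pow, mul_pow, hsq]
      field_simp
      ring
    have h5 : 4 * L ≤ t * ∑ m ∈ Finset.range M, if A m ω then Y m ω else 0 := by
      calc 4 * L = 4 * Real.sqrt (c * L) / c * Real.sqrt (c * L) := by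
            rw [div_mul_eq_mul_div, mul_assoc, ← sq, hsq]; field_simp
        _ ≤ 4 * Real.sqrt (c * L) / c *
            (σ * ∑ m ∈ Finset.range M, if A m ω then Y m ω else 0) := by gcongr
        _ = _ := by rw [ht]; ring
    linarith
  have h6 : ENNReal.ofReal (Real.exp (-(2 * L))) * ENNReal.ofReal (Real.exp (2 * L)) = 1 := by
    rw [← ENNReal.ofReal_mul (Real.exp_pos _).le, ← Real.exp_add]
    simp
  refine (measure_mono h2).trans ?_
  calc _ = ENNReal.ofReal (Real.exp (-(2 * L))) * (ENNReal.ofReal (Real.exp (2 * L)) * _) := by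
        rw [← mul_assoc, h6, one_mul]
    _ ≤ ENNReal.ofReal (Real.exp (-(2 * L))) * 1 := by
        gcongr
        exact h1.trans hE
    _ = _ := mul_one _

open scoped Classical in
theorem measure_abs_sum_gt_le (h𝒢 : ∀ m, 𝒢 m ≤ mΩ) (hmono : Monotone 𝒢)
    (hY : ∀ m, Measurable[𝒢 (m + 1)] (Y m))
    (hind : ∀ m, Indep (𝒢 m) (MeasurableSpace.comap (Y m) inferInstance) μ)
    (hsub : ∀ m, HasSubgaussianMGF (Y m) (1 / 4) μ) (hA : ∀ m, Measurable[𝒢 m] (A m))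
    {M c : ℕ} (hc : 0 < c) {L : ℝ} (hL : 0 ≤ L) :
    μ {ω | ∑ m ∈ Finset.range M, (if A m ω then (1 : ℝ) else 0) = c ∧
      Real.sqrt (c * L) < |∑ m ∈ Finset.range M, if A m ω then Y m ω else 0|} ≤
      2 * ENNReal.ofReal (Real.exp (-(2 * L))) := by
  have h1 := measure_sum_gt_le h𝒢 hmono hY hind hsub hA (M := M) hc hL (σ := 1) (by norm_num)
  have h2 := measure_sum_gt_le h𝒢 hmono hY hind hsub hA (M := M) hc hL (σ := -1) (by norm_num)
  refine (measure_mono ?_).trans ((measure_union_le _ _).trans ((add_le_add h1 h2).trans_eq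
    (two_mul _).symm))
  rintro ω ⟨hN, hS⟩
  rcases lt_abs.1 hS with h | h
  · exact Or.inl ⟨hN, by rwa [one_mul]⟩
  · exact Or.inr ⟨hN, by rwa [neg_one_mul]⟩

end Concentration

/-- The sum of the first `c` samples of a window, obtained by stopping a sum over all times. -/
theorem stopped_sum_eq {v cnt : ℕ → ℕ} {P : ℕ → Prop} [DecidablePred P] {y sm : ℕ → ℝ}
    {w c : ℕ} (hs0 : sm 0 = 0)
    (hstep : ∀ m, (v (m + 1) = v m ∧ cnt (m + 1) = cnt m + (if P m then 1 else 0) ∧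
        sm (m + 1) = sm m + if P m then y m else 0) ∨
      (v (m + 1) = v m + 1 ∧ cnt (m + 1) = 0 ∧ sm (m + 1) = 0))
    {m M : ℕ} (hmM : m ≤ M) (hv : v m = w) (hcnt : cnt m = c) :
    ∑ m ∈ Finset.range M, (if P m ∧ v m = w ∧ cnt m < c then y m else 0) = sm m := by
  have h1 : ∀ m, (v m < w → ∑ m ∈ Finset.range m,
      (if P m ∧ v m = w ∧ cnt m < c then y m else 0) = 0) ∧
      (v m = w → cnt m ≤ c → ∑ m ∈ Finset.range m,
      (if P m ∧ v m = w ∧ cnt m < c then y m else 0) = sm m) := by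
    intro m
    induction m with
    | zero => simp [hs0]
    | succ m ih =>
      rw [Finset.sum_range_succ]
      rcases hstep m with ⟨g1, g2, g3⟩ | ⟨g1, g2, g3⟩
      · rw [g1, g2, g3]
        refine ⟨fun hv => ?_, fun hv hc => ?_⟩
        · rw [ih.1 hv, if_neg (by omega), add_zero]
        · rw [ih.2 hv (by omega)]
          by_cases hP : P m
          · rw [if_pos hP] at hc
            rw [if_pos hP, if_pos ⟨hP, hv, by omega⟩]
          · rw [if_neg hP, if_neg (by tauto)]
      · rw [g1, g2, g3]
        refine ⟨fun hv => ?_, fun hv _ => ?_⟩ <;>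
          rw [ih.1 (by omega), if_neg (by omega), add_zero]
  have h2 : ∀ k, (w < v (m + k) ∨ (v (m + k) = w ∧ c ≤ cnt (m + k))) ∧
      ∑ m ∈ Finset.range (m + k), (if P m ∧ v m = w ∧ cnt m < c then y m else 0) = sm m := by
    intro k
    induction k with
    | zero => exact ⟨Or.inr ⟨hv, hcnt.ge⟩, (h1 m).2 hv hcnt.le⟩
    | succ k ih =>
      rw [← add_assoc, Finset.sum_range_succ, ih.2, if_neg (by omega), add_zero]
      refine ⟨?_, rfl⟩
      rcases hstep (m + k) with ⟨g1, g2, g3⟩ | ⟨g1, g2, g3⟩ <;> rw [g1, g2] <;> omega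
  obtain ⟨k, rfl⟩ := Nat.exists_eq_add_of_le hmM
  exact (h2 k).2

end PairElimMono

/-! ### Probability of inaccurate samples -/

namespace PairElimMono

theorem run_counts_le {n : ℕ} (T : ℕ) {ord : List (Fin n × Fin n)} (hnd : ord.Nodup)
    (hord : ∀ p, p ∈ ord ↔ p.1 ≠ p.2) (hne : ord ≠ []) (x : ℕ → Fin n → Fin n → ℝ) (m : ℕ)
    (i k : Fin n) : (run T ord x m).C i k ≤ m ∧
      (run T ord x m).Cw i k ≤ 2 ^ 2 ^ (run T ord x m).w + 2 * ord.length := by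
  have h1 : (run T ord x m).C i k ≤ m ∧ (run T ord x m).Cw i k ≤ (run T ord x m).s := by
    induction m with
    | zero => exact ⟨le_rfl, le_rfl⟩
    | succ m ih =>
      obtain ⟨p, -, -, h2, ⟨-, -, h3, h4⟩ | ⟨-, -, h3, h4⟩⟩ :=
        run_succ_samples T hnd hord hne x m
      · rw [h2, h3, h4]
        constructor <;> split_ifs <;> omega
      · rw [h2, h3, h4]
        constructor
        · split_ifs <;> omega
        · rfl
  have h2 := playCount_le T hnd hord hne x m
  rw [State.playCount] at h2
  exact ⟨h1.1, by omega⟩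

variable {n : ℕ} {Ω : Type*}

/-- The outcomes observed in the noise `ε` around the means. -/
def outcomes (u : Fin n → ℝ) (ε : ℕ → Fin n → Fin n → Ω → ℝ) (ω : Ω) (t : ℕ) (i j : Fin n) : ℝ :=
  u i * u j + ε t i j ω

/-- The information available before iteration `m`. -/
abbrev past (ε : ℕ → Fin n → Fin n → Ω → ℝ) (m : ℕ) : MeasurableSpace Ω :=
  ⨆ t ∈ {t | t < 2 * m}, MeasurableSpace.comap (fun ω (p : Fin n × Fin n) => ε t p.1 p.2 ω)
    inferInstance

theorem past_mono (ε : ℕ → Fin n → Fin n → Ω → ℝ) : Monotone (past ε) := by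
  intro m m' h
  refine biSup_mono fun t ht => ?_
  have : t < 2 * m := ht
  exact (by omega : t < 2 * m')

theorem measurable_past (ε : ℕ → Fin n → Fin n → Ω → ℝ) {t m : ℕ} (h : t < 2 * m) (i k : Fin n) :
    Measurable[past ε m] (ε t i k) := by
  have h1 : Measurable[MeasurableSpace.comap (fun ω (p : Fin n × Fin n) => ε t p.1 p.2 ω)
      inferInstance] (ε t i k) := (measurable_pi_apply (i, k)).comp (comap_measurable
        (fun ω (p : Fin n × Fin n) => ε t p.1 p.2 ω))
  exact h1.mono (le_biSup (fun t => MeasurableSpace.comap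
    (fun ω (p : Fin n × Fin n) => ε t p.1 p.2 ω) inferInstance) (show t ∈ {t | t < 2 * m} from h))
    le_rfl

theorem measurableState_run_past (u : Fin n → ℝ) (ε : ℕ → Fin n → Fin n → Ω → ℝ) (T : ℕ)
    (ord : List (Fin n × Fin n)) (m : ℕ) :
    @MeasurableState n Ω (past ε m) fun ω => run T ord (outcomes u ε ω) m :=
  measurableState_run (past_mono ε) T ord
    (fun m i k => (measurable_past ε (by omega) i k).const_add _)
    (fun m i k => (measurable_past ε (by omega) i k).const_add _) m

variable {mΩ : MeasurableSpace Ω} {μ : Measure Ω}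

theorem past_le {ε : ℕ → Fin n → Fin n → Ω → ℝ} (hε : ∀ t i j, Measurable (ε t i j)) (m : ℕ) :
    past ε m ≤ mΩ :=
  iSup₂_le fun t _ => (measurable_pi_lambda _ fun p : Fin n × Fin n => hε t p.1 p.2).comap_le

theorem indep_past {ε : ℕ → Fin n → Fin n → Ω → ℝ} (hε : ∀ t i j, Measurable (ε t i j))
    (hind : iIndepFun (fun (t : ℕ) (ω : Ω) (p : Fin n × Fin n) => ε t p.1 p.2 ω) μ)
    {t m : ℕ} (h : 2 * m ≤ t) (i k : Fin n) :
    Indep (past ε m) (MeasurableSpace.comap (ε t i k) inferInstance) μ := by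
  have h1 := indep_iSup_of_disjoint (S := {t | t < 2 * m}) (T := {t})
    (fun t => (measurable_pi_lambda _ fun p : Fin n × Fin n => hε t p.1 p.2).comap_le) hind.iIndep
    (by simpa using h)
  refine indep_of_indep_of_le_right h1 ?_
  simp only [Set.mem_singleton_iff, iSup_iSup_eq_left]
  have h2 : Measurable[MeasurableSpace.comap (fun ω (p : Fin n × Fin n) => ε t p.1 p.2 ω)
      inferInstance] (ε t i k) := (measurable_pi_apply (i, k)).comp (comap_measurable
        (fun ω (p : Fin n × Fin n) => ε t p.1 p.2 ω))
  exact h2.comap_le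

theorem MeasurableState.head? [MeasurableSpace Ω] {f : Ω → State n} (hf : MeasurableState f)
    (p : Fin n × Fin n) : Measurable fun ω => (f ω).queue.head? = some p :=
  measurable_of_countable_cases hf.queue fun l =>
    ⟨fun _ => l.head? = some p, measurable_const, by rintro ω rfl; rfl⟩

theorem MeasurableState.rowAccurate [MeasurableSpace Ω] {f : Ω → State n}
    (hf : MeasurableState f) (u : Fin n → ℝ) (T : ℕ) :
    Measurable fun ω => RowAccurate u T (f ω) := by
  refine Measurable.forall fun i => Measurable.forall fun k => measurableSet_setOfPred.1 ?_
  have hc : Measurable fun ω => ((f ω).C i k : ℝ) := measurable_from_top.comp (hf.C i k)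
  exact measurableSet_le ((hf.X i k).sub (hc.mul_const _)).abs (hc.mul_const _).sqrt

theorem MeasurableState.colAccurate [MeasurableSpace Ω] {f : Ω → State n}
    (hf : MeasurableState f) (u : Fin n → ℝ) :
    Measurable fun ω => ColAccurate u (f ω) := by
  refine Measurable.forall fun i => Measurable.forall fun k => measurableSet_setOfPred.1 ?_
  have hc : Measurable fun ω => ((f ω).Cw i k : ℝ) := measurable_from_top.comp (hf.Cw i k)
  have hw : Measurable fun ω => Real.log ((2 : ℝ) ^ 2 ^ (f ω).w) :=
    (measurable_from_top (f := fun w : ℕ => Real.log ((2 : ℝ) ^ 2 ^ w))).comp hf.w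
  exact measurableSet_le ((hf.Xw i k).sub (hc.mul_const _)).abs (hc.mul hw).sqrt

/-- The conjunct `0 = 0` is a constant window index: rows are treated as a single window, in the
shape of `stopped_sum_eq`. -/
theorem MeasurableState.measurable_row_event [MeasurableSpace Ω] {f : Ω → State n}
    (hf : MeasurableState f) (p : Fin n × Fin n) (c : ℕ) :
    Measurable fun ω => (f ω).queue.head? = some p ∧ 0 = 0 ∧ (f ω).C p.1 p.2 < c :=
  (hf.head? p).and (measurable_const.and (measurableSet_setOfPred.1
    (hf.C p.1 p.2 (MeasurableSet.of_discrete (s := Set.Iio c)))))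

theorem MeasurableState.measurable_col_event [MeasurableSpace Ω] {f : Ω → State n}
    (hf : MeasurableState f) (p : Fin n × Fin n) (w c : ℕ) :
    Measurable fun ω => (f ω).queue.head? = some p ∧ (f ω).w = w ∧ (f ω).Cw p.2 p.1 < c :=
  (hf.head? p).and ((measurable_eq_const hf.w w).and (measurableSet_setOfPred.1
    (hf.Cw p.2 p.1 (MeasurableSet.of_discrete (s := Set.Iio c)))))

theorem measure_exists_le {N : ℕ} {B : Set Ω} {E : Fin n × Fin n → ℕ → Set Ω} {δ : ENNReal}
    (hE : ∀ p, ∀ c ∈ Finset.Icc 1 N, μ (E p c) ≤ δ)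
    (hB : ∀ ω ∈ B, ∃ p, ∃ c ∈ Finset.Icc 1 N, ω ∈ E p c) : μ B ≤ n ^ 2 * N * δ := by
  calc μ B ≤ μ (⋃ q ∈ (Finset.univ ×ˢ Finset.Icc 1 N : Finset ((Fin n × Fin n) × ℕ)),
        E q.1 q.2) := by
        refine measure_mono fun ω hω => ?_
        obtain ⟨p, c, hc, h⟩ := hB ω hω
        simp only [Set.mem_iUnion]
        exact ⟨(p, c), by simpa using hc, h⟩
    _ ≤ ∑ q ∈ (Finset.univ ×ˢ Finset.Icc 1 N : Finset ((Fin n × Fin n) × ℕ)), μ (E q.1 q.2) :=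
        measure_biUnion_finset_le _ _
    _ ≤ ∑ q ∈ (Finset.univ ×ˢ Finset.Icc 1 N : Finset ((Fin n × Fin n) × ℕ)), δ :=
        Finset.sum_le_sum fun q hq => hE _ _ (Finset.mem_product.1 hq).2
    _ = n ^ 2 * N * δ := by
        rw [Finset.sum_const, Finset.card_product, Finset.card_univ, Fintype.card_prod]
        simp [sq]

/-- An inaccuracy with `c` samples is one of the sum stopped at `c` samples, whatever the time. The
union bound therefore runs over entries and counts only. -/
theorem measure_rowInaccurate_le [IsProbabilityMeasure μ] {u : Fin n → ℝ}
    {ε : ℕ → Fin n → Fin n → Ω → ℝ} (hε : ∀ t i j, Measurable (ε t i j))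
    (hind : iIndepFun (fun (t : ℕ) (ω : Ω) (p : Fin n × Fin n) => ε t p.1 p.2 ω) μ)
    (hsub : ∀ t i j, HasSubgaussianMGF (ε t i j) (1 / 4) μ)
    {T : ℕ} {ord : List (Fin n × Fin n)} (hnd : ord.Nodup) (hord : ∀ p, p ∈ ord ↔ p.1 ≠ p.2)
    (hne : ord ≠ []) {M : ℕ} (hT : 1 ≤ T) :
    μ {ω | ∃ m < M, ¬ RowAccurate u T (run T ord (outcomes u ε ω) m)} ≤
      n ^ 2 * M * (2 * ENNReal.ofReal (Real.exp (-(2 * Real.log T)))) := by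
  classical
  refine measure_exists_le (N := M) (E := fun p c => {ω | ∑ m ∈ Finset.range M,
    (if (run T ord (outcomes u ε ω) m).queue.head? = some p ∧ 0 = 0 ∧
      (run T ord (outcomes u ε ω) m).C p.1 p.2 < c then (1 : ℝ) else 0) = c ∧
    Real.sqrt (c * Real.log T) < |∑ m ∈ Finset.range M,
      if (run T ord (outcomes u ε ω) m).queue.head? = some p ∧ 0 = 0 ∧
      (run T ord (outcomes u ε ω) m).C p.1 p.2 < c then ε (2 * m) p.1 p.2 ω else 0|})
    (fun p c hc => ?_) ?_
  · have hc := (Finset.mem_Icc.1 hc).1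
    have hA := fun m => @MeasurableState.measurable_row_event n Ω (past ε m) _
      (measurableState_run_past u ε T ord m) p c
    convert measure_abs_sum_gt_le (past_le hε) (past_mono ε)
      (Y := fun m => ε (2 * m) p.1 p.2)
      (fun m => measurable_past ε (by omega) _ _) (fun m => indep_past hε hind le_rfl _ _)
      (fun m => hsub _ _ _) hA (M := M) hc
      (Real.log_nonneg (by exact_mod_cast hT : (1 : ℝ) ≤ T)) using 9
  · rintro ω ⟨m, hm, hacc⟩
    simp only [RowAccurate, not_forall, not_le] at hacc
    obtain ⟨i, k, hik⟩ := hacc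
    set r := fun m => run T ord (outcomes u ε ω) m with hr
    have hstep : ∀ m, ((fun _ : ℕ => 0) (m + 1) = (fun _ : ℕ => 0) m ∧
        (r (m + 1)).C i k = (r m).C i k + (if (r m).queue.head? = some (i, k) then 1 else 0) ∧
        (r (m + 1)).X i k - (r (m + 1)).C i k * entryMean u i k =
          (r m).X i k - (r m).C i k * entryMean u i k +
          if (r m).queue.head? = some (i, k) then ε (2 * m) i k ω else 0) := by
      intro m
      obtain ⟨q, h1, h2, h3, -⟩ := run_succ_samples T hnd hord hne (outcomes u ε ω) m
      simp only [hr, h1, h2, h3, Option.some.injEq]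
      refine ⟨trivial, by simp only [eq_comm], ?_⟩
      by_cases h : (i, k) = q
      · simp only [if_pos h, if_pos h.symm, outcomes, entryMean]
        push_cast
        ring
      · simp only [if_neg h, if_neg (Ne.symm h), add_zero]
    have hs0 : (r 0).X i k - (r 0).C i k * entryMean u i k = 0 := by
      simp [hr, run, beginRound, init]
    have hsum := fun c (hc : (r m).C i k = c) => stopped_sum_eq (v := fun _ => 0)
      (cnt := fun m => (r m).C i k) (P := fun m => (r m).queue.head? = some (i, k))
      (y := fun m => ε (2 * m) i k ω)
      (sm := fun m => (r m).X i k - (r m).C i k * entryMean u i k) (w := 0) hs0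
      (fun m => Or.inl (hstep m)) hm.le rfl hc
    -- The same identity with unit summands shows that the stopped sum has exactly `c` terms.
    have hcount := fun c (hc : (r m).C i k = c) => stopped_sum_eq (v := fun _ => 0)
      (cnt := fun m => (r m).C i k) (P := fun m => (r m).queue.head? = some (i, k))
      (y := fun m => 1) (sm := fun m => ((r m).C i k : ℝ)) (w := 0)
      (by simp [hr, run, beginRound, init])
      (fun m => Or.inl ⟨rfl, (hstep m).2.1, by rw [(hstep m).2.1]; push_cast; rfl⟩) hm.le rfl hc
    refine ⟨(i, k), (r m).C i k, Finset.mem_Icc.2 ⟨?_, ?_⟩, hcount _ rfl, ?_⟩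
    -- With no samples the deviation is zero, so the count is at least 1.
    · by_contra h0
      have h0 : (r m).C i k = 0 := by omega
      have h1 := hsum 0 h0
      simp only [not_lt_zero, and_false, if_false, Finset.sum_const_zero] at h1
      change _ < |(r m).X i k - (r m).C i k * entryMean u i k| at hik
      rw [← h1, abs_zero] at hik
      exact (Real.sqrt_nonneg _).not_gt hik
    · exact ((run_counts_le T hnd hord hne _ m i k).1).trans hm.le
    · rw [hsum _ rfl]
      exact hik

/-- As for rows, with the odd times as samples. The number of possible counts is the maximal length
of window `w`, not the horizon, so the bound is of order 1/h_w. -/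
theorem measure_colInaccurate_le [IsProbabilityMeasure μ] {u : Fin n → ℝ}
    {ε : ℕ → Fin n → Fin n → Ω → ℝ} (hε : ∀ t i j, Measurable (ε t i j))
    (hind : iIndepFun (fun (t : ℕ) (ω : Ω) (p : Fin n × Fin n) => ε t p.1 p.2 ω) μ)
    (hsub : ∀ t i j, HasSubgaussianMGF (ε t i j) (1 / 4) μ)
    {T : ℕ} {ord : List (Fin n × Fin n)} (hnd : ord.Nodup) (hord : ∀ p, p ∈ ord ↔ p.1 ≠ p.2)
    (hne : ord ≠ []) (M w : ℕ) :
    μ {ω | ∃ m < M, (run T ord (outcomes u ε ω) m).w = w ∧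
      ¬ ColAccurate u (run T ord (outcomes u ε ω) m)} ≤
      n ^ 2 * (2 ^ 2 ^ w + 2 * ord.length : ℕ) *
        (2 * ENNReal.ofReal (Real.exp (-(2 * Real.log ((2 : ℝ) ^ 2 ^ w))))) := by
  classical
  refine measure_exists_le (N := 2 ^ 2 ^ w + 2 * ord.length)
    (E := fun p c => {ω | ∑ m ∈ Finset.range M,
    (if (run T ord (outcomes u ε ω) m).queue.head? = some p ∧
      (run T ord (outcomes u ε ω) m).w = w ∧
      (run T ord (outcomes u ε ω) m).Cw p.2 p.1 < c then (1 : ℝ) else 0) = c ∧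
    Real.sqrt (c * Real.log ((2 : ℝ) ^ 2 ^ w)) < |∑ m ∈ Finset.range M,
      if (run T ord (outcomes u ε ω) m).queue.head? = some p ∧
      (run T ord (outcomes u ε ω) m).w = w ∧
      (run T ord (outcomes u ε ω) m).Cw p.2 p.1 < c then ε (2 * m + 1) p.1 p.2 ω else 0|})
    (fun p c hc => ?_) ?_
  · have hc := (Finset.mem_Icc.1 hc).1
    have hA := fun m => @MeasurableState.measurable_col_event n Ω (past ε m) _
      (measurableState_run_past u ε T ord m) p w c
    convert measure_abs_sum_gt_le (past_le hε) (past_mono ε)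
      (Y := fun m => ε (2 * m + 1) p.1 p.2)
      (fun m => measurable_past ε (by omega) _ _)
      (fun m => indep_past hε hind (Nat.le_succ _) _ _)
      (fun m => hsub _ _ _) hA (M := M) hc (log_window_pos w).le using 9
  · rintro ω ⟨m, hm, hw, hacc⟩
    simp only [ColAccurate, not_forall, not_le] at hacc
    obtain ⟨i, k, hik⟩ := hacc
    set r := fun m => run T ord (outcomes u ε ω) m with hr
    have hstep : ∀ m, ((r (m + 1)).w = (r m).w ∧
        (r (m + 1)).Cw i k = (r m).Cw i k + (if (r m).queue.head? = some (k, i) then 1 else 0) ∧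
        (r (m + 1)).Xw i k - (r (m + 1)).Cw i k * entryMean u i k =
          (r m).Xw i k - (r m).Cw i k * entryMean u i k +
          if (r m).queue.head? = some (k, i) then ε (2 * m + 1) k i ω else 0) ∨
        ((r (m + 1)).w = (r m).w + 1 ∧ (r (m + 1)).Cw i k = 0 ∧
          (r (m + 1)).Xw i k - (r (m + 1)).Cw i k * entryMean u i k = 0) := by
      intro m
      obtain ⟨q, h1, -, -, ⟨h2, h3, h4, -⟩ | ⟨h2, h3, h4, -⟩⟩ :=
        run_succ_samples T hnd hord hne (outcomes u ε ω) m
      · left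
        simp only [hr, h1, h2, h3, h4, Option.some.injEq]
        refine ⟨trivial, by simp only [eq_comm], ?_⟩
        by_cases h : (k, i) = q
        · simp only [if_pos h, if_pos h.symm, outcomes, entryMean]
          push_cast
          ring
        · simp only [if_neg h, if_neg (Ne.symm h), add_zero]
      · right
        simp only [hr, h2, h3, h4]
        simp
    have hs0 : (r 0).Xw i k - (r 0).Cw i k * entryMean u i k = 0 := by
      simp [hr, run, beginRound, init]
    have hsum := fun c (hc : (r m).Cw i k = c) => stopped_sum_eq (v := fun m => (r m).w)
      (cnt := fun m => (r m).Cw i k) (P := fun m => (r m).queue.head? = some (k, i))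
      (y := fun m => ε (2 * m + 1) k i ω)
      (sm := fun m => (r m).Xw i k - (r m).Cw i k * entryMean u i k) (w := w) hs0
      hstep hm.le hw hc
    have hcount := fun c (hc : (r m).Cw i k = c) => stopped_sum_eq (v := fun m => (r m).w)
      (cnt := fun m => (r m).Cw i k) (P := fun m => (r m).queue.head? = some (k, i))
      (y := fun m => 1) (sm := fun m => ((r m).Cw i k : ℝ)) (w := w)
      (by simp [hr, run, beginRound, init])
      (fun m => (hstep m).imp (fun h => ⟨h.1, h.2.1, by rw [h.2.1]; push_cast; rfl⟩)
        (fun h => ⟨h.1, h.2.1, by rw [h.2.1, Nat.cast_zero]⟩)) hm.le hw hc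
    change (run T ord (outcomes u ε ω) m).w = w at hw
    rw [hw] at hik
    refine ⟨(k, i), (r m).Cw i k, Finset.mem_Icc.2 ⟨?_, ?_⟩, hcount _ rfl, ?_⟩
    · by_contra h0
      have h0 : (r m).Cw i k = 0 := by omega
      have h1 := hsum 0 h0
      simp only [not_lt_zero, and_false, if_false, Finset.sum_const_zero] at h1
      change _ < |(r m).Xw i k - (r m).Cw i k * entryMean u i k| at hik
      rw [← h1, abs_zero] at hik
      exact (Real.sqrt_nonneg _).not_gt hik
    · have := (run_counts_le T hnd hord hne (outcomes u ε ω) m i k).2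
      rwa [hw] at this
    · rw [hsum _ rfl]
      exact hik

end PairElimMono

/-! ### Expected regret -/

namespace PairElimMono

variable {n : ℕ} {u : Fin n → ℝ} {a b : Fin n}

theorem TopPair.exists_gap (hu : TopPair u a b) :
    ∃ g : ℝ, 0 < g ∧ g < 1 ∧ ∀ i j, j ≠ a → j ≠ b → g ≤ u i * (u b - u j) := by
  classical
  -- The default 1/2 is harmless: it only fills in the entries on which nothing is claimed.
  let f : Fin n × Fin n → ℝ := fun q =>
    if q.2 ≠ a ∧ q.2 ≠ b then u q.1 * (u b - u q.2) else 1 / 2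
  have hf : ∀ q, 0 < f q := by
    intro q
    simp only [f]
    split_ifs with h
    · exact mul_pos (hu.pos _) (sub_pos.2 (hu.lt _ h.1 h.2))
    · norm_num
  have : Nonempty (Fin n × Fin n) := ⟨(a, b)⟩
  obtain ⟨q, hq⟩ := Finite.exists_min f
  refine ⟨min (f q) (1 / 2), lt_min (hf q) (by norm_num),
    (min_le_right _ _).trans_lt (by norm_num), fun i j hja hjb => (min_le_left _ _).trans ?_⟩
  have := hq (i, j)
  simp only [f] at this ⊢
  rwa [if_pos (show j ≠ a ∧ j ≠ b from ⟨hja, hjb⟩)] at this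

theorem TopPair.bestPairValue_le (hu : TopPair u a b) : bestPairValue u ≤ u a * u b := by
  have : Nonempty {p : Fin n × Fin n // p.1 ≠ p.2} := ⟨⟨(a, b), hu.ne⟩⟩
  refine ciSup_le fun p => ?_
  have := hu.gap_nonneg p.2
  rw [gap] at this
  linarith

/-- Each iteration makes two plays; for odd `T` the last one is completed, which is harmless as the
losses are nonnegative. -/
theorem sum_range_half_le {f : ℕ → ℝ} (hf : ∀ m, 0 ≤ f m) (T : ℕ) :
    ∑ t ∈ Finset.range T, f (t / 2) ≤ 2 * ∑ m ∈ Finset.range ((T + 1) / 2), f m := by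
  have h1 : ∀ M, ∑ t ∈ Finset.range (2 * M), f (t / 2) = 2 * ∑ m ∈ Finset.range M, f m := by
    intro M
    induction M with
    | zero => simp
    | succ M ih =>
      rw [mul_add, mul_one, Finset.sum_range_succ, Finset.sum_range_succ, ih,
        Finset.sum_range_succ, show (2 * M + 1) / 2 = M by omega,
        Nat.mul_div_cancel_left M two_pos]
      ring
  rw [← h1]
  exact Finset.sum_le_sum_of_subset_of_nonneg (Finset.range_subset_range.2 (by omega))
    fun _ _ _ => hf _

/-- Some row samples are inaccurate before iteration `M`. -/
def RowFailure (u : Fin n → ℝ) (T : ℕ) (ord : List (Fin n × Fin n))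
    (x : ℕ → Fin n → Fin n → ℝ) (M : ℕ) : Prop :=
  ∃ m < M, ¬ RowAccurate u T (run T ord x m)

/-- Some column samples of the window `w` are inaccurate before iteration `M`. -/
def ColFailure (u : Fin n → ℝ) (T : ℕ) (ord : List (Fin n × Fin n))
    (x : ℕ → Fin n → Fin n → ℝ) (M w : ℕ) : Prop :=
  ∃ m < M, (run T ord x m).w = w ∧ ¬ ColAccurate u (run T ord x m)

/-- The part of the regret bound that holds when no samples are inaccurate. -/
noncomputable def regularBound (u : Fin n → ℝ) (a b : Fin n) (g : ℝ) (T len : ℕ) : ℝ :=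
  2112 * Real.log T *
    (∑ i ∈ Finset.univ.filter (fun i => i ≠ a ∧ i ≠ b), 1 / (u a * (u b - u i))) +
  2 * n ^ 2 * (66 / g ^ 2) *
    (Real.log 2 + 4 * max (Real.log (2 * len * (66 * Real.log T / g ^ 2))) 0)

/-- Bound for the loss that is due to inaccurate samples in the window `w`. -/
noncomputable def failureCost (n : ℕ) (g : ℝ) (len w : ℕ) : ℝ :=
  2 * ((2 : ℝ) ^ 2 ^ w + 2 * len) + 264 * n ^ 2 / g ^ 2 * Real.log ((2 : ℝ) ^ 2 ^ w)

theorem failureCost_nonneg (n : ℕ) (g : ℝ) (len w : ℕ) : 0 ≤ failureCost n g len w := by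
  have := log_window_pos w
  rw [failureCost]
  positivity

theorem regularBound_nonneg (hu : TopPair u a b) {g : ℝ} {T len : ℕ} (hT : 0 ≤ Real.log T) :
    0 ≤ regularBound u a b g T len := by
  have h1 : 0 ≤ ∑ i ∈ Finset.univ.filter (fun i => i ≠ a ∧ i ≠ b), 1 / (u a * (u b - u i)) := by
    refine Finset.sum_nonneg fun i hi => ?_
    obtain ⟨hia, hib⟩ := (Finset.mem_filter.1 hi).2
    have := mul_pos (hu.pos a) (sub_pos.2 (hu.lt i hia hib))
    positivity
  have h2 := Real.log_pos one_lt_two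
  rw [regularBound]
  positivity

-- Holds for every sequence of outcomes. A row failure is charged the whole horizon; otherwise the
-- run is good, with `ok` the windows free of column failures. A failed window is charged for its
-- own plays and for making its successor early.
open scoped Classical in
theorem pairRegret_le (hu : TopPair u a b) {T : ℕ} (hT : 3 ≤ T) {ord : List (Fin n × Fin n)}
    (hnd : ord.Nodup) (hord : ∀ p, p ∈ ord ↔ p.1 ≠ p.2) (x : ℕ → Fin n → Fin n → ℝ)
    {g : ℝ} (hg0 : 0 < g) (hg1 : g < 1) (hg : ∀ i j, j ≠ a → j ≠ b → g ≤ u i * (u b - u j)) :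
    pairRegret u (play T ord x) T ≤
      (if RowFailure u T ord x ((T + 1) / 2) then (T : ℝ) else 0) +
      (∑ w ∈ Finset.range (numWindows T),
        if ColFailure u T ord x ((T + 1) / 2) w then failureCost n g ord.length w else 0) +
      regularBound u a b g T ord.length := by
  have hne : ord ≠ [] := List.ne_nil_of_mem ((hord (a, b)).2 hu.ne)
  have hlog : 0 < Real.log T := Real.log_pos (by exact_mod_cast (by omega : 1 < T))
  have hP' : ∀ m, ∃ p, (run T ord x m).queue.head? = some p := fun m =>
    (run_succ_samples T hnd hord hne x m).imp fun p hp => hp.1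
  choose P hP using hP'
  have hPne : ∀ m, (P m).1 ≠ (P m).2 := fun m =>
    (hord _).1 ((run_wellFormed T hnd hord hne x m).1.queue_sublist.subset
      (List.mem_of_mem_head? (hP m)))
  have hreg : pairRegret u (play T ord x) T ≤ ∑ t ∈ Finset.range T, gap u a b (P (t / 2)) := by
    have h1 := hu.bestPairValue_le
    simp only [pairRegret, play, hP, Option.elim_some, gap, Finset.sum_sub_distrib,
      Finset.sum_const, Finset.card_range, nsmul_eq_mul]
    gcongr
  have hreg0 : 0 ≤ regularBound u a b g T ord.length := regularBound_nonneg hu hlog.le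
  have hcol0 : 0 ≤ ∑ w ∈ Finset.range (numWindows T),
      if ColFailure u T ord x ((T + 1) / 2) w then failureCost n g ord.length w else 0 :=
    Finset.sum_nonneg fun w _ => by
      split_ifs <;> [exact failureCost_nonneg _ _ _ _; rfl]
  by_cases hrow : RowFailure u T ord x ((T + 1) / 2)
  · rw [if_pos hrow]
    have h1 : ∑ t ∈ Finset.range T, gap u a b (P (t / 2)) ≤ T := by
      refine (Finset.sum_le_card_nsmul _ _ 1 fun t _ => (hu.gap_lt_one _).le).trans ?_
      simp
    linarith
  rw [if_neg hrow]
  obtain ⟨ok, hok⟩ : ∃ ok : ℕ → Prop, ∀ w, ok w ↔ ¬ ColFailure u T ord x ((T + 1) / 2) w :=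
    ⟨_, fun _ => Iff.rfl⟩
  have hite : ∀ w (c : ℝ), (if ok w then 0 else c) =
      if ColFailure u T ord x ((T + 1) / 2) w then c else 0 := by
    intro w c
    by_cases h : ColFailure u T ord x ((T + 1) / 2) w <;> simp [hok, h]
  have hgood : GoodRun u a b T ord x ((T + 1) / 2) ok := by
    refine ⟨hu, hlog, hnd, hord, fun m hm => ?_, fun m hm hm' => ?_⟩
    · by_contra h
      exact hrow ⟨m, hm, h⟩
    · by_contra h
      exact (hok _).1 hm' ⟨m, hm, rfl, h⟩
  have h1 := hgood.sum_gap_le (by omega)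
    (fun m hm => window_lt_numWindows T hnd hord hne x (m := m) (by omega))
    (sum_log_window_le (by omega)) hg0 hg1 hg hP
  have h2 := sum_earlyWindow_le ok (2 * ord.length * (66 * Real.log T / g ^ 2)) (numWindows T)
  have h3 := sum_range_half_le (f := fun m => gap u a b (P m)) (fun m => hu.gap_nonneg (hPne m)) T
  simp only [hite] at h1 h2
  have h4 : ∑ w ∈ Finset.range (numWindows T),
      (if ColFailure u T ord x ((T + 1) / 2) w then failureCost n g ord.length w else 0) =
      2 * (∑ w ∈ Finset.range (numWindows T), if ColFailure u T ord x ((T + 1) / 2) w then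
        ((2 : ℝ) ^ 2 ^ w + 2 * ord.length) else 0) +
      2 * (n ^ 2 * (66 * (∑ w ∈ Finset.range (numWindows T),
        if ColFailure u T ord x ((T + 1) / 2) w then
          2 * Real.log ((2 : ℝ) ^ 2 ^ w) else 0) / g ^ 2)) := by
    have h5 : ∀ S : ℝ, 2 * (n ^ 2 * (66 * S / g ^ 2)) = 132 * n ^ 2 / g ^ 2 * S := fun S => by
      ring
    rw [h5, Finset.mul_sum, Finset.mul_sum, ← Finset.sum_add_distrib]
    refine Finset.sum_congr rfl fun w _ => ?_
    split_ifs
    · rw [failureCost]; ring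
    · simp
  rw [h4, regularBound]
  have h5 : 2 * (n ^ 2 * (66 * (∑ w ∈ Finset.range (numWindows T),
        if EarlyWindow ok (2 * ord.length * (66 * Real.log T / g ^ 2)) w then
          Real.log ((2 : ℝ) ^ 2 ^ w) else 0) / g ^ 2)) ≤
      2 * (n ^ 2 * (66 * (Real.log 2 + (∑ w ∈ Finset.range (numWindows T),
        if ColFailure u T ord x ((T + 1) / 2) w then 2 * Real.log ((2 : ℝ) ^ 2 ^ w) else 0) +
        4 * max (Real.log (2 * ord.length * (66 * Real.log T / g ^ 2))) 0) / g ^ 2)) := by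
    gcongr
  have h6 : ∀ S m : ℝ, 2 * (n ^ 2 * (66 * (Real.log 2 + S + m) / g ^ 2)) =
      2 * (n ^ 2 * (66 * S / g ^ 2)) + 2 * n ^ 2 * (66 / g ^ 2) * (Real.log 2 + m) := by
    intro S m; ring
  rw [h6] at h5
  linarith

theorem exp_neg_two_mul_log {h : ℝ} (hh : 0 < h) :
    Real.exp (-(2 * Real.log h)) = 1 / h ^ 2 := by
  rw [Real.exp_neg, two_mul, Real.exp_add, Real.exp_log hh, sq, one_div]

variable {Ω : Type*} {mΩ : MeasurableSpace Ω} {μ : Measure Ω} [IsProbabilityMeasure μ]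
  {ε : ℕ → Fin n → Fin n → Ω → ℝ} {T : ℕ} {ord : List (Fin n × Fin n)}

theorem measurableState_run_outcomes (hε : ∀ t i j, Measurable (ε t i j)) (u : Fin n → ℝ)
    (T : ℕ) (ord : List (Fin n × Fin n)) (m : ℕ) :
    MeasurableState fun ω => run T ord (outcomes u ε ω) m :=
  (measurableState_run_past u ε T ord m).mono (past_le hε m)

theorem measurableSet_rowFailure (hε : ∀ t i j, Measurable (ε t i j)) (M : ℕ) :
    MeasurableSet {ω | RowFailure u T ord (outcomes u ε ω) M} := by
  refine measurableSet_setOfPred.2 (Measurable.exists fun m => measurable_const.and ?_)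
  exact ((measurableState_run_outcomes hε u T ord m).rowAccurate u T).not

theorem measurableSet_colFailure (hε : ∀ t i j, Measurable (ε t i j)) (M w : ℕ) :
    MeasurableSet {ω | ColFailure u T ord (outcomes u ε ω) M w} := by
  refine measurableSet_setOfPred.2 (Measurable.exists fun m => measurable_const.and ?_)
  have h := measurableState_run_outcomes hε u T ord m
  exact (measurable_eq_const h.w w).and (h.colAccurate u).not

theorem integrable_pairRegret (hε : ∀ t i j, Measurable (ε t i j)) (u : Fin n → ℝ) (T : ℕ)
    (ord : List (Fin n × Fin n)) :
    Integrable (fun ω => pairRegret u (play T ord (outcomes u ε ω)) T) μ := by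
  refine (integrable_const _).sub (integrable_finsetSum _ fun t _ => ?_)
  have hm : Measurable fun ω => (play T ord (outcomes u ε ω) t).elim 0 fun p => u p.1 * u p.2 :=
    measurable_of_countable_cases (measurableState_run_outcomes hε u T ord (t / 2)).queue fun l =>
      ⟨fun _ => l.head?.elim 0 fun p => u p.1 * u p.2, measurable_const, by rintro ω rfl; rfl⟩
  refine Integrable.of_bound hm.aestronglyMeasurable (∑ p : Fin n × Fin n, |u p.1 * u p.2|)
    (Filter.Eventually.of_forall fun ω => ?_)
  cases play T ord (outcomes u ε ω) t with
  | none =>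
    rw [Option.elim_none, norm_zero]
    exact Finset.sum_nonneg fun p _ => abs_nonneg _
  | some p =>
    exact Finset.single_le_sum (f := fun p : Fin n × Fin n => |u p.1 * u p.2|)
      (fun p _ => abs_nonneg _) (Finset.mem_univ p)

theorem measureReal_le_of_le {Ω : Type*} {mΩ : MeasurableSpace Ω} {μ : Measure Ω} {B : Set Ω} {c e : ℝ} {k : ℕ} (he : 0 ≤ e)
    (h : μ B ≤ n ^ 2 * (k : ENNReal) * (2 * ENNReal.ofReal e)) (hc : n ^ 2 * k * (2 * e) ≤ c) :
    μ.real B ≤ c := by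
  refine le_trans ?_ hc
  refine ENNReal.toReal_le_of_le_ofReal (by positivity) (h.trans_eq ?_)
  rw [ENNReal.ofReal_mul (by positivity), ENNReal.ofReal_mul (by positivity),
    ENNReal.ofReal_mul (by norm_num), ENNReal.ofReal_pow (by positivity)]
  simp

theorem length_le_of_nodup (hnd : ord.Nodup) : (ord.length : ℝ) ≤ n ^ 2 := by
  have := hnd.length_le_card
  rw [Fintype.card_prod, Fintype.card_fin] at this
  rw [sq]
  exact_mod_cast this

/-- Probability times cost is bounded in each case: 2n²/T times T for rows, and O(1/h_w) times
O(h_w) for the columns of each window. -/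
theorem integral_pairRegret_le (hu : TopPair u a b) (hε : ∀ t i j, Measurable (ε t i j))
    (hind : iIndepFun (fun (t : ℕ) (ω : Ω) (p : Fin n × Fin n) => ε t p.1 p.2 ω) μ)
    (hsub : ∀ t i j, HasSubgaussianMGF (ε t i j) (1 / 4) μ)
    (hT : 3 ≤ T) (hnd : ord.Nodup) (hord : ∀ p, p ∈ ord ↔ p.1 ≠ p.2)
    {g : ℝ} (hg0 : 0 < g) (hg1 : g < 1) (hg : ∀ i j, j ≠ a → j ≠ b → g ≤ u i * (u b - u j)) :
    ∫ ω, pairRegret u (play T ord (outcomes u ε ω)) T ∂μ ≤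
      2 * n ^ 2 + numWindows T * ((2 * (1 + 2 * n ^ 2) + 264 * n ^ 2 / g ^ 2) *
        (2 * n ^ 2 * (1 + 2 * n ^ 2))) + regularBound u a b g T ord.length := by
  classical
  have hne : ord ≠ [] := List.ne_nil_of_mem ((hord (a, b)).2 hu.ne)
  have hlen := length_le_of_nodup hnd
  set M := (T + 1) / 2 with hM
  have hT0 : (0 : ℝ) < T := by exact_mod_cast (by omega : 0 < T)
  have hrowM := measurableSet_rowFailure (u := u) (T := T) (ord := ord) hε M
  have hcolM := measurableSet_colFailure (u := u) (T := T) (ord := ord) hε M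
  have hrow : μ.real {ω | RowFailure u T ord (outcomes u ε ω) M} ≤ 2 * n ^ 2 / T := by
    refine measureReal_le_of_le (Real.exp_pos _).le
      (measure_rowInaccurate_le hε hind hsub hnd hord hne (by omega)) ?_
    rw [exp_neg_two_mul_log hT0]
    have h1 : (M : ℝ) ≤ T := by exact_mod_cast (by omega : M ≤ T)
    calc (n : ℝ) ^ 2 * M * (2 * (1 / T ^ 2)) ≤ (n : ℝ) ^ 2 * T * (2 * (1 / T ^ 2)) := by gcongr
      _ = 2 * (n : ℝ) ^ 2 / T := by field_simp
  have hcol : ∀ w, μ.real {ω | ColFailure u T ord (outcomes u ε ω) M w} ≤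
      2 * n ^ 2 * (1 + 2 * n ^ 2) / 2 ^ 2 ^ w := by
    intro w
    refine measureReal_le_of_le (Real.exp_pos _).le
      (measure_colInaccurate_le hε hind hsub hnd hord hne M w) ?_
    have hH := two_le_window w
    rw [exp_neg_two_mul_log (by positivity)]
    push_cast
    set H : ℝ := (2 : ℝ) ^ 2 ^ w
    calc (n : ℝ) ^ 2 * (H + 2 * ord.length) * (2 * (1 / H ^ 2))
        ≤ n ^ 2 * (H * (1 + 2 * n ^ 2)) * (2 * (1 / H ^ 2)) := by
          gcongr
          nlinarith
      _ = 2 * n ^ 2 * (1 + 2 * n ^ 2) / H := by field_simp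
  have hcost : ∀ w, failureCost n g ord.length w ≤
      (2 * (1 + 2 * n ^ 2) + 264 * n ^ 2 / g ^ 2) * 2 ^ 2 ^ w := by
    intro w
    have hH := two_le_window w
    have hL : Real.log ((2 : ℝ) ^ 2 ^ w) ≤ 2 ^ 2 ^ w := Real.log_le_self (by positivity)
    rw [failureCost]
    set H : ℝ := (2 : ℝ) ^ 2 ^ w
    calc 2 * (H + 2 * ord.length) + 264 * n ^ 2 / g ^ 2 * Real.log H
        ≤ 2 * (H * (1 + 2 * n ^ 2)) + 264 * n ^ 2 / g ^ 2 * H := by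
          gcongr
          nlinarith
      _ = _ := by ring
  have hint1 : Integrable (fun ω => if RowFailure u T ord (outcomes u ε ω) M then (T : ℝ) else 0)
      μ := (integrable_const (T : ℝ)).indicator hrowM
  have hint2 : ∀ w, Integrable (fun ω => if ColFailure u T ord (outcomes u ε ω) M w then
      failureCost n g ord.length w else 0) μ := fun w =>
    (integrable_const (failureCost n g ord.length w)).indicator (hcolM w)
  have hval1 : ∫ ω, (if RowFailure u T ord (outcomes u ε ω) M then (T : ℝ) else 0) ∂μ =
      μ.real {ω | RowFailure u T ord (outcomes u ε ω) M} * T := by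
    rw [← smul_eq_mul]
    exact integral_indicator_const (T : ℝ) hrowM
  have hval2 : ∀ w, ∫ ω, (if ColFailure u T ord (outcomes u ε ω) M w then
      failureCost n g ord.length w else 0) ∂μ =
      μ.real {ω | ColFailure u T ord (outcomes u ε ω) M w} * failureCost n g ord.length w := by
    intro w
    rw [← smul_eq_mul]
    exact integral_indicator_const (failureCost n g ord.length w) (hcolM w)
  have hint3 : Integrable (fun ω => ∑ w ∈ Finset.range (numWindows T),
      if ColFailure u T ord (outcomes u ε ω) M w then failureCost n g ord.length w else 0) μ :=
    integrable_finsetSum _ fun w _ => hint2 w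
  have hint4 : Integrable (fun ω => (if RowFailure u T ord (outcomes u ε ω) M then (T : ℝ) else 0) +
      ∑ w ∈ Finset.range (numWindows T),
        if ColFailure u T ord (outcomes u ε ω) M w then failureCost n g ord.length w else 0) μ :=
    hint1.add hint3
  calc ∫ ω, pairRegret u (play T ord (outcomes u ε ω)) T ∂μ
      ≤ ∫ ω, ((if RowFailure u T ord (outcomes u ε ω) M then (T : ℝ) else 0) +
        (∑ w ∈ Finset.range (numWindows T),
          if ColFailure u T ord (outcomes u ε ω) M w then failureCost n g ord.length w else 0) +
        regularBound u a b g T ord.length) ∂μ :=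
        integral_mono (integrable_pairRegret hε u T ord)
          (hint4.add (integrable_const _))
          fun ω => pairRegret_le hu hT hnd hord (outcomes u ε ω) hg0 hg1 hg
    _ = μ.real {ω | RowFailure u T ord (outcomes u ε ω) M} * T +
        (∑ w ∈ Finset.range (numWindows T),
          μ.real {ω | ColFailure u T ord (outcomes u ε ω) M w} * failureCost n g ord.length w) +
        regularBound u a b g T ord.length := by
        rw [integral_add hint4 (integrable_const _), integral_add hint1 hint3, hval1,
          integral_finsetSum _ fun w _ => hint2 w]
        simp [hval2]
    _ ≤ _ := by
        refine add_le_add (add_le_add ?_ ?_) le_rfl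
        · calc _ ≤ 2 * (n : ℝ) ^ 2 / T * T := mul_le_mul_of_nonneg_right hrow hT0.le
            _ = _ := by field_simp
        · refine (Finset.sum_le_card_nsmul _ _ ((2 * (1 + 2 * n ^ 2) + 264 * n ^ 2 / g ^ 2) *
            (2 * n ^ 2 * (1 + 2 * n ^ 2))) fun w _ => ?_).trans_eq (by simp)
          calc _ ≤ 2 * n ^ 2 * (1 + 2 * n ^ 2) / 2 ^ 2 ^ w *
              ((2 * (1 + 2 * n ^ 2) + 264 * n ^ 2 / g ^ 2) * 2 ^ 2 ^ w) :=
                mul_le_mul (hcol w) (hcost w) (failureCost_nonneg _ _ _ _) (by positivity)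
            _ = _ := by field_simp

/-- The threshold for early windows is at most a constant times log T, so its logarithm is O(log log
T). Bounding the length of `ord` by n² makes the constant independent of the order. -/
theorem exists_regularBound_le (u : Fin n → ℝ) (a b : Fin n) {g : ℝ} (hg0 : 0 < g) :
    ∃ c : ℝ, 0 < c ∧ ∀ ord : List (Fin n × Fin n), ord.Nodup → ord ≠ [] → ∀ T : ℕ, 3 ≤ T →
      regularBound u a b g T ord.length ≤ 2112 * Real.log T *
        (∑ i ∈ Finset.univ.filter (fun i => i ≠ a ∧ i ≠ b), 1 / (u a * (u b - u i))) +
        c * Real.log (Real.log T) := by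
  have hn : (0 : ℝ) < n := by exact_mod_cast a.pos
  have hl2 := Real.log_pos one_lt_two
  have hll3 := (log_log_le_of_three_le (le_refl 3)).1
  set K : ℝ := 132 * n ^ 2 / g ^ 2 with hK
  refine ⟨2 * n ^ 2 * (66 / g ^ 2) * ((Real.log 2 + 4 * |Real.log K|) / Real.log (Real.log 3) + 4),
    by positivity, fun ord hnd hne T hT => ?_⟩
  have h3 := (log_log_le_of_three_le hT).2
  have hlT : 0 < Real.log T := Real.log_pos (by exact_mod_cast (by omega : 1 < T))
  have hlen := length_le_of_nodup hnd
  have hlen0 : (0 : ℝ) < ord.length := by exact_mod_cast List.length_pos_iff.2 hne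
  have hlog : max (Real.log (2 * ord.length * (66 * Real.log T / g ^ 2))) 0 ≤
      |Real.log K| + Real.log (Real.log T) := by
    refine max_le ?_ (by have := abs_nonneg (Real.log K); linarith)
    have h4 : 2 * ord.length * (66 * Real.log T / g ^ 2) ≤ K * Real.log T := by
      calc 2 * ord.length * (66 * Real.log T / g ^ 2)
          ≤ 2 * n ^ 2 * (66 * Real.log T / g ^ 2) := by gcongr
        _ = K * Real.log T := by rw [hK]; ring
    have h5 := Real.log_le_log (by positivity) h4
    rw [Real.log_mul (by positivity) hlT.ne'] at h5
    have := le_abs_self (Real.log K)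
    linarith
  rw [regularBound, mul_assoc (2 * (n : ℝ) ^ 2 * (66 / g ^ 2))]
  gcongr
  have h4 : Real.log 2 + 4 * |Real.log K| ≤
      (Real.log 2 + 4 * |Real.log K|) / Real.log (Real.log 3) * Real.log (Real.log T) := by
    rw [div_mul_eq_mul_div, le_div_iff₀ hll3]
    gcongr
  rw [add_mul]
  linarith

end PairElimMono

/-! ### Choice of the constants -/

theorem theorem3 :
    ∃ cu : ℝ, 0 < cu ∧
      ∀ (N : ℕ) (hN : 1 ≤ N) (u : Fin (2 * N) → ℝ),
        (∀ i, u i ∈ Set.Ioo (0 : ℝ) 1) → Antitone u →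
        (∀ i : Fin (2 * N), 2 ≤ i.val → u i < u ⟨1, by omega⟩) →
        ∃ cp : ℝ, 0 < cp ∧
          ∀ (ord : List (Fin (2 * N) × Fin (2 * N))),
            ord.Nodup → (∀ p, p ∈ ord ↔ p.1 ≠ p.2) →
          ∀ (Ω : Type*) [MeasurableSpace Ω] (μ : Measure Ω) [IsProbabilityMeasure μ]
            (ε : ℕ → Fin (2 * N) → Fin (2 * N) → Ω → ℝ),
            (∀ t i j, Measurable (ε t i j)) →
            iIndepFun (fun (t : ℕ) (ω : Ω) (p : Fin (2 * N) × Fin (2 * N)) => ε t p.1 p.2 ω) μ →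
            (∀ t i j, HasSubgaussianMGF (ε t i j) (1 / 4) μ) →
          ∀ T : ℕ, 3 ≤ T →
            Integrable (fun ω => pairRegret u
              (PairElimMono.play T ord fun t i j => u i * u j + ε t i j ω) T) μ ∧
            ∫ ω, pairRegret u
              (PairElimMono.play T ord fun t i j => u i * u j + ε t i j ω) T ∂μ
              ≤ cu * monoComplexity hN u * Real.log T + cp * Real.log (Real.log T) := by
  -- 2112 = 2 · 1056, with two plays per iteration.
  refine ⟨2112, by norm_num, fun N hN u hu01 hanti htop => ?_⟩
  have hu : PairElimMono.TopPair u ⟨0, by omega⟩ ⟨1, by omega⟩ := by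
    refine ⟨fun i => (hu01 i).1, fun i => (hu01 i).2, by simp, hanti (by simp),
      fun i h0 h1 => htop i ?_⟩
    have h0 : i.val ≠ 0 := fun h => h0 (Fin.ext h)
    have h1 : i.val ≠ 1 := fun h => h1 (Fin.ext h)
    omega
  have hcomplexity : monoComplexity hN u = ∑ i ∈ Finset.univ.filter (fun i : Fin (2 * N) =>
      i ≠ ⟨0, by omega⟩ ∧ i ≠ ⟨1, by omega⟩),
      1 / (u ⟨0, by omega⟩ * (u ⟨1, by omega⟩ - u i)) := by
    rw [monoComplexity]
    refine Finset.sum_congr (Finset.filter_congr fun i _ => ⟨fun h => ⟨?_, ?_⟩, fun h => ?_⟩)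
      fun _ _ => rfl
    · rintro rfl
      simp at h
    · rintro rfl
      simp at h
    · refine ⟨?_, sub_pos.2 (hu.lt i h.1 h.2)⟩
      have h0 : i.val ≠ 0 := fun h' => h.1 (Fin.ext h')
      have h1 : i.val ≠ 1 := fun h' => h.2 (Fin.ext h')
      omega
  obtain ⟨g, hg0, hg1, hg⟩ := hu.exists_gap
  obtain ⟨c₁, hc₁, hregular⟩ := PairElimMono.exists_regularBound_le u ⟨0, by omega⟩ ⟨1, by omega⟩ hg0
  obtain ⟨c₂, hc₂, hwindows⟩ := PairElimMono.exists_numWindows_le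
  have hll3 := (PairElimMono.log_log_le_of_three_le (le_refl 3)).1
  set n : ℝ := ((2 * N : ℕ) : ℝ) with hn
  set B : ℝ := (2 * (1 + 2 * n ^ 2) + 264 * n ^ 2 / g ^ 2) * (2 * n ^ 2 * (1 + 2 * n ^ 2)) with hB
  have hB0 : 0 ≤ B := by positivity
  -- The summands pay for row failures, for column failures over all windows, and for the pairs that
  -- avoid the two best items.
  refine ⟨2 * n ^ 2 / Real.log (Real.log 3) + c₂ * B + c₁, by positivity,
    fun ord hnd hord Ω _ μ _ ε hε hind hsub T hT =>
      ⟨PairElimMono.integrable_pairRegret hε u T ord, ?_⟩⟩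
  have hne : ord ≠ [] := List.ne_nil_of_mem ((hord (_, _)).2 hu.ne)
  have h1 := PairElimMono.integral_pairRegret_le hu hε hind hsub hT hnd hord hg0 hg1 hg
  have h2 := hregular ord hnd hne T hT
  have h3 := mul_le_mul_of_nonneg_right (hwindows T hT) hB0
  have h4 : 2 * n ^ 2 ≤ 2 * n ^ 2 / Real.log (Real.log 3) * Real.log (Real.log T) := by
    rw [div_mul_eq_mul_div, le_div_iff₀ hll3]
    exact mul_le_mul_of_nonneg_left (PairElimMono.log_log_le_of_three_le hT).2 (by positivity)
  rw [← hcomplexity] at h2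
  refine h1.trans ?_
  rw [add_mul, add_mul]
  linarith
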